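/- **Polygons.** A column-convex polygon of width $m\ge 1$ on the square lattice, up to translation, is a pair of self-avoiding partially directed paths (steps north, south, east; $m$ east steps each), the top path and the bottom path, with the same two end points and no other common lattice site, the top path starting with a north step and ending with an east step, the bottom path starting with an east step and having no south step at abscissa $m$. Let $\overline N_i,\overline S_i$ (resp. $\underline N_i,\underline S_i$), $0\le i\le m$, be the numbers of north and south steps of the top (resp. bottom) path at abscissa $i$. The polygon is *convex* if its perimeter equals that of its minimal bounding rectangle. A convex polygon is *directed convex* if it contains the south-west corner of this rectangle, *staircase* if it contains the south-west and north-east corners, a *stack* if it contains the south-east and north-east corners, a *Ferrers graph* if it contains the south-west, south-east and north-east corners. A column-convex polygon is a *bar-graph* if it contains the bottom edge of its minimal bounding rectangle, and *directed column-convex* if its bottom path has no south step. **Self-reciprocity.** A rational function $R(u_1,\dots,u_k)$ over $\mathbb R$ is self-reciprocal if $R(1/u_1,\dots,1/u_k)=\pm u_1^{\beta_1}\cdots u_k^{\beta_k}R(u_1,\dots,u_k)$ for some integers $\beta_j$ and some sign. Let $\mathcal P$ be one of the families: Ferrers graphs, stacks, staircase polygons, bar-graphs, column-convex polygons. Let $m\ge1$,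 let $\mathcal P_m$ be the set of polygons of width $m$ in $\mathcal P$, and let $w=(w_1,\dots,w_k)$ be statistics, each a linear combination with integer coefficients of the $\overline N_i,\overline S_i,\underline N_i,\underline S_i$, such that only finitely many $P\in\mathcal P_m$ have any given value of $w(P)$. Then $\sum_{P\in\mathcal P_m}u_1^{w_1(P)}\cdots u_k^{w_k(P)}$ is a rational function of $u_1,\dots,u_k$ (that is, its product with some nonzero Laurent polynomial $D$ is a Laurent polynomial $N$, and the rational function is $N/D$), and it is self-reciprocal. **Inversion relations.** For each family below let $H_m(y,q)$ be the generating function of its polygons of width $m$ by half the vertical perimeter ($y$) and by the area ($q$), let $G(x,y,q)=\sum_{m\ge1}H_m(y,q)x^m$, and write $H_m(y),G(x,y)$ for the versions by half the vertical perimeter only and $H_m(q),G(x,q)$ for those by the area only. In the following cases the $H_m$ are well defined and rational, and the relations hold, as identities of rational functions and of power series in $x$ over rational functions, for all $m\ge1$ unless stated otherwise. * Column-convex: $H_m(1/y,1/q)=-\frac1{yq^m}H_m(y,q)$ and $G(x,y,q)+yG(xq,1/y,1/q)=0$. * Ferrers: $H_m(1/y,1/q)=(-1)^my^{m-2}q^{(m^2-3m)/2}H_m(y,q)$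 and $G(x,y)-y^2G(-x/y,1/y)=0$. * Stack: $H_m(1/y,1/q)=-y^{2m-3}q^{m^2-2m}H_m(y,q)$ and $G(x,y)+y^3G(x/y^2,1/y)=0$. * Staircase: $H_m(1/y,1/q)=-y^{m-1}H_m(y,q)$ for $m\ge2$, and $G(x,y,q)+yG(x/y,1/y,1/q)=-x$. * Directed convex: $H_m(1/y)=-y^{m-2}H_m(y)$ and $G(x,y)+y^2G(x/y,1/y)=0$. * Convex: $G(x,y)+y^3G(x/y,1/y)=xy-x^3y\,\frac{\partial}{\partial x}\frac{1-x+y}{\Delta(x,y)}$, where $\Delta(x,y)=1-2x-2y-2xy+x^2+y^2$. * Bar-graph: $H_m(1/y,1/q)=\frac{(-1)^m}{yq^m}H_m(y,q)$ and $G(x,y,q)-yG(-xq,1/y,1/q)=0$. * Directed column-convex: $H_m(1/q)=-\frac1qH_m(q)$ and $G(x,q)+qG(x,1/q)=0$. -/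

import Mathlib

noncomputable section

/-! ### Column-convex polygons as pairs of partially directed paths -/

namespace Polyomino

/-- A self-avoiding partially directed path (steps north, south and east) with `m` east steps,
starting at height `0` at abscissa `0`, is recorded by its signed vertical runs: `v i > 0` means
`v i` north steps at abscissa `i`, and `v i < 0` means `-v i` south steps at abscissa `i`
(being self-avoiding, the path cannot make both kinds of steps at the same abscissa).
`level v k` is the height of the path on arrival at abscissa `k`; for `k = i + 1` it is the
height of the east step that goes from abscissa `i` to abscissa `i + 1`. -/
def level {m : ℕ} (v : Fin (m + 1) → ℤ) (k : ℕ) : ℤ :=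
  ∑ i : Fin (m + 1), if (i : ℕ) < k then v i else 0

/-- The lattice sites visited by the path. -/
def pathVertices {m : ℕ} (v : Fin (m + 1) → ℤ) : Set (ℤ × ℤ) :=
  {p | ∃ i : Fin (m + 1), p.1 = (i : ℤ) ∧ p.2 ∈ Set.uIcc (level v (i : ℕ)) (level v ((i : ℕ) + 1))}

/-- A column-convex polygon of width `m`, up to translation: a top path and a bottom path, both
from `(0, 0)` to a common end point at abscissa `m`, that meet at no other lattice site. The end
points are placed so that the bottom path starts with an east step, the top path starts with a
north step, the top path ends with an east step, and the bottom path makes no south step at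
abscissa `m`. -/
@[ext] structure ColumnConvexPolygon (m : ℕ) where
  top : Fin (m + 1) → ℤ
  bot : Fin (m + 1) → ℤ
  same_end : ∑ i, top i = ∑ i, bot i
  top_zero : 0 < top 0
  bot_zero : bot 0 = 0
  top_last : top (Fin.last m) = 0
  bot_last : 0 ≤ bot (Fin.last m)
  self_avoiding :
    pathVertices top ∩ pathVertices bot = {((0 : ℤ), (0 : ℤ)), ((m : ℤ), ∑ i, top i)}

namespace ColumnConvexPolygon

variable {m : ℕ} (P : ColumnConvexPolygon m)

/-- Number of north steps of the top path at abscissa `i`. -/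
def topN (i : Fin (m + 1)) : ℤ := max (P.top i) 0

/-- Number of south steps of the top path at abscissa `i`. -/
def topS (i : Fin (m + 1)) : ℤ := max (-P.top i) 0

/-- Number of north steps of the bottom path at abscissa `i`. -/
def botN (i : Fin (m + 1)) : ℤ := max (P.bot i) 0

/-- Number of south steps of the bottom path at abscissa `i`. -/
def botS (i : Fin (m + 1)) : ℤ := max (-P.bot i) 0

/-- The number of vertical steps of the polygon. -/
def verticalPerimeter : ℤ := ∑ i, (P.topN i + P.topS i + P.botN i + P.botS i)

/-- Half of the vertical perimeter; the division is exact, see `two_mul_halfVertical`. -/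
def halfVertical : ℤ := P.verticalPerimeter / 2

theorem verticalPerimeter_eq : P.verticalPerimeter = 2 * ∑ i, (P.topN i + P.botS i) := by
  have h1 : ∀ i, P.topN i - P.topS i = P.top i := fun i => by
    simp only [topN, topS]; omega
  have h2 : ∀ i, P.botN i - P.botS i = P.bot i := fun i => by
    simp only [botN, botS]; omega
  have h := P.same_end
  simp only [← h1, ← h2, Finset.sum_sub_distrib] at h
  simp only [verticalPerimeter, Finset.sum_add_distrib]
  linarith

theorem two_mul_halfVertical : 2 * P.halfVertical = P.verticalPerimeter := by
  rw [halfVertical, P.verticalPerimeter_eq]; omega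

/-- The total perimeter: the vertical steps and the `2 m` east steps of the two paths. -/
def perimeter : ℤ := P.verticalPerimeter + 2 * (m : ℤ)

/-- The number of lattice cells enclosed: the sum of the heights of the `m` columns. -/
def area : ℤ := ∑ i : Fin m, (level P.top ((i : ℕ) + 1) - level P.bot ((i : ℕ) + 1))

/-- The lattice sites of the polygon. -/
def vertices : Set (ℤ × ℤ) := pathVertices P.top ∪ pathVertices P.bot

/-- The height of the bottom edge of the minimal bounding rectangle. -/
def yMin : ℤ := sInf (Prod.snd '' P.vertices)

/-- The height of the top edge of the minimal bounding rectangle. -/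
def yMax : ℤ := sSup (Prod.snd '' P.vertices)

/-- Convex: the perimeter equals that of the minimal bounding rectangle. -/
def IsConvex : Prop := P.perimeter = 2 * ((m : ℤ) + (P.yMax - P.yMin))

/-- The polygon contains the south-west corner of its minimal bounding rectangle. -/
def HasSW : Prop := ((0 : ℤ), P.yMin) ∈ P.vertices

/-- The polygon contains the south-east corner of its minimal bounding rectangle. -/
def HasSE : Prop := ((m : ℤ), P.yMin) ∈ P.vertices

/-- The polygon contains the north-east corner of its minimal bounding rectangle. -/
def HasNE : Prop := ((m : ℤ), P.yMax) ∈ P.vertices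

end ColumnConvexPolygon

/-- Ferrers graphs, with flat bottom and full right side. -/
def ferrers (m : ℕ) : Set (ColumnConvexPolygon m) :=
  {P | P.IsConvex ∧ P.HasSW ∧ P.HasSE ∧ P.HasNE}

/-- Stack polygons, with full right side. -/
def stackPolygons (m : ℕ) : Set (ColumnConvexPolygon m) :=
  {P | P.IsConvex ∧ P.HasSE ∧ P.HasNE}

/-- Staircase polygons. -/
def staircase (m : ℕ) : Set (ColumnConvexPolygon m) :=
  {P | P.IsConvex ∧ P.HasSW ∧ P.HasNE}

/-- Directed convex polygons. -/
def directedConvex (m : ℕ) : Set (ColumnConvexPolygon m) :=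
  {P | P.IsConvex ∧ P.HasSW}

/-- Convex polygons. -/
def convexPolygons (m : ℕ) : Set (ColumnConvexPolygon m) :=
  {P | P.IsConvex}

/-- Bar-graphs: the polygon contains the whole bottom edge of its minimal bounding rectangle. -/
def bargraphs (m : ℕ) : Set (ColumnConvexPolygon m) :=
  {P | ∀ i : Fin m, level P.bot ((i : ℕ) + 1) = P.yMin}

/-- Directed column-convex polygons: the bottom path has only north and east steps. -/
def directedColumnConvex (m : ℕ) : Set (ColumnConvexPolygon m) :=
  {P | ∀ i, P.botS i = 0}

/-- All column-convex polygons. -/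
def columnConvex (m : ℕ) : Set (ColumnConvexPolygon m) := Set.univ

/-- The five families to which the general self-reciprocity statement applies. -/
inductive Family
  | ferrers
  | stack
  | staircase
  | bargraphs
  | columnConvex

/-- The polygons of width `m` of a family. -/
def Family.ofWidth : Family → (m : ℕ) → Set (ColumnConvexPolygon m)
  | .ferrers => Polyomino.ferrers
  | .stack => Polyomino.stackPolygons
  | .staircase => Polyomino.staircase
  | .bargraphs => Polyomino.bargraphs
  | .columnConvex => Polyomino.columnConvex

/-- A `k`-tuple of statistics, each linear with integer coefficients in the numbers of north and
south steps of the top and bottom paths at the various abscissas. -/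
def linearStat {m k : ℕ} (a b c d : Fin k → Fin (m + 1) → ℤ) (P : ColumnConvexPolygon m) :
    Fin k → ℤ :=
  fun j => ∑ i, (a j i * P.topN i + b j i * P.topS i + c j i * P.botN i + d j i * P.botS i)

/-! ### Rational generating functions and inversion of the variables -/

/-- Laurent polynomials over `ℝ` in the variables `u_0, …, u_{k-1}`. -/
abbrev Laurent (k : ℕ) : Type := AddMonoidAlgebra ℝ (Fin k → ℤ)

/-- The field `ℝ(u_0, …, u_{k-1})` of rational functions, as fractions of Laurent polynomials. -/
abbrev RatFun (k : ℕ) : Type := FractionRing (Laurent k)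

/-- The Laurent monomial `u ^ β`. -/
def monom {k : ℕ} (β : Fin k → ℤ) : RatFun k :=
  algebraMap (Laurent k) (RatFun k) (AddMonoidAlgebra.single β 1)

/-- The substitution `R(u) ↦ R(1/u)`. -/
def invVars (k : ℕ) : RatFun k ≃+* RatFun k :=
  IsFractionRing.ringEquivOfRingEquiv (A := Laurent k) (B := Laurent k)
    (AddMonoidAlgebra.domCongr ℝ ℝ (AddEquiv.neg (Fin k → ℤ))).toRingEquiv

/-- `R(1/u) = ± u ^ β R(u)` for some exponent `β` and some sign. -/
def IsSelfReciprocal {k : ℕ} (R : RatFun k) : Prop :=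
  ∃ β : Fin k → ℤ, invVars k R = monom β * R ∨ invVars k R = -(monom β * R)

/-- The generating function `∑_{P ∈ s} u ^ f(P)` is well defined (finitely many objects for each
value of the statistics) and is the rational function `R`: for some Laurent polynomials `N` and
`D ≠ 0` the product of `D` with the formal series is `N`, and `R = N / D`. -/
def IsRationalGF {α : Type*} {k : ℕ} (s : Set α) (f : α → Fin k → ℤ) (R : RatFun k) : Prop :=
  (∀ w, {P | P ∈ s ∧ f P = w}.Finite) ∧
  ∃ N D : Laurent k, D ≠ 0 ∧
    (∀ w, ∑ v ∈ D.coeff.support, D.coeff v * ({P | P ∈ s ∧ f P = w - v}.ncard : ℝ)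
      = N.coeff w) ∧
    R = algebraMap (Laurent k) (RatFun k) N / algebraMap (Laurent k) (RatFun k) D

/-- `H m` is the generating function of the polygons of width `m`, for all `m`. There are no
polygons of width `0`, so `H 0 = 0`. -/
def IsWidthGF {k : ℕ} (F : (m : ℕ) → Set (ColumnConvexPolygon m))
    (f : (m : ℕ) → ColumnConvexPolygon m → Fin k → ℤ) (H : ℕ → RatFun k) : Prop :=
  ∀ m, IsRationalGF (F m) (f m) (H m)

/-- Half vertical perimeter and area: the variables are `y = u_0` and `q = u_1`. -/
def perimArea (m : ℕ) (P : ColumnConvexPolygon m) : Fin 2 → ℤ := ![P.halfVertical, P.area]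

/-- Half vertical perimeter only: the variable is `y = u_0`. -/
def perimOnly (m : ℕ) (P : ColumnConvexPolygon m) : Fin 1 → ℤ := ![P.halfVertical]

/-- Area only: the variable is `q = u_0`. -/
def areaOnly (m : ℕ) (P : ColumnConvexPolygon m) : Fin 1 → ℤ := ![P.area]

/-- `G(c x, 1/u)` for a power series `G(x, u)` in `x` with coefficients rational in `u`. -/
def inverted {k : ℕ} (c : RatFun k) (G : PowerSeries (RatFun k)) : PowerSeries (RatFun k) :=
  PowerSeries.rescale c (PowerSeries.map (invVars k : RatFun k →+* RatFun k) G)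

/-- The monomial `u ^ β` as a constant power series in `x`. -/
def cst {k : ℕ} (β : Fin k → ℤ) : PowerSeries (RatFun k) := PowerSeries.C (monom β)

/-- `Δ(x, y) = 1 - 2x - 2y - 2xy + x² + y²`, as a power series in `x`; its constant term
`(1 - y)²` is invertible. -/
def discr : PowerSeries (RatFun 1) :=
  1 - 2 * PowerSeries.X - 2 * cst ![1] - 2 * PowerSeries.X * cst ![1]
    + PowerSeries.X ^ 2 + cst ![1] ^ 2

end Polyomino

end

/-! Except for convex and directed convex polygons, everything follows from Stanley's reciprocity
for partitions of a labelled poset. A polygon of width `M + 1` is the same thing as its column tops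
and bottoms, with neighbouring columns overlapping (`isColumns_col`, `ofColumns`), and in each of
these families the heights are the integer functions that obey a list of weak and strict
inequalities. Labels that increase along the weak inequalities and decrease along the strict ones
make these functions the partitions of a labelled relation.

Sorting the values, with ties broken by label, splits the partitions into cones, one for each linear
extension (`isPartition_and_sort_eq_iff`). In a cone the gaps between consecutive values are free
above the bound 1 at a descent and 0 elsewhere. A statistic that is additive on comonotone functions
is linear on each cone, so the cone contributes a product of factors u^(d v) / (1 - u^v) with d = 0
or 1. The substitution of 1/u for u changes each factor into -u^((1 - d) v) / (1 - u^v), the factor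
of the dual problem with weak and strict exchanged; this is `partition_reciprocity`. Numbers of
north and south steps are admissible statistics because positive parts of differences are additive
on comonotone functions (`isComonotoneFn_max`).

For these families the dual partitions are the partitions translated by one fixed vector. The
translation changes a linear statistic by a constant if every run that it modifies keeps its
direction (`columnStat_add`). So the generating function at 1/u is, up to sign, a monomial times
itself (`Presentation.reciprocity`), and summation over the widths gives the functional equations.
Staircase polygons of width one are exceptional and produce the term -x.

Convex and directed convex polygons are counted instead. At fixed width the number of them with half
vertical perimeter n ≥ 1 is a polynomial in n: a squared multiset number in the directed case
(`ncard_directed_frames`), and `convexCount` in the convex case (`ncard_frames_eq`). For a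
polynomial P the sum of P(n) y^n over all integers n has value 0, so the sum over n ≥ 1, taken at
1/y, is minus the sum of P(-n) y^n over n ≥ 0 (`HasVal.halfLine_reflect`). An inversion relation
thus becomes a symmetry of P under a reflection of n, together with zeros that fill the gap. In the
directed case P is symmetric. In the convex case the symmetry fails by a multiple of `oddCount`; the
generating function of these polynomials over all widths is y (1 - x + y) / Δ, and the multiple,
which is the width minus 2, turns it into a derivative.

Rational functions are read off from doubly infinite series through the action of Laurent
polynomials (`HasVal`). Such a value is unique (`HasVal.unique`), and reflecting the exponents
inverts the variables (`HasVal.inv`). -/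

noncomputable section

namespace Polyomino

/-! ### Formal Laurent series as a module over Laurent polynomials -/

/-- Formal, possibly doubly infinite, Laurent series. -/
abbrev Series (k : ℕ) : Type := (Fin k → ℤ) → ℝ

/-- Translation of the exponents, that is, multiplication by a monomial. -/
def translate (k : ℕ) : Multiplicative (Fin k → ℤ) →* Module.End ℝ (Series k) where
  toFun v :=
    { toFun := fun s w => s (w - v.toAdd)
      map_add' := fun _ _ => rfl
      map_smul' := fun _ _ => rfl }
  map_one' := by ext; simp
  map_mul' a b := by
    ext s w
    simp only [toAdd_mul, LinearMap.coe_mk, AddHom.coe_mk, Module.End.mul_apply]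
    congr 1
    abel

/-- Multiplication of a formal series by a Laurent polynomial. -/
def act {k : ℕ} : Laurent k →ₐ[ℝ] Module.End ℝ (Series k) :=
  AddMonoidAlgebra.lift ℝ (Module.End ℝ (Series k)) (Fin k → ℤ) (translate k)

variable {k : ℕ}

theorem act_apply (D : Laurent k) (s : Series k) (w : Fin k → ℤ) :
    act D s w = ∑ v ∈ D.coeff.support, D.coeff v * s (w - v) := by
  simp only [act, AddMonoidAlgebra.lift_apply, Finsupp.sum, LinearMap.sum_apply, Finset.sum_apply]
  rfl

@[simp] theorem act_single (v : Fin k → ℤ) (c : ℝ) (s : Series k) (w : Fin k → ℤ) :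
    act (AddMonoidAlgebra.single v c) s w = c * s (w - v) := by
  simp only [act, AddMonoidAlgebra.lift_single]
  rfl

theorem act_mul (D E : Laurent k) (s : Series k) : act (D * E) s = act D (act E s) := by
  rw [map_mul]; rfl

theorem act_one (s : Series k) : act (1 : Laurent k) s = s := by
  rw [map_one]; rfl

theorem act_sub (D E : Laurent k) (s : Series k) : act (D - E) s = act D s - act E s := by
  rw [map_sub]; rfl

/-- The series of a Laurent polynomial. -/
def toSeries (N : Laurent k) : Series k := fun w => N.coeff w

/-- The series 1 generates a copy of the Laurent polynomials inside the module of all series, so the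
action on that copy is multiplication. -/
theorem act_pi_single (N : Laurent k) : act N (Pi.single 0 1) = toSeries N := by
  ext w
  rw [act_apply]
  have : ∀ v ∈ N.coeff.support, N.coeff v * (Pi.single 0 1 : Series k) (w - v)
      = if v = w then N.coeff w else 0 := by
    intro v _
    by_cases h : v = w
    · subst h; simp
    · rw [Pi.single_eq_of_ne (by rw [sub_ne_zero]; exact fun e => h e.symm), if_neg h, mul_zero]
  rw [Finset.sum_congr rfl this, Finset.sum_ite_eq']
  split_ifs with h
  · rfl
  · simp only [Finsupp.mem_support_iff, not_not] at h
    exact h.symm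

theorem act_toSeries (D N : Laurent k) : act D (toSeries N) = toSeries (D * N) := by
  rw [← act_pi_single, ← act_pi_single, act_mul]

theorem toSeries_injective : Function.Injective (toSeries (k := k)) := fun A B h => by
  ext w; exact congrFun h w

theorem toSeries_add (A B : Laurent k) : toSeries (A + B) = toSeries A + toSeries B := rfl

/-- The formal series `s` is the expansion of the rational function `R`. -/
def HasVal (s : Series k) (R : RatFun k) : Prop :=
  ∃ N D : Laurent k, D ≠ 0 ∧ act D s = toSeries N ∧
    R = algebraMap (Laurent k) (RatFun k) N / algebraMap (Laurent k) (RatFun k) D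

theorem algebraMap_ne_zero {D : Laurent k} (h : D ≠ 0) :
    algebraMap (Laurent k) (RatFun k) D ≠ 0 := by
  rwa [Ne, FaithfulSMul.algebraMap_eq_zero_iff]

theorem HasVal.add {s t : Series k} {R S : RatFun k} (hs : HasVal s R) (ht : HasVal t S) :
    HasVal (s + t) (R + S) := by
  obtain ⟨N, D, hD, h, rfl⟩ := hs
  obtain ⟨N', D', hD', h', rfl⟩ := ht
  refine ⟨D' * N + D * N', D * D', mul_ne_zero hD hD', ?_, ?_⟩
  · rw [map_add, toSeries_add]
    conv_lhs => rw [mul_comm D D', act_mul, h, mul_comm D' D, act_mul, h']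
    rw [act_toSeries, act_toSeries]
  · have := algebraMap_ne_zero hD
    have := algebraMap_ne_zero hD'
    simp only [map_add, map_mul]
    field_simp

theorem HasVal.zero : HasVal (0 : Series k) 0 :=
  ⟨0, 1, one_ne_zero, by rw [map_zero]; rfl, by simp⟩

theorem HasVal.sum {ι : Type*} (S : Finset ι) {s : ι → Series k} {R : ι → RatFun k}
    (h : ∀ i ∈ S, HasVal (s i) (R i)) : HasVal (∑ i ∈ S, s i) (∑ i ∈ S, R i) := by
  classical
  induction S using Finset.induction_on with
  | empty => simpa using HasVal.zero
  | insert a S ha ih =>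
    rw [Finset.sum_insert ha, Finset.sum_insert ha]
    exact (h a (Finset.mem_insert_self _ _)).add
      (ih fun i hi => h i (Finset.mem_insert_of_mem hi))

theorem HasVal.act {s : Series k} {R : RatFun k} (hs : HasVal s R) (P : Laurent k) :
    HasVal (act P s) (algebraMap (Laurent k) (RatFun k) P * R) := by
  obtain ⟨N, D, hD, h, rfl⟩ := hs
  refine ⟨P * N, D, hD, ?_, ?_⟩
  · rw [← act_mul, mul_comm, act_mul, h, act_toSeries]
  · rw [map_mul, mul_div_assoc]

/-- A factor cleared from the series joins the denominator, which stays nonzero because Laurent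
polynomials form a domain. -/
theorem HasVal.of_act {s : Series k} {R : RatFun k} {P : Laurent k} (hP : P ≠ 0)
    (h : HasVal (Polyomino.act P s) R) : HasVal s (R / algebraMap (Laurent k) (RatFun k) P) := by
  obtain ⟨N, D, hD, h, rfl⟩ := h
  refine ⟨N, D * P, mul_ne_zero hD hP, by rw [act_mul, h], ?_⟩
  rw [map_mul, div_div]

theorem hasVal_toSeries (N : Laurent k) :
    HasVal (toSeries N) (algebraMap (Laurent k) (RatFun k) N) :=
  ⟨N, 1, one_ne_zero, act_one _, by simp⟩

/-- Doubly infinite series have torsion, but two presentations of one series satisfy D' N = D' D s =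
D N', an identity between Laurent polynomials, and this is the equality of the two fractions. -/
theorem HasVal.unique {s : Series k} {R S : RatFun k} (h : HasVal s R) (h' : HasVal s S) :
    R = S := by
  obtain ⟨N, D, hD, h, rfl⟩ := h
  obtain ⟨N', D', hD', h', rfl⟩ := h'
  rw [div_eq_div_iff (algebraMap_ne_zero hD) (algebraMap_ne_zero hD'), ← map_mul, ← map_mul]
  congr 1
  apply toSeries_injective
  rw [mul_comm N, mul_comm N', ← act_toSeries, ← act_toSeries, ← h, ← h', ← act_mul, ← act_mul,
    mul_comm]

theorem HasVal.smul {s : Series k} {R : RatFun k} (hs : HasVal s R) (c : ℝ) :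
    HasVal (c • s) (algebraMap ℝ (RatFun k) c * R) := by
  have := hs.act (AddMonoidAlgebra.single 0 c)
  convert this using 1
  · ext w
    simp
  · rw [IsScalarTower.algebraMap_apply ℝ (Laurent k) (RatFun k)]
    rfl

theorem HasVal.neg {s : Series k} {R : RatFun k} (hs : HasVal s R) : HasVal (-s) (-R) := by
  have := hs.smul (-1)
  simpa using this

theorem HasVal.sub {s t : Series k} {R S : RatFun k} (hs : HasVal s R) (ht : HasVal t S) :
    HasVal (s - t) (R - S) := by
  rw [sub_eq_add_neg, sub_eq_add_neg]
  exact hs.add ht.neg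

theorem HasVal.shift {s : Series k} {R : RatFun k} (hs : HasVal s R) (v : Fin k → ℤ) :
    HasVal (fun w => s (w - v)) (monom v * R) := by
  have := hs.act (AddMonoidAlgebra.single v 1)
  convert this using 1
  · ext w
    simp
  · rfl

theorem invVars_algebraMap (N : Laurent k) :
    invVars k (algebraMap (Laurent k) (RatFun k) N) = algebraMap (Laurent k) (RatFun k)
      (AddMonoidAlgebra.domCongr ℝ ℝ (AddEquiv.neg (Fin k → ℤ)) N) := by
  rw [invVars, IsFractionRing.ringEquivOfRingEquiv_algebraMap]
  rfl

theorem invVars_monom (v : Fin k → ℤ) : invVars k (monom v) = monom (-v) := by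
  rw [monom, invVars_algebraMap, AddMonoidAlgebra.domCongr_single]
  rfl

theorem monom_zero : monom (0 : Fin k → ℤ) = 1 := by
  rw [monom, ← AddMonoidAlgebra.one_def, map_one]

theorem monom_add (v w : Fin k → ℤ) : monom (v + w) = monom v * monom w := by
  rw [monom, monom, monom, ← map_mul, AddMonoidAlgebra.single_mul_single, mul_one]

theorem monom_ne_zero (v : Fin k → ℤ) : monom v ≠ 0 :=
  algebraMap_ne_zero (by simp)

theorem monom_neg (v : Fin k → ℤ) : monom (-v) = (monom v)⁻¹ := by
  apply eq_inv_of_mul_eq_one_left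
  rw [← monom_add, neg_add_cancel, monom_zero]

theorem monom_nsmul (n : ℕ) (v : Fin k → ℤ) : monom (n • v) = monom v ^ n := by
  induction n with
  | zero => rw [zero_smul, monom_zero, pow_zero]
  | succ n ih => rw [succ_nsmul, monom_add, ih, pow_succ]

/-- Reflection of the exponents is compatible with the action, so the reflected N and D present the
reflected series. The reflected series may extend in the opposite direction, which is why doubly
infinite series are allowed. -/
theorem HasVal.inv {s : Series k} {R : RatFun k} (hs : HasVal s R) :
    HasVal (fun w => s (-w)) (invVars k R) := by
  obtain ⟨N, D, hD, h, rfl⟩ := hs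
  refine ⟨AddMonoidAlgebra.domCongr ℝ ℝ (AddEquiv.neg (Fin k → ℤ)) N,
    AddMonoidAlgebra.domCongr ℝ ℝ (AddEquiv.neg (Fin k → ℤ)) D, by simpa using hD, ?_, ?_⟩
  · ext w
    have := congrFun h (-w)
    rw [act_apply] at this
    rw [act_apply, AddMonoidAlgebra.domCongr_support, Finset.sum_map]
    simp only [toSeries, AddMonoidAlgebra.coeff_domCongr] at this ⊢
    refine Eq.trans ?_ (this.trans ?_)
    · refine Finset.sum_congr rfl fun v _ => ?_
      simp [add_comm, sub_eq_add_neg]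
    · simp
  · rw [map_div₀, invVars_algebraMap, invVars_algebraMap]

/-- The counting series of a statistic on a set. -/
def countSeries {α : Type*} (s : Set α) (f : α → Fin k → ℤ) : Series k :=
  fun w => ({P | P ∈ s ∧ f P = w}.ncard : ℝ)

theorem isRationalGF_iff {α : Type*} (s : Set α) (f : α → Fin k → ℤ) (R : RatFun k) :
    IsRationalGF s f R ↔
      (∀ w, {P | P ∈ s ∧ f P = w}.Finite) ∧ HasVal (countSeries s f) R := by
  unfold IsRationalGF HasVal
  refine and_congr_right fun _ => exists_congr fun N => exists_congr fun D =>
    and_congr_right fun _ => and_congr_left fun _ => ?_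
  rw [funext_iff]
  refine forall_congr' fun w => ?_
  rw [act_apply]
  rfl

end Polyomino
end

noncomputable section

namespace Polyomino

variable {k : ℕ}

/-! ### Counting series -/

theorem countSeries_congr {α β : Type*} {s : Set α} {t : Set β} {f : α → Fin k → ℤ}
    {g : β → Fin k → ℤ} (φ : α → β) (hφ : Set.BijOn φ s t) (hf : ∀ x ∈ s, g (φ x) = f x) :
    countSeries s f = countSeries t g := by
  ext w
  simp only [countSeries]
  congr 1
  have : {P | P ∈ t ∧ g P = w} = φ '' {P | P ∈ s ∧ f P = w} := by
    ext y
    constructor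
    · rintro ⟨hy, rfl⟩
      obtain ⟨x, hx, rfl⟩ := hφ.surjOn hy
      exact ⟨x, ⟨hx, (hf x hx).symm⟩, rfl⟩
    · rintro ⟨x, ⟨hx, rfl⟩, rfl⟩
      exact ⟨hφ.mapsTo hx, hf x hx⟩
  rw [this, (hφ.injOn.mono fun x hx => hx.1).ncard_image]

theorem finite_fiber_congr {α β : Type*} {s : Set α} {t : Set β} {f : α → Fin k → ℤ}
    {g : β → Fin k → ℤ} (φ : α → β) (hφ : Set.BijOn φ s t) (hf : ∀ x ∈ s, g (φ x) = f x)
    (h : ∀ w, {P | P ∈ s ∧ f P = w}.Finite) (w : Fin k → ℤ) : {P | P ∈ t ∧ g P = w}.Finite := by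
  refine ((h w).image φ).subset ?_
  rintro y ⟨hy, rfl⟩
  obtain ⟨x, hx, rfl⟩ := hφ.surjOn hy
  exact ⟨x, ⟨hx, (hf x hx).symm⟩, rfl⟩

theorem finite_fiber_congr' {α β : Type*} {s : Set α} {t : Set β} {f : α → Fin k → ℤ}
    {g : β → Fin k → ℤ} (φ : α → β) (hφ : Set.BijOn φ s t) (hf : ∀ x ∈ s, g (φ x) = f x)
    (h : ∀ w, {P | P ∈ t ∧ g P = w}.Finite) (w : Fin k → ℤ) : {P | P ∈ s ∧ f P = w}.Finite := by
  refine Set.Finite.of_finite_image (f := φ) ((h w).subset ?_)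
    (hφ.injOn.mono fun x hx => hx.1)
  rintro _ ⟨x, ⟨hx, rfl⟩, rfl⟩
  exact ⟨hφ.mapsTo hx, hf x hx⟩

/-- Finite fibres are needed because `ncard` is 0 on an infinite set, some of whose pieces may still
be finite and nonempty. -/
theorem countSeries_eq_sum {α ι : Type*} [Fintype ι] [DecidableEq ι] {s : Set α}
    {f : α → Fin k → ℤ} (c : α → ι) (h : ∀ w, {P | P ∈ s ∧ f P = w}.Finite) :
    countSeries s f = ∑ i, countSeries {P | P ∈ s ∧ c P = i} f := by
  ext w
  rw [Finset.sum_apply]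
  simp only [countSeries]
  rw [← Nat.cast_sum, Set.ncard_eq_toFinset_card _ (h w),
    Finset.card_eq_sum_card_fiberwise (f := c) (t := Finset.univ) (by intro x _; simp)]
  congr 1
  refine Finset.sum_congr rfl fun i _ => ?_
  rw [← Set.ncard_coe_finset]
  congr 1
  ext x
  simp only [Finset.coe_filter, Set.Finite.mem_toFinset, Set.mem_ofPred_eq]
  tauto

theorem countSeries_empty {α : Type*} {s : Set α} (hs : s = ∅) (f : α → Fin k → ℤ) :
    countSeries s f = 0 := by
  subst hs
  ext w
  simp [countSeries]

theorem countSeries_add_const {α : Type*} (s : Set α) (f : α → Fin k → ℤ) (β : Fin k → ℤ) :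
    countSeries s (fun x => f x + β) = fun w => countSeries s f (w - β) := by
  ext w
  simp only [countSeries, eq_sub_iff_add_eq]

/-! ### The generating function of an orthant -/

theorem one_sub_single_ne_zero {v : Fin k → ℤ} (hv : v ≠ 0) :
    (1 - AddMonoidAlgebra.single v 1 : Laurent k) ≠ 0 := by
  intro h
  have := congrArg (fun A : Laurent k => A.coeff 0) h
  rw [AddMonoidAlgebra.one_def] at this
  simp [hv] at this

theorem algebraMap_one_sub_single (v : Fin k → ℤ) :
    algebraMap (Laurent k) (RatFun k) (1 - AddMonoidAlgebra.single v 1) = 1 - monom v := by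
  rw [map_sub, map_one]; rfl

theorem one_sub_monom_ne_zero {v : Fin k → ℤ} (hv : v ≠ 0) : 1 - monom v ≠ 0 := by
  rw [← algebraMap_one_sub_single]
  exact algebraMap_ne_zero (one_sub_single_ne_zero hv)

/-- A zero direction would put a whole ray, obtained by increasing one coordinate, into a single
fibre. -/
theorem ne_zero_of_finite_fiber {n : ℕ} {δ : Fin n → ℤ} {v : Fin n → Fin k → ℤ}
    (h : ∀ w, {g | g ∈ Set.Ici δ ∧ ∑ i, g i • v i = w}.Finite) (i : Fin n) : v i ≠ 0 := by
  intro hv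
  refine (Set.infinite_of_injective_forall_mem
    (f := fun t : ℕ => δ + (t : ℤ) • (Pi.single i 1 : Fin n → ℤ)) ?_ ?_) (h (∑ i, δ i • v i))
  · intro s t hst
    have := congrFun hst i
    simpa using this
  · intro t
    refine ⟨fun j => ?_, ?_⟩
    · by_cases hj : j = i
      · subst hj; simp
      · simp [hj]
    · refine Finset.sum_congr rfl fun j _ => ?_
      by_cases hj : j = i
      · subst hj; simp [hv]
      · simp [hj]

/-- A product of geometric series, one coordinate at a time. Multiplication by 1 - u^(v 0) cancels
the points whose coordinate 0 is above its lower bound and leaves the facet where the bound is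
attained, an orthant of one dimension less. -/
theorem hasVal_Ici : ∀ (n : ℕ) (δ : Fin n → ℤ) (v : Fin n → Fin k → ℤ),
    (∀ w, {g | g ∈ Set.Ici δ ∧ ∑ i, g i • v i = w}.Finite) →
    HasVal (countSeries (Set.Ici δ) fun g => ∑ i, g i • v i)
      (∏ i, monom (δ i • v i) / (1 - monom (v i)))
  | 0, δ, v, _ => by
    simp only [Finset.univ_eq_empty, Finset.prod_empty, Finset.sum_empty]
    convert hasVal_toSeries (1 : Laurent k) using 1
    · ext w
      rw [countSeries, toSeries, AddMonoidAlgebra.one_def, AddMonoidAlgebra.coeff_single]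
      by_cases hw : w = 0
      · subst hw
        have : {P : Fin 0 → ℤ | P ∈ Set.Ici δ ∧ (0 : Fin k → ℤ) = 0} = {δ} := by
          ext g; simp [Subsingleton.elim g δ]
        rw [this]
        simp
      · have : {P : Fin 0 → ℤ | P ∈ Set.Ici δ ∧ (0 : Fin k → ℤ) = w} = ∅ := by
          ext g; simp [Ne.symm hw]
        rw [this]
        simp [hw]
    · simp
  | n + 1, δ, v, h => by
    have hv := ne_zero_of_finite_fiber h 0
    have hinj : Function.Injective fun g : Fin n → ℤ => (Fin.cons (δ 0) g : Fin (n + 1) → ℤ) :=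
      fun g g' h => (Fin.cons_inj.1 h).2
    have htail : ∀ w, {g | g ∈ Set.Ici (Fin.tail δ) ∧ ∑ i, g i • Fin.tail v i = w}.Finite := by
      intro w
      refine Set.Finite.of_finite_image (f := fun g => (Fin.cons (δ 0) g : Fin (n + 1) → ℤ))
        ((h (δ 0 • v 0 + w)).subset ?_) ?_
      · rintro _ ⟨g, ⟨hg, rfl⟩, rfl⟩
        refine ⟨fun i => ?_, ?_⟩
        · refine Fin.cases ?_ (fun i => ?_) i
          · simp
          · simpa [Fin.tail] using hg i
        · simp [Fin.sum_univ_succ, Fin.tail]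
      · exact hinj.injOn
    have ih := hasVal_Ici n (Fin.tail δ) (Fin.tail v) htail
    have key : act (1 - AddMonoidAlgebra.single (v 0) 1)
        (countSeries (Set.Ici δ) fun g => ∑ i, g i • v i) =
        fun w => countSeries (Set.Ici (Fin.tail δ)) (fun g => ∑ i, g i • Fin.tail v i)
          (w - δ 0 • v 0) := by
      ext w
      rw [act_sub, act_one, Pi.sub_apply, act_single, one_mul, sub_eq_iff_eq_add]
      simp only [countSeries]
      rw [← Nat.cast_add]
      congr 1
      -- The fibre splits according to whether coordinate 0 attains its lower bound; if it does not,
      -- it can be lowered by one.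
      have h1 : {P | P ∈ Set.Ici δ ∧ ∑ i, P i • v i = w} =
          (fun g => (Fin.cons (δ 0) g : Fin (n + 1) → ℤ)) ''
            {P | P ∈ Set.Ici (Fin.tail δ) ∧ ∑ i, P i • Fin.tail v i = w - δ 0 • v 0} ∪
          (fun g => g + Pi.single 0 1) '' {P | P ∈ Set.Ici δ ∧ ∑ i, P i • v i = w - v 0} := by
        ext g
        constructor
        · rintro ⟨hg, rfl⟩
          rcases (hg 0).eq_or_lt with h0 | h0
          · left
            refine ⟨Fin.tail g, ⟨fun i => hg i.succ, ?_⟩, ?_⟩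
            · rw [Fin.sum_univ_succ, h0]; simp [Fin.tail]
            · simp only [h0]
              exact Fin.cons_self_tail g
          · right
            refine ⟨g - Pi.single 0 1, ⟨fun i => ?_, ?_⟩, by simp⟩
            · refine Fin.cases ?_ (fun i => ?_) i
              · simp only [Pi.sub_apply, Pi.single_eq_same]
                exact Int.le_sub_one_of_lt h0
              · simpa using hg i.succ
            · rw [Fin.sum_univ_succ, Fin.sum_univ_succ]
              simp [sub_smul, -zsmul_eq_mul]
              abel
        · rintro (⟨g, ⟨hg, hw⟩, rfl⟩ | ⟨g, ⟨hg, hw⟩, rfl⟩)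
          · refine ⟨fun i => ?_, ?_⟩
            · refine Fin.cases ?_ (fun i => ?_) i
              · simp
              · simpa [Fin.tail] using hg i
            · rw [Fin.sum_univ_succ]
              simp only [Fin.cons_zero, Fin.cons_succ]
              simp only [Fin.tail] at hw
              rw [hw]
              abel
          · refine ⟨fun i => ?_, ?_⟩
            · refine Fin.cases ?_ (fun i => ?_) i
              · have : δ 0 ≤ g 0 := hg 0
                simp; omega
              · simpa using hg i.succ
            · rw [Fin.sum_univ_succ] at hw ⊢
              simp [add_smul, -zsmul_eq_mul]
              rw [eq_sub_iff_add_eq] at hw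
              rw [← hw]
              abel
      rw [h1, Set.ncard_union_eq _ ((htail _).image _) ((h _).image _),
        Set.ncard_image_of_injective _ hinj,
        Set.ncard_image_of_injective _ (add_left_injective _)]
      · rw [Set.disjoint_left]
        rintro _ ⟨g, _, rfl⟩ ⟨g', ⟨hg', _⟩, hgg⟩
        have h0 := congrFun hgg 0
        have h2 := hg' 0
        simp only [Pi.add_apply, Pi.single_eq_same, Fin.cons_zero] at h0
        have h3 : δ 0 ≤ g' 0 := h2
        linarith
    have := HasVal.of_act (one_sub_single_ne_zero hv) (key ▸ ih.shift (δ 0 • v 0))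
    rw [algebraMap_one_sub_single] at this
    convert this using 1
    rw [Fin.prod_univ_succ]
    simp only [Fin.tail]
    ring

end Polyomino
end

noncomputable section

namespace Polyomino

variable {k n : ℕ}

/-! ### Partitions of a labelled relation and their reciprocity -/

/-- `f` weakly increases along the relation `r`, strictly where the labels decrease. -/
def IsPartition (r : Fin n → Fin n → Prop) (f : Fin n → ℤ) : Prop :=
  ∀ a b, r a b → f a ≤ f b ∧ (b < a → f a < f b)

/-- `f` weakly increases along the relation `r`, strictly where the labels increase. -/
def IsDualPartition (r : Fin n → Fin n → Prop) (f : Fin n → ℤ) : Prop :=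
  ∀ a b, r a b → f a ≤ f b ∧ (a < b → f a < f b)

/-- The permutation `σ` lists the labels in an order compatible with `r`. -/
def IsLinearExtension (r : Fin n → Fin n → Prop) (σ : Equiv.Perm (Fin n)) : Prop :=
  ∀ a b, r a b → σ.symm a ≤ σ.symm b

/-- A statistic that is additive on comonotone functions and vanishes on constants. -/
structure IsComonotone {ι : Type*} (w : (ι → ℤ) → Fin k → ℤ) : Prop where
  add : ∀ f g : ι → ℤ, (∀ a b, f a < f b → g a ≤ g b) → w (f + g) = w f + w g
  const : ∀ c : ℤ, w (fun _ => c) = 0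

/-- The indicator function of the labels that come after position `i`. -/
def upper (σ : Equiv.Perm (Fin (n + 1))) (i : Fin n) : Fin (n + 1) → ℤ :=
  fun a => if i.castSucc < σ.symm a then 1 else 0

theorem upper_mono (σ : Equiv.Perm (Fin (n + 1))) (i : Fin n) {a b : Fin (n + 1)}
    (h : σ.symm a ≤ σ.symm b) : upper σ i a ≤ upper σ i b := by
  unfold upper
  split_ifs with h1 h2
  · rfl
  · exact absurd (h1.trans_le h) h2
  · exact zero_le_one
  · rfl

/-- The function with prescribed successive differences `g` along `σ`, vanishing at `x₀`. -/
def ofGaps (σ : Equiv.Perm (Fin (n + 1))) (x₀ : Fin (n + 1)) (g : Fin n → ℤ) : Fin (n + 1) → ℤ :=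
  fun a => ∑ i, g i * upper σ i a - ∑ i, g i * upper σ i x₀

theorem IsComonotone.nsmul {ι : Type*} {w : (ι → ℤ) → Fin k → ℤ} (hw : IsComonotone w)
    (f : ι → ℤ) (m : ℕ) : w ((m : ℤ) • f) = (m : ℤ) • w f := by
  induction m with
  | zero =>
    have h0 : w 0 = 0 := hw.const 0
    simp [h0]
  | succ m ih =>
    rw [Nat.cast_succ, add_smul, one_smul, hw.add, ih, add_smul, one_smul]
    intro a b hab
    simp only [Pi.smul_apply, smul_eq_mul] at hab
    by_contra hlt
    rw [not_le] at hlt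
    nlinarith

/-- All the `upper σ i` increase along the same order σ, so nonnegative combinations of them are
comonotone and additivity extends to the whole cone. -/
theorem IsComonotone.sum_upper {w : (Fin (n + 1) → ℤ) → Fin k → ℤ} (hw : IsComonotone w)
    (σ : Equiv.Perm (Fin (n + 1))) (g : Fin n → ℤ) (hg : ∀ i, 0 ≤ g i) (S : Finset (Fin n)) :
    w (fun a => ∑ i ∈ S, g i * upper σ i a) = ∑ i ∈ S, g i • w (upper σ i) := by
  classical
  induction S using Finset.induction_on with
  | empty => simpa using hw.const 0
  | insert i S hi ih =>
    have h1 : (fun a => ∑ i ∈ insert i S, g i * upper σ i a) =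
        g i • upper σ i + fun a => ∑ i ∈ S, g i * upper σ i a := by
      ext a
      simp [Finset.sum_insert hi]
    rw [h1, hw.add, ih, Finset.sum_insert hi]
    · congr 1
      lift g i to ℕ using hg i with m
      exact hw.nsmul _ _
    · intro a b hab
      have hlt : σ.symm a ≤ σ.symm b := by
        by_contra hlt
        rw [not_le] at hlt
        have := mul_le_mul_of_nonneg_left (upper_mono σ i hlt.le) (hg i)
        simp only [Pi.smul_apply, smul_eq_mul] at hab
        omega
      exact Finset.sum_le_sum fun j _ => mul_le_mul_of_nonneg_left (upper_mono σ j hlt) (hg j)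

theorem IsComonotone.add_const {ι : Type*} {w : (ι → ℤ) → Fin k → ℤ} (hw : IsComonotone w)
    (f : ι → ℤ) (c : ℤ) : w (fun a => f a + c) = w f := by
  have := hw.add f (fun _ => c) (fun _ _ _ => le_rfl)
  rw [hw.const, add_zero] at this
  exact this

theorem IsComonotone.ofGaps {w : (Fin (n + 1) → ℤ) → Fin k → ℤ} (hw : IsComonotone w)
    (σ : Equiv.Perm (Fin (n + 1))) (x₀ : Fin (n + 1)) (g : Fin n → ℤ) (hg : ∀ i, 0 ≤ g i) :
    w (ofGaps σ x₀ g) = ∑ i, g i • w (upper σ i) := by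
  rw [← hw.sum_upper σ g hg]
  exact hw.add_const _ _

theorem sum_ite_castSucc_lt (h : Fin (n + 1) → ℤ) (j : Fin (n + 1)) :
    ∑ i : Fin n, (if i.castSucc < j then h i.succ - h i.castSucc else 0) = h j - h 0 := by
  induction j using Fin.induction with
  | zero => simp
  | succ j ih =>
    have : ∀ i : Fin n, (if i.castSucc < j.succ then h i.succ - h i.castSucc else 0) =
        (if i.castSucc < j.castSucc then h i.succ - h i.castSucc else 0) +
          if i = j then h i.succ - h i.castSucc else 0 := by
      intro i
      rcases lt_trichotomy i j with hij | rfl | hij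
      · have h1 : i.castSucc < j.succ := by
          simp only [Fin.lt_def, Fin.val_castSucc, Fin.val_succ] at *; omega
        have h2 : i.castSucc < j.castSucc := by simpa using hij
        simp [h1, h2, hij.ne]
      · simp
      · have h1 : ¬ i.castSucc < j.succ := by
          simp only [Fin.lt_def, Fin.val_castSucc, Fin.val_succ] at *; omega
        have h2 : ¬ i.castSucc < j.castSucc := by simpa using hij.le
        simp [h1, h2, hij.ne']
    rw [Finset.sum_congr rfl fun i _ => this i, Finset.sum_add_distrib, ih]
    simp

theorem ofGaps_sub (σ : Equiv.Perm (Fin (n + 1))) (x₀ : Fin (n + 1)) (g : Fin n → ℤ) (i : Fin n) :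
    ofGaps σ x₀ g (σ i.succ) - ofGaps σ x₀ g (σ i.castSucc) = g i := by
  have : ∀ j, g j * upper σ j (σ i.succ) - g j * upper σ j (σ i.castSucc) =
      if j = i then g i else 0 := by
    intro j
    simp only [upper, Equiv.symm_apply_apply, Fin.castSucc_lt_succ_iff, Fin.castSucc_lt_castSucc_iff]
    rcases lt_trichotomy j i with hij | rfl | hij
    · simp [hij.le, hij, hij.ne]
    · simp
    · simp [hij.not_ge, hij.not_gt, hij.ne']
  simp only [ofGaps, sub_sub_sub_cancel_right]
  rw [← Finset.sum_sub_distrib, Finset.sum_congr rfl fun j _ => this j]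
  simp

/-- A function vanishing at `x₀` is determined by its successive differences along σ. Normalising at
`x₀` rather than at the first element of σ makes the condition the same for all σ. -/
theorem bijOn_ofGaps (σ : Equiv.Perm (Fin (n + 1))) (x₀ : Fin (n + 1)) (δ : Fin n → ℤ) :
    Set.BijOn (ofGaps σ x₀) (Set.Ici δ)
      {f | f x₀ = 0 ∧ ∀ i, f (σ i.castSucc) + δ i ≤ f (σ i.succ)} := by
  refine ⟨fun g hg => ⟨by simp [ofGaps], fun i => ?_⟩, fun g _ g' _ h => ?_, fun f hf => ?_⟩
  · have := ofGaps_sub σ x₀ g i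
    have h : δ i ≤ g i := hg i
    linarith
  · ext i
    rw [← ofGaps_sub σ x₀ g i, ← ofGaps_sub σ x₀ g' i, h]
  · refine ⟨fun i => f (σ i.succ) - f (σ i.castSucc), fun i => ?_, ?_⟩
    · have := hf.2 i
      dsimp only
      linarith
    · have key : ∀ a, ∑ i : Fin n, (f (σ i.succ) - f (σ i.castSucc)) * upper σ i a =
          f a - f (σ 0) := by
        intro a
        have := sum_ite_castSucc_lt (fun j => f (σ j)) (σ.symm a)
        simp only [Equiv.apply_symm_apply] at this
        rw [← this]
        refine Finset.sum_congr rfl fun i _ => ?_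
        simp only [upper, mul_ite, mul_one, mul_zero]
      ext a
      simp only [ofGaps]
      rw [key, key, hf.1]
      ring

/-- The indicator of the descents of `σ`. -/
def descents (σ : Equiv.Perm (Fin (n + 1))) (i : Fin n) : ℤ :=
  if σ i.succ < σ i.castSucc then 1 else 0

theorem descents_nonneg (σ : Equiv.Perm (Fin (n + 1))) (i : Fin n) : 0 ≤ descents σ i := by
  unfold descents; split_ifs <;> simp

/-- `Tuple.sort` breaks ties by increasing label, so σ sorts f exactly when f increases along σ,
strictly at the descents of σ. If r a b held with b placed before a, then f a = f b and the tie rule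
would give b < a, where a partition must have f a < f b; hence σ is a linear extension. Neither
transitivity nor acyclicity of r is needed. -/
theorem isPartition_and_sort_eq_iff (r : Fin (n + 1) → Fin (n + 1) → Prop)
    (σ : Equiv.Perm (Fin (n + 1))) (f : Fin (n + 1) → ℤ) :
    (IsPartition r f ∧ Tuple.sort f = σ) ↔
      IsLinearExtension r σ ∧ ∀ i, f (σ i.castSucc) + descents σ i ≤ f (σ i.succ) := by
  have hsort : Tuple.sort f = σ ↔ ∀ i, f (σ i.castSucc) + descents σ i ≤ f (σ i.succ) := by
    rw [eq_comm, Tuple.eq_sort_iff]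
    constructor
    · rintro ⟨hm, ht⟩ i
      have h1 : f (σ i.castSucc) ≤ f (σ i.succ) := hm (Fin.castSucc_lt_succ (i := i)).le
      unfold descents
      split_ifs with hd
      · have : f (σ i.castSucc) ≠ f (σ i.succ) := fun h =>
          absurd (ht _ _ Fin.castSucc_lt_succ h) hd.not_gt
        omega
      · omega
    · intro h
      have hm : Monotone (f ∘ σ) := by
        rw [Fin.monotone_iff_le_succ]
        intro i
        have := h i
        have := descents_nonneg σ i
        simp only [Function.comp]
        omega
      refine ⟨hm, fun i j => ?_⟩
      induction j using Fin.induction with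
      | zero => intro hij; exact absurd hij (Fin.not_lt_zero _)
      | succ j ih =>
        intro hij he
        have hle : i ≤ j.castSucc := Fin.le_castSucc_iff.2 hij
        have h1 : f (σ i) ≤ f (σ j.castSucc) := hm hle
        have h2 : f (σ j.castSucc) ≤ f (σ j.succ) := hm (Fin.castSucc_lt_succ (i := j)).le
        have h3 : σ j.castSucc < σ j.succ := by
          have := h j
          unfold descents at this
          split_ifs at this with hd
          · omega
          · exact lt_of_le_of_ne (not_lt.1 hd)
              (fun e => absurd (σ.injective e) (Fin.castSucc_lt_succ (i := j)).ne)
        rcases hle.eq_or_lt with rfl | hlt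
        · exact h3
        · exact (ih hlt (by omega)).trans h3
  rw [hsort]
  constructor
  · rintro ⟨hp, hc⟩
    refine ⟨fun a b hab => ?_, hc⟩
    by_contra hlt
    rw [not_le] at hlt
    obtain ⟨h1, h2⟩ := hp a b hab
    have hs := (Tuple.eq_sort_iff.1 (hsort.2 hc).symm)
    have h3 : f (σ (σ.symm b)) ≤ f (σ (σ.symm a)) := hs.1 hlt.le
    have h4 := hs.2 _ _ hlt
    simp only [Equiv.apply_symm_apply] at h3 h4
    have := h2 (h4 (le_antisymm h3 h1))
    omega
  · rintro ⟨hl, hc⟩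
    refine ⟨fun a b hab => ?_, hc⟩
    have hs := (Tuple.eq_sort_iff.1 (hsort.2 hc).symm)
    have h3 : f (σ (σ.symm a)) ≤ f (σ (σ.symm b)) := hs.1 (hl a b hab)
    simp only [Equiv.apply_symm_apply] at h3
    refine ⟨h3, fun hba => lt_of_le_of_ne h3 fun he => ?_⟩
    have hlt : σ.symm a < σ.symm b := lt_of_le_of_ne (hl a b hab)
      (fun e => hba.ne' (σ.symm.injective e))
    have h4 := hs.2 _ _ hlt
    simp only [Equiv.apply_symm_apply] at h4
    exact absurd (h4 he) hba.not_gt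

-- Grouping by the sorting permutation decomposes the partitions into orthants of gaps bounded below
-- by the descents. Finite fibres are inherited by every cone, so no direction `w (upper σ i)`
-- vanishes; reciprocity needs this in order to invert the denominators.
open Classical in
theorem hasVal_partitions (r : Fin (n + 1) → Fin (n + 1) → Prop) (x₀ : Fin (n + 1))
    {w : (Fin (n + 1) → ℤ) → Fin k → ℤ} (hw : IsComonotone w)
    (hfin : ∀ v, {f | f ∈ {f | IsPartition r f ∧ f x₀ = 0} ∧ w f = v}.Finite) :
    HasVal (countSeries {f | IsPartition r f ∧ f x₀ = 0} w)
      (∑ σ ∈ {σ | IsLinearExtension r σ},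
        ∏ i, monom (descents σ i • w (upper σ i)) / (1 - monom (w (upper σ i)))) ∧
    ∀ σ, IsLinearExtension r σ → ∀ i, w (upper σ i) ≠ 0 := by
  have hset : ∀ σ, IsLinearExtension r σ →
      {P | P ∈ {f | IsPartition r f ∧ f x₀ = 0} ∧ Tuple.sort P = σ} =
        {f | f x₀ = 0 ∧ ∀ i, f (σ i.castSucc) + descents σ i ≤ f (σ i.succ)} := by
    intro σ hσ
    ext f
    have := isPartition_and_sort_eq_iff r σ f
    simp only [Set.mem_ofPred_eq]
    tauto
  have hstat : ∀ σ : Equiv.Perm (Fin (n + 1)), ∀ g ∈ Set.Ici (descents σ),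
      w (ofGaps σ x₀ g) = ∑ i, g i • w (upper σ i) := fun σ g hg =>
    hw.ofGaps σ x₀ g fun i => (descents_nonneg σ i).trans (hg i)
  have hcone : ∀ σ, IsLinearExtension r σ →
      ∀ v, {g | g ∈ Set.Ici (descents σ) ∧ ∑ i, g i • w (upper σ i) = v}.Finite := by
    intro σ hσ
    refine finite_fiber_congr' (ofGaps σ x₀) (bijOn_ofGaps σ x₀ (descents σ)) (hstat σ) fun v => ?_
    refine (hfin v).subset ?_
    rintro f ⟨hf, hv⟩
    rw [← hset σ hσ] at hf
    exact ⟨hf.1, hv⟩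
  refine ⟨?_, fun σ hσ i => ne_zero_of_finite_fiber (hcone σ hσ) i⟩
  rw [countSeries_eq_sum Tuple.sort hfin, ← Finset.sum_filter_add_sum_filter_not Finset.univ
    (fun σ => IsLinearExtension r σ)]
  rw [Finset.sum_eq_zero (s := Finset.univ.filter fun σ => ¬ IsLinearExtension r σ), add_zero]
  · refine HasVal.sum _ fun σ hσ => ?_
    have hσ' : IsLinearExtension r σ := by simpa using hσ
    rw [hset σ hσ', ← countSeries_congr (ofGaps σ x₀) (bijOn_ofGaps σ x₀ (descents σ)) (hstat σ)]
    exact hasVal_Ici n _ _ (hcone σ hσ')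
  · intro σ hσ
    refine countSeries_empty ?_ _
    rw [Set.eq_empty_iff_forall_notMem]
    rintro f ⟨⟨hf, -⟩, hs⟩
    exact (Finset.mem_filter.1 hσ).2 ((isPartition_and_sort_eq_iff r σ f).1 ⟨hf, hs⟩).1

theorem isDualPartition_iff (r : Fin n → Fin n → Prop) (f : Fin n → ℤ) :
    IsDualPartition r f ↔ IsPartition (fun a b => r a.rev b.rev) fun a => f a.rev := by
  constructor
  · intro h a b hab
    have := h _ _ hab
    rwa [Fin.rev_lt_rev] at this
  · intro h a b hab
    have := h a.rev b.rev (by simpa using hab)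
    simpa using this

-- Reversing the labels turns dual partitions into partitions and exchanges descents with ascents,
-- while the linear orders of the elements, and with them the directions of the cones, stay the
-- same.
open Classical in
theorem hasVal_dualPartitions (r : Fin (n + 1) → Fin (n + 1) → Prop) (x₀ : Fin (n + 1))
    {w : (Fin (n + 1) → ℤ) → Fin k → ℤ} (hw : IsComonotone w)
    (hfin : ∀ v, {f | f ∈ {f | IsDualPartition r f ∧ f x₀ = 0} ∧ w f = v}.Finite) :
    HasVal (countSeries {f | IsDualPartition r f ∧ f x₀ = 0} w)
      (∑ σ ∈ {σ | IsLinearExtension r σ},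
        ∏ i, monom ((1 - descents σ i) • w (upper σ i)) / (1 - monom (w (upper σ i)))) := by
  set r' : Fin (n + 1) → Fin (n + 1) → Prop := fun a b => r a.rev b.rev with hr'
  set w' : (Fin (n + 1) → ℤ) → Fin k → ℤ := fun f => w fun a => f a.rev with hw'
  have hcom : IsComonotone w' :=
    ⟨fun f g h => hw.add _ _ fun a b => h _ _, fun c => hw.const c⟩
  have hbij : Set.BijOn (fun (f : Fin (n + 1) → ℤ) a => f a.rev)
      {f | IsDualPartition r f ∧ f x₀ = 0} {f | IsPartition r' f ∧ f x₀.rev = 0} := by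
    refine ⟨fun f hf => ⟨(isDualPartition_iff r f).1 hf.1, by simpa using hf.2⟩,
      fun f _ g _ h => ?_, fun f hf => ⟨fun a => f a.rev, ⟨?_, hf.2⟩, by simp⟩⟩
    · ext a
      simpa using congrFun h a.rev
    · rw [isDualPartition_iff]
      simpa using hf.1
  have hst : ∀ f ∈ {f | IsDualPartition r f ∧ f x₀ = 0}, w' (fun a => f a.rev) = w f := by
    intro f _
    simp [hw']
  rw [countSeries_congr _ hbij hst]
  have := (hasVal_partitions r' x₀.rev hcom (finite_fiber_congr _ hbij hst hfin)).1
  convert this using 1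
  refine Finset.sum_bij' (fun σ _ => σ.trans Fin.revPerm) (fun σ _ => σ.trans Fin.revPerm)
    ?_ ?_ ?_ ?_ ?_
  · intro σ hσ
    simp only [Finset.mem_filter, Finset.mem_univ, true_and] at hσ ⊢
    intro a b hab
    have := hσ _ _ hab
    simpa [Equiv.symm_trans_apply] using this
  · intro σ hσ
    simp only [Finset.mem_filter, Finset.mem_univ, true_and] at hσ ⊢
    intro a b hab
    have := hσ a.rev b.rev (by simpa [hr'] using hab)
    simpa [Equiv.symm_trans_apply] using this
  · intro σ _; ext; simp
  · intro σ _; ext; simp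
  · intro σ _
    refine Finset.prod_congr rfl fun i _ => ?_
    have h1 : w' (upper (σ.trans Fin.revPerm) i) = w (upper σ i) := by
      simp [hw', upper]
      rfl
    have h2 : descents (σ.trans Fin.revPerm) i = 1 - descents σ i := by
      simp only [descents, Equiv.trans_apply, Fin.revPerm_apply, Fin.rev_lt_rev]
      have hne : σ i.castSucc ≠ σ i.succ := fun e =>
        absurd (σ.injective e) (Fin.castSucc_lt_succ (i := i)).ne
      rcases lt_or_gt_of_ne hne with h | h
      · simp [h, h.not_gt]
      · simp [h, h.not_gt]
    rw [h1, h2]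

/-- Reciprocity for partitions of a labelled relation. -/
theorem partition_reciprocity (r : Fin (n + 1) → Fin (n + 1) → Prop) (x₀ : Fin (n + 1))
    {w : (Fin (n + 1) → ℤ) → Fin k → ℤ} (hw : IsComonotone w)
    (hfin : ∀ v, {f | f ∈ {f | IsPartition r f ∧ f x₀ = 0} ∧ w f = v}.Finite)
    (hfin' : ∀ v, {f | f ∈ {f | IsDualPartition r f ∧ f x₀ = 0} ∧ w f = v}.Finite) :
    ∃ R, HasVal (countSeries {f | IsPartition r f ∧ f x₀ = 0} w) R ∧
      HasVal (countSeries {f | IsDualPartition r f ∧ f x₀ = 0} w) ((-1) ^ n * invVars k R) := by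
  classical
  obtain ⟨h1, h2⟩ := hasVal_partitions r x₀ hw hfin
  refine ⟨_, h1, ?_⟩
  convert hasVal_dualPartitions r x₀ hw hfin' using 1
  rw [map_sum, Finset.mul_sum]
  refine Finset.sum_congr rfl fun σ hσ => ?_
  have hσ' : IsLinearExtension r σ := by simpa using hσ
  have hn : ((-1) ^ n : RatFun k) = ∏ _i : Fin n, (-1 : RatFun k) := by simp
  rw [map_prod, hn, ← Finset.prod_mul_distrib]
  refine Finset.prod_congr rfl fun i _ => ?_
  -- With v the direction and d the descent, u^(-d v) / (1 - u^(-v)) = -u^((1 - d) v) / (1 - u^v);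
  -- the n minus signs form the global sign.
  have h3 := one_sub_monom_ne_zero (h2 σ hσ' i)
  have h4 := monom_ne_zero (w (upper σ i))
  rw [map_div₀, map_sub, map_one, invVars_monom, invVars_monom, sub_smul, one_smul,
    sub_eq_add_neg (w (upper σ i)), monom_add, monom_neg (w (upper σ i))]
  have h5 : 1 - (monom (w (upper σ i)))⁻¹ = -(1 - monom (w (upper σ i))) / monom (w (upper σ i)) := by
    field_simp
    ring
  rw [h5]
  field_simp

end Polyomino
end

/-! ### Column-convex polygons as sequences of overlapping columns. -/

noncomputable section

namespace Polyomino

/-! ### Paths and their levels -/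

theorem level_zero {m : ℕ} (v : Fin (m + 1) → ℤ) : level v 0 = 0 := by
  simp [level]

theorem level_succ {m : ℕ} (v : Fin (m + 1) → ℤ) (i : Fin (m + 1)) :
    level v (i + 1) = level v i + v i := by
  have : ∀ j : Fin (m + 1), (if (j : ℕ) < i + 1 then v j else 0) =
      (if (j : ℕ) < i then v j else 0) + if j = i then v j else 0 := by
    intro j
    rcases lt_trichotomy j i with h | h | h
    · have : (j : ℕ) < i := h
      simp [h.ne, this, this.trans (Nat.lt_succ_self _)]
    · simp [h]
    · have h' : (i : ℕ) < j := h
      have h1 : ¬ (j : ℕ) < i + 1 := by omega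
      have h2 : ¬ (j : ℕ) < i := by omega
      simp only [h1, h2, h.ne', if_false, add_zero]
  simp only [level]
  rw [Finset.sum_congr rfl fun j _ => this j, Finset.sum_add_distrib]
  simp

theorem level_last {m : ℕ} (v : Fin (m + 1) → ℤ) : level v (m + 1) = ∑ i, v i :=
  Finset.sum_congr rfl fun i _ => if_pos i.2

theorem level_eq_of_sub {m : ℕ} {v : Fin (m + 1) → ℤ} {L : ℕ → ℤ} (h0 : L 0 = 0)
    (h : ∀ i : Fin (m + 1), v i = L (i + 1) - L i) : ∀ j ≤ m + 1, level v j = L j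
  | 0, _ => by rw [level_zero, h0]
  | j + 1, hj => by
    have := level_succ v ⟨j, hj⟩
    simp only at this
    rw [this, level_eq_of_sub h0 h j (by omega), h]
    simp

theorem max_lt_min_of_disjoint {a b c d : ℤ} (hca : c < a)
    (h : ∀ y, y ∈ Set.uIcc a b → y ∉ Set.uIcc c d) : max c d < min a b := by
  by_contra hlt
  -- The larger of the two lower end points lies in both intervals as soon as they overlap.
  refine h (max (min a b) (min c d)) ?_ ?_ <;> rw [Set.mem_uIcc] <;> omega

variable {M : ℕ}

/-- The heights of the columns: neighbouring columns overlap in at least one edge. -/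
def IsColumns (T B : Fin (M + 1) → ℤ) : Prop :=
  ∀ i j : Fin (M + 1), (i : ℕ) ≤ j + 1 → (j : ℕ) ≤ i + 1 → B j < T i

/-- The levels of the top path with column tops `T`, starting at the height of the first
bottom. -/
def topLevels (T B : Fin (M + 1) → ℤ) : ℕ → ℤ
  | 0 => B 0
  | j + 1 => if h : j < M + 1 then T ⟨j, h⟩ else T (Fin.last M)

/-- The levels of the bottom path with column bottoms `B`, ending at the height of the last top. -/
def botLevels (T B : Fin (M + 1) → ℤ) : ℕ → ℤ
  | 0 => B 0
  | j + 1 => if h : j < M + 1 then B ⟨j, h⟩ else T (Fin.last M)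

/-- The vertical runs of the top path. -/
def topRun (T B : Fin (M + 1) → ℤ) (i : Fin (M + 2)) : ℤ :=
  topLevels T B (i + 1) - topLevels T B i

/-- The vertical runs of the bottom path. -/
def botRun (T B : Fin (M + 1) → ℤ) (i : Fin (M + 2)) : ℤ :=
  botLevels T B (i + 1) - botLevels T B i

theorem topLevels_succ (T B : Fin (M + 1) → ℤ) (i : Fin (M + 1)) :
    topLevels T B (i + 1) = T i :=
  dif_pos i.2

theorem botLevels_succ (T B : Fin (M + 1) → ℤ) (i : Fin (M + 1)) :
    botLevels T B (i + 1) = B i :=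
  dif_pos i.2

theorem topLevels_end (T B : Fin (M + 1) → ℤ) : topLevels T B (M + 2) = T (Fin.last M) := by
  simp [topLevels]

theorem botLevels_end (T B : Fin (M + 1) → ℤ) : botLevels T B (M + 2) = T (Fin.last M) := by
  simp [botLevels]

theorem level_topRun {T B : Fin (M + 1) → ℤ} (h0 : B 0 = 0) {j : ℕ} (hj : j ≤ M + 2) :
    level (topRun T B) j = topLevels T B j :=
  level_eq_of_sub (L := topLevels T B) h0 (fun _ => rfl) j hj

theorem level_botRun {T B : Fin (M + 1) → ℤ} (h0 : B 0 = 0) {j : ℕ} (hj : j ≤ M + 2) :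
    level (botRun T B) j = botLevels T B j :=
  level_eq_of_sub (L := botLevels T B) h0 (fun _ => rfl) j hj

/-- The polygon with given column tops and bottoms. -/
def ofColumns (T B : Fin (M + 1) → ℤ) (h0 : B 0 = 0) (h : IsColumns T B) :
    ColumnConvexPolygon (M + 1) where
  top := topRun T B
  bot := botRun T B
  same_end := by
    rw [← level_last, ← level_last, level_topRun h0 le_rfl, level_botRun h0 le_rfl, topLevels_end,
      botLevels_end]
  top_zero := by
    have := h 0 0 (by simp) (by simp)
    simpa [topRun, topLevels] using this
  bot_zero := by simp [botRun, botLevels]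
  top_last := by simp [topRun, topLevels, Fin.last]
  bot_last := by
    have := h (Fin.last M) (Fin.last M) (by simp) (by simp)
    simp only [Fin.last] at this
    simp [botRun, botLevels, Fin.last, this.le]
  self_avoiding := by
    have hend : ∑ i, topRun T B i = T (Fin.last M) := by
      rw [← level_last, level_topRun h0 le_rfl, topLevels_end]
    rw [hend]
    ext ⟨x, y⟩
    simp only [Set.mem_inter_iff, Set.mem_insert_iff, Set.mem_singleton_iff, Prod.mk.injEq]
    constructor
    · rintro ⟨⟨i, rfl, hi⟩, ⟨j, hij, hj⟩⟩
      simp only at hi hj hij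
      obtain rfl : i = j := Fin.ext (by exact_mod_cast hij)
      have hlt := i.2
      rw [level_topRun h0 (by omega), level_topRun h0 (by omega)] at hi
      rw [level_botRun h0 (by omega), level_botRun h0 (by omega)] at hj
      rcases i with ⟨i, hi2⟩
      simp only at hi hj
      -- At abscissa 0 the bottom path is a single point, and at the last abscissa the top path is
      -- one. In between, the overlap of neighbouring columns puts both bottoms below both tops.
      rcases i with _ | i
      · left
        simp only [botLevels, Nat.succ_pos, dif_pos] at hj
        rw [Set.mem_uIcc] at hj
        have : (⟨0, Nat.succ_pos _⟩ : Fin (M + 1)) = 0 := rfl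
        rw [this, h0] at hj
        refine ⟨rfl, by omega⟩
      · rcases Nat.lt_or_ge i M with hiM | hiM
        · exfalso
          have e1 := topLevels_succ T B ⟨i, by omega⟩
          have e2 := topLevels_succ T B ⟨i + 1, by omega⟩
          have e3 := botLevels_succ T B ⟨i, by omega⟩
          have e4 := botLevels_succ T B ⟨i + 1, by omega⟩
          simp only at e1 e2 e3 e4
          rw [e1, e2, Set.mem_uIcc] at hi
          rw [e3, e4, Set.mem_uIcc] at hj
          have h1 := h ⟨i, by omega⟩ ⟨i, by omega⟩ (by simp) (by simp)
          have h2 := h ⟨i + 1, by omega⟩ ⟨i, by omega⟩ (by simp) (by simp; omega)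
          have h3 := h ⟨i, by omega⟩ ⟨i + 1, by omega⟩ (by simp; omega) (by simp)
          have h4 := h ⟨i + 1, by omega⟩ ⟨i + 1, by omega⟩ (by simp) (by simp)
          omega
        · right
          obtain rfl : i = M := by omega
          have e1 := topLevels_succ T B (Fin.last i)
          have e2 := topLevels_end T B
          simp only [Fin.val_last] at e1
          rw [e1, e2, Set.mem_uIcc] at hi
          exact ⟨rfl, by omega⟩
    · rintro (⟨rfl, rfl⟩ | ⟨rfl, rfl⟩)
      · refine ⟨⟨0, by simp, ?_⟩, ⟨0, by simp, ?_⟩⟩ <;>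
        · simp only [Fin.val_zero, level_zero]
          exact Set.left_mem_uIcc
      · refine ⟨⟨Fin.last _, by simp, ?_⟩, ⟨Fin.last _, by simp, ?_⟩⟩
        · simp only [Fin.val_last]
          rw [level_topRun h0 (by omega), level_topRun h0 (by omega), topLevels_end]
          exact Set.right_mem_uIcc
        · simp only [Fin.val_last]
          rw [level_botRun h0 (by omega), level_botRun h0 (by omega), botLevels_end]
          exact Set.right_mem_uIcc

namespace ColumnConvexPolygon

/-- The first and the last abscissa coincide, and the top run there would be both positive and zero.
-/
theorem not_width_zero (P : ColumnConvexPolygon 0) : False := by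
  have h1 := P.top_zero
  have h2 := P.top_last
  simp only [Fin.last_zero] at h2
  omega

variable (P : ColumnConvexPolygon (M + 1))

/-- The heights of the tops of the columns. -/
def colTop (i : Fin (M + 1)) : ℤ := level P.top (i + 1)

/-- The heights of the bottoms of the columns. -/
def colBot (i : Fin (M + 1)) : ℤ := level P.bot (i + 1)

theorem colBot_zero : P.colBot 0 = 0 := by
  have := level_succ P.bot 0
  simp only [Fin.val_zero, level_zero, P.bot_zero] at this
  simpa [colBot] using this

/-- The default value past the last column is right because the top path ends with an east step; for
the bottom path, below, it is right because the two paths have the same end point. -/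
theorem topLevels_eq : ∀ j ≤ M + 2, topLevels P.colTop P.colBot j = level P.top j
  | 0, _ => by simp [topLevels, colBot_zero, level_zero]
  | j + 1, hj => by
    simp only [topLevels, colTop]
    split_ifs with h
    · rfl
    · obtain rfl : j = M + 1 := by omega
      have := level_succ P.top (Fin.last _)
      rw [P.top_last, add_zero] at this
      exact this.symm

theorem botLevels_eq : ∀ j ≤ M + 2, botLevels P.colTop P.colBot j = level P.bot j
  | 0, _ => by simp [botLevels, colBot_zero, level_zero]
  | j + 1, hj => by
    simp only [botLevels, colBot, colTop]
    split_ifs with h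
    · rfl
    · obtain rfl : j = M + 1 := by omega
      rw [level_last, ← P.same_end, ← level_last]
      have := level_succ P.top (Fin.last _)
      rw [P.top_last, add_zero] at this
      exact this.symm

theorem topRun_col (i : Fin (M + 2)) : topRun P.colTop P.colBot i = P.top i := by
  rw [topRun, topLevels_eq _ _ (by omega), topLevels_eq _ _ (by omega), level_succ]
  ring

theorem botRun_col (i : Fin (M + 2)) : botRun P.colTop P.colBot i = P.bot i := by
  rw [botRun, botLevels_eq _ _ (by omega), botLevels_eq _ _ (by omega), level_succ]
  ring

theorem ext_col {P Q : ColumnConvexPolygon (M + 1)} (h1 : P.colTop = Q.colTop)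
    (h2 : P.colBot = Q.colBot) : P = Q := by
  ext i
  · rw [← topRun_col, ← topRun_col, h1, h2]
  · rw [← botRun_col, ← botRun_col, h1, h2]

theorem colTop_ofColumns {T B : Fin (M + 1) → ℤ} (h0 : B 0 = 0) (h : IsColumns T B) :
    (ofColumns T B h0 h).colTop = T := by
  ext i
  simp only [colTop, ofColumns]
  rw [level_topRun h0 (by omega), topLevels_succ]

theorem colBot_ofColumns {T B : Fin (M + 1) → ℤ} (h0 : B 0 = 0) (h : IsColumns T B) :
    (ofColumns T B h0 h).colBot = B := by
  ext i
  simp only [colBot, ofColumns]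
  rw [level_botRun h0 (by omega), botLevels_succ]

theorem disjoint_levels {j : ℕ} (h0 : 0 < j) (hj : j < M + 1) (y : ℤ)
    (h1 : y ∈ Set.uIcc (level P.top j) (level P.top (j + 1))) :
    y ∉ Set.uIcc (level P.bot j) (level P.bot (j + 1)) := by
  intro h2
  have : ((j : ℤ), y) ∈ pathVertices P.top ∩ pathVertices P.bot :=
    ⟨⟨⟨j, by omega⟩, rfl, h1⟩, ⟨⟨j, by omega⟩, rfl, h2⟩⟩
  rw [P.self_avoiding] at this
  simp only [Set.mem_insert_iff, Set.mem_singleton_iff, Prod.mk.injEq] at this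
  omega

/-- The top path starts above the bottom path, and the disjointness of their runs at every inner
abscissa prevents a crossing. -/
theorem level_bot_lt : ∀ j, j < M + 1 → level P.bot (j + 1) < level P.top (j + 1)
  | 0, _ => by
    have h1 := level_succ P.top 0
    have h2 := level_succ P.bot 0
    have := P.top_zero
    simp only [Fin.val_zero, level_zero, P.bot_zero] at h1 h2
    omega
  | j + 1, hj => by
    have := max_lt_min_of_disjoint (level_bot_lt j (by omega))
      (P.disjoint_levels (Nat.succ_pos j) hj)
    omega

/-- At an inner abscissa the two vertical runs are disjoint intervals with the bottom one below;
comparing all their end points gives the inequalities between neighbouring columns. -/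
theorem isColumns_col : IsColumns P.colTop P.colBot := by
  have key : ∀ j, j + 1 < M + 1 → level P.bot (j + 1 + 1) < level P.top (j + 1) ∧
      level P.bot (j + 1) < level P.top (j + 1 + 1) := by
    intro j hj
    have := max_lt_min_of_disjoint (P.level_bot_lt j (by omega))
      (P.disjoint_levels (Nat.succ_pos j) hj)
    constructor <;> omega
  rintro ⟨i, hi⟩ ⟨j, hj⟩ h1 h2
  simp only at h1 h2
  simp only [colTop, colBot]
  rcases Nat.lt_trichotomy i j with h | h | h
  · obtain rfl : j = i + 1 := by omega
    exact (key i hj).1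
  · subst h
    exact P.level_bot_lt i hi
  · obtain rfl : i = j + 1 := by omega
    exact (key j hi).2

theorem colBot_lt (i : Fin (M + 1)) : P.colBot i < P.colTop i :=
  P.isColumns_col i i (by omega) (by omega)

/-! ### The bounding rectangle -/

theorem topLevels_cases (T B : Fin (M + 1) → ℤ) (j : ℕ) :
    topLevels T B j = B 0 ∨ ∃ i, topLevels T B j = T i := by
  rcases j with _ | j
  · exact Or.inl rfl
  · right
    simp only [topLevels]
    split_ifs with h
    exacts [⟨_, rfl⟩, ⟨_, rfl⟩]

theorem botLevels_cases (T B : Fin (M + 1) → ℤ) (j : ℕ) :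
    botLevels T B j = T (Fin.last M) ∨ ∃ i, botLevels T B j = B i := by
  rcases j with _ | j
  · exact Or.inr ⟨_, rfl⟩
  · simp only [botLevels]
    split_ifs with h
    exacts [Or.inr ⟨_, rfl⟩, Or.inl rfl]

theorem snd_mem_of_col (i : Fin (M + 1)) :
    P.colTop i ∈ Prod.snd '' P.vertices ∧ P.colBot i ∈ Prod.snd '' P.vertices :=
  ⟨⟨((i : ℕ), P.colTop i), Or.inl ⟨i.castSucc, rfl, Set.right_mem_uIcc⟩, rfl⟩,
    ⟨((i : ℕ), P.colBot i), Or.inr ⟨i.castSucc, rfl, Set.right_mem_uIcc⟩, rfl⟩⟩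

/-- Every level of either path is a column top, a column bottom or the height of a common end point,
so the extreme heights of the polygon are attained at columns. -/
theorem exists_bounds {y : ℤ} (hy : y ∈ Prod.snd '' P.vertices) :
    (∃ i, y ≤ P.colTop i) ∧ ∃ i, P.colBot i ≤ y := by
  have hT : ∀ j ≤ M + 2, (∃ i, level P.top j ≤ P.colTop i) ∧ ∃ i, P.colBot i ≤ level P.top j := by
    intro j hj
    rw [← topLevels_eq _ _ hj]
    rcases topLevels_cases P.colTop P.colBot j with h | ⟨i, h⟩
    · rw [h]; exact ⟨⟨0, (P.colBot_lt 0).le⟩, ⟨0, le_rfl⟩⟩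
    · rw [h]; exact ⟨⟨i, le_rfl⟩, ⟨i, (P.colBot_lt i).le⟩⟩
  have hB : ∀ j ≤ M + 2, (∃ i, level P.bot j ≤ P.colTop i) ∧ ∃ i, P.colBot i ≤ level P.bot j := by
    intro j hj
    rw [← botLevels_eq _ _ hj]
    rcases botLevels_cases P.colTop P.colBot j with h | ⟨i, h⟩
    · rw [h]; exact ⟨⟨_, le_rfl⟩, ⟨_, (P.colBot_lt _).le⟩⟩
    · rw [h]; exact ⟨⟨i, (P.colBot_lt i).le⟩, ⟨i, le_rfl⟩⟩
  have key : ∀ a b : ℤ, y ∈ Set.uIcc a b →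
      ((∃ i, a ≤ P.colTop i) ∧ ∃ i, P.colBot i ≤ a) →
      ((∃ i, b ≤ P.colTop i) ∧ ∃ i, P.colBot i ≤ b) →
      (∃ i, y ≤ P.colTop i) ∧ ∃ i, P.colBot i ≤ y := by
    rintro a b hab ⟨⟨i1, h1⟩, ⟨i2, h2⟩⟩ ⟨⟨i3, h3⟩, ⟨i4, h4⟩⟩
    rcases Set.mem_uIcc.1 hab with ⟨h5, h6⟩ | ⟨h5, h6⟩
    · exact ⟨⟨i3, h6.trans h3⟩, ⟨i2, h2.trans h5⟩⟩
    · exact ⟨⟨i1, h6.trans h1⟩, ⟨i4, h4.trans h5⟩⟩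
  obtain ⟨p, ⟨i, -, hi⟩ | ⟨i, -, hi⟩, rfl⟩ := hy
  · exact key _ _ hi (hT _ (by omega)) (hT _ (by omega))
  · exact key _ _ hi (hB _ (by omega)) (hB _ (by omega))

theorem exists_isMax (f : Fin (M + 1) → ℤ) : ∃ k, ∀ i, f i ≤ f k := by
  obtain ⟨k, -, h⟩ := Finset.exists_max_image Finset.univ f ⟨0, Finset.mem_univ _⟩
  exact ⟨k, fun i => h i (Finset.mem_univ _)⟩

theorem yMax_eq {k : Fin (M + 1)} (h : ∀ i, P.colTop i ≤ P.colTop k) : P.yMax = P.colTop k := by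
  refine IsGreatest.csSup_eq ⟨(P.snd_mem_of_col k).1, fun y hy => ?_⟩
  obtain ⟨⟨i, hi⟩, -⟩ := P.exists_bounds hy
  exact hi.trans (h i)

theorem yMin_eq {k : Fin (M + 1)} (h : ∀ i, P.colBot k ≤ P.colBot i) : P.yMin = P.colBot k := by
  refine IsLeast.csInf_eq ⟨(P.snd_mem_of_col k).2, fun y hy => ?_⟩
  obtain ⟨-, ⟨i, hi⟩⟩ := P.exists_bounds hy
  exact (h i).trans hi

theorem exists_yMax : ∃ k, P.yMax = P.colTop k ∧ ∀ i, P.colTop i ≤ P.colTop k := by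
  obtain ⟨k, hk⟩ := exists_isMax P.colTop
  exact ⟨k, P.yMax_eq hk, hk⟩

theorem exists_yMin : ∃ k, P.yMin = P.colBot k ∧ ∀ i, P.colBot k ≤ P.colBot i := by
  obtain ⟨k, hk⟩ := exists_isMax fun i => -P.colBot i
  have hk' : ∀ i, P.colBot k ≤ P.colBot i := fun i => neg_le_neg_iff.1 (hk i)
  exact ⟨k, P.yMin_eq hk', hk'⟩

/-- On the left side the bottom path has only the origin, and the first run of the top path covers
the first column. -/
theorem mem_vertices_zero_iff (y : ℤ) :
    ((0 : ℤ), y) ∈ P.vertices ↔ 0 ≤ y ∧ y ≤ P.colTop 0 := by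
  have h1 := level_succ P.bot 0
  simp only [Fin.val_zero, level_zero, P.bot_zero] at h1
  have h2 : 0 < P.colTop 0 := P.colBot_zero ▸ P.colBot_lt 0
  have h2' : 0 < level P.top (0 + 1) := h2
  constructor
  · rintro (⟨i, hi, h⟩ | ⟨i, hi, h⟩)
    · obtain rfl : i = 0 := Fin.ext (by simp only at hi; simpa using hi.symm)
      simp only [Fin.val_zero, level_zero] at h
      rw [Set.mem_uIcc] at h
      simp only [colTop, Fin.val_zero]
      omega
    · obtain rfl : i = 0 := Fin.ext (by simp only at hi; simpa using hi.symm)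
      simp only [Fin.val_zero, level_zero] at h
      rw [Set.mem_uIcc] at h
      omega
  · intro h
    refine Or.inl ⟨0, by simp, ?_⟩
    simp only [Fin.val_zero, level_zero]
    rw [Set.mem_uIcc]
    exact Or.inl h

/-- On the right side the top path has only the common end point, and the last run of the bottom
path covers the last column. -/
theorem mem_vertices_last_iff (y : ℤ) : (((M + 1 : ℕ) : ℤ), y) ∈ P.vertices ↔
    P.colBot (Fin.last M) ≤ y ∧ y ≤ P.colTop (Fin.last M) := by
  have h1 : P.colTop (Fin.last M) = level P.top (M + 1 + 1) :=
    (topLevels_end _ _).symm.trans (P.topLevels_eq _ le_rfl)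
  have h2 : P.colTop (Fin.last M) = level P.bot (M + 1 + 1) :=
    (botLevels_end _ _).symm.trans (P.botLevels_eq _ le_rfl)
  have h3 : P.colTop (Fin.last M) = level P.top (M + 1) := rfl
  have h4 : P.colBot (Fin.last M) = level P.bot (M + 1) := rfl
  have h5 := P.colBot_lt (Fin.last M)
  constructor
  · rintro (⟨i, hi, h⟩ | ⟨i, hi, h⟩) <;>
    · obtain rfl : i = Fin.last _ := Fin.ext (by
        simp only at hi; rw [Fin.val_last]; exact_mod_cast hi.symm)
      simp only [Fin.val_last] at h
      rw [Set.mem_uIcc] at h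
      omega
  · intro h
    refine Or.inr ⟨Fin.last _, by simp, ?_⟩
    simp only [Fin.val_last]
    rw [Set.mem_uIcc]
    left
    omega

theorem hasSW_iff : P.HasSW ↔ ∀ i, P.colBot 0 ≤ P.colBot i := by
  obtain ⟨k, hk, hmin⟩ := P.exists_yMin
  rw [HasSW, mem_vertices_zero_iff, hk, colBot_zero]
  constructor
  · rintro ⟨h, -⟩ i
    exact h.trans (hmin i)
  · intro h
    refine ⟨h k, (hmin 0).trans ?_⟩
    exact (P.colBot_lt 0).le

theorem hasSE_iff : P.HasSE ↔ ∀ i, P.colBot (Fin.last M) ≤ P.colBot i := by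
  obtain ⟨k, hk, hmin⟩ := P.exists_yMin
  rw [HasSE, mem_vertices_last_iff, hk]
  constructor
  · rintro ⟨h, -⟩ i
    exact h.trans (hmin i)
  · intro h
    exact ⟨h k, (hmin _).trans (P.colBot_lt _).le⟩

theorem hasNE_iff : P.HasNE ↔ ∀ i, P.colTop i ≤ P.colTop (Fin.last M) := by
  obtain ⟨k, hk, hmax⟩ := P.exists_yMax
  rw [HasNE, mem_vertices_last_iff, hk]
  constructor
  · rintro ⟨-, h⟩ i
    exact (hmax i).trans h
  · intro h
    exact ⟨(P.colBot_lt _).le.trans (hmax _), h k⟩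

end ColumnConvexPolygon

end Polyomino
end

noncomputable section

namespace Polyomino

/-! ### Convexity in terms of the columns -/

theorem sub_eq_sum_ite (L : ℕ → ℤ) {j n : ℕ} (hj : j ≤ n) :
    L j - L 0 = ∑ i ∈ Finset.range n, if i < j then L (i + 1) - L i else 0 := by
  rw [← Finset.sum_range_sub, ← Finset.sum_filter]
  refine Finset.sum_congr ?_ fun _ _ => rfl
  ext i
  simp only [Finset.mem_range, Finset.mem_filter]
  omega

theorem sub_le_sum_max (L : ℕ → ℤ) {j n : ℕ} (hj : j ≤ n) :
    L j - L 0 ≤ ∑ i ∈ Finset.range n, max (L (i + 1) - L i) 0 := by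
  rw [sub_eq_sum_ite L hj]
  refine Finset.sum_le_sum fun i _ => ?_
  split_ifs
  · exact le_max_left _ _
  · exact le_max_right _ _

/-- The steps before j telescope to L j - L 0. Each of them is at most its positive part, and each
later step is compared with 0; equality of the sums forces equality term by term. -/
theorem sum_max_eq_iff (L : ℕ → ℤ) {j n : ℕ} (hj : j ≤ n) :
    ∑ i ∈ Finset.range n, max (L (i + 1) - L i) 0 = L j - L 0 ↔
      ∀ i < n, (i < j → L i ≤ L (i + 1)) ∧ (j ≤ i → L (i + 1) ≤ L i) := by
  rw [sub_eq_sum_ite L hj, eq_comm, Finset.sum_eq_sum_iff_of_le]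
  · refine forall_congr' fun i => ?_
    rw [Finset.mem_range]
    refine imp_congr_right fun _ => ?_
    split_ifs <;> omega
  · intro i _
    split_ifs
    · exact le_max_left _ _
    · exact le_max_right _ _

/-- `f` weakly increases up to position `j` and weakly decreases from there on. -/
def IsPeak {n : ℕ} (f : Fin n → ℤ) (j : Fin n) : Prop :=
  (∀ a b, a ≤ b → b ≤ j → f a ≤ f b) ∧ ∀ a b, j ≤ a → a ≤ b → f b ≤ f a

theorem IsPeak.le {n : ℕ} {f : Fin n → ℤ} {j : Fin n} (h : IsPeak f j) (i : Fin n) :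
    f i ≤ f j := by
  rcases le_total i j with hij | hij
  · exact h.1 _ _ hij le_rfl
  · exact h.2 _ _ le_rfl hij

/-- Levels are offset by one: the height of column i is `L (i + 1)`, so a peak at column j is a peak
of the levels at j + 1. -/
theorem isPeak_of_steps {M : ℕ} {f : Fin (M + 1) → ℤ} {j : Fin (M + 1)} {L : ℕ → ℤ}
    (hL : ∀ i : Fin (M + 1), L (i + 1) = f i)
    (h : ∀ i < M + 2, (i < (j : ℕ) + 1 → L i ≤ L (i + 1)) ∧ ((j : ℕ) + 1 ≤ i → L (i + 1) ≤ L i)) :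
    IsPeak f j := by
  constructor
  · intro a b hab hbj
    rw [← hL, ← hL]
    refine Nat.le_induction (P := fun c _ => c ≤ (j : ℕ) → L (a + 1) ≤ L (c + 1))
      (fun _ => le_rfl) (fun c hc ih hcj => ?_) (b : ℕ) hab hbj
    exact (ih (by omega)).trans ((h (c + 1) (by omega)).1 (by omega))
  · intro a b hja hab
    rw [← hL, ← hL]
    refine Nat.le_induction (P := fun c _ => c < M + 1 → L (c + 1) ≤ L (a + 1))
      (fun _ => le_rfl) (fun c hc ih hcj => ?_) (b : ℕ) hab b.2
    have hja' : (j : ℕ) ≤ a := hja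
    exact ((h (c + 1) (by omega)).2 (by omega)).trans (ih (by omega))

theorem IsPeak.steps {M : ℕ} {f : Fin (M + 1) → ℤ} {j : Fin (M + 1)} (h : IsPeak f j) {L : ℕ → ℤ}
    (hL : ∀ i : Fin (M + 1), L (i + 1) = f i) (h0 : L 0 ≤ f 0) (h1 : L (M + 2) ≤ f (Fin.last M))
    (i : ℕ) (hi : i < M + 2) :
    (i < (j : ℕ) + 1 → L i ≤ L (i + 1)) ∧ ((j : ℕ) + 1 ≤ i → L (i + 1) ≤ L i) := by
  constructor
  · intro hij
    rcases i with _ | i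
    · rw [show L (0 + 1) = f 0 from hL 0]; exact h0
    · have e1 := hL ⟨i, by omega⟩
      have e2 := hL ⟨i + 1, by omega⟩
      simp only at e1 e2
      rw [e1, e2]
      refine h.1 _ _ ?_ ?_ <;> rw [Fin.le_def] <;> simp only <;> omega
  · intro hij
    rcases i with _ | i
    · omega
    · have e1 := hL ⟨i, by omega⟩
      simp only at e1
      rcases Nat.lt_or_ge i M with hiM | hiM
      · have e2 := hL ⟨i + 1, by omega⟩
        simp only at e2
        rw [e1, e2]
        refine h.2 _ _ ?_ ?_ <;> rw [Fin.le_def] <;> simp only <;> omega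
      · obtain rfl : i = M := by omega
        rw [e1]
        exact h1

namespace ColumnConvexPolygon

variable {M : ℕ} (P : ColumnConvexPolygon (M + 1))

theorem halfVertical_eq : P.halfVertical = ∑ i, P.topN i + ∑ i, P.botS i := by
  have h1 := P.two_mul_halfVertical
  rw [P.verticalPerimeter_eq, Finset.sum_add_distrib] at h1
  omega

theorem sum_topN : ∑ i, P.topN i =
    ∑ i ∈ Finset.range (M + 2), max (topLevels P.colTop P.colBot (i + 1) -
      topLevels P.colTop P.colBot i) 0 := by
  rw [Finset.sum_range]
  refine Finset.sum_congr rfl fun i _ => ?_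
  rw [topN, ← topRun_col]
  rfl

theorem sum_botS : ∑ i, P.botS i =
    ∑ i ∈ Finset.range (M + 2), max (-botLevels P.colTop P.colBot (i + 1) -
      -botLevels P.colTop P.colBot i) 0 := by
  rw [Finset.sum_range]
  refine Finset.sum_congr rfl fun i _ => ?_
  rw [botS, ← botRun_col]
  simp only [botRun]
  congr 1
  ring

theorem isConvex_iff_halfVertical : P.IsConvex ↔ P.halfVertical = P.yMax - P.yMin := by
  have h1 := P.two_mul_halfVertical
  rw [IsConvex, perimeter, ← h1]
  constructor <;> intro h <;> linarith

/-- Half the vertical perimeter counts the north steps of the top path and the south steps of the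
bottom path. The former are at least the rise to the highest top, the latter at least the descent to
the lowest bottom. Convexity means equality in both, which by `sum_max_eq_iff` is unimodality of the
tops and of the negated bottoms. -/
theorem isConvex_iff : P.IsConvex ↔
    (∃ j, IsPeak P.colTop j) ∧ ∃ j, IsPeak (fun i => -P.colBot i) j := by
  have htl : ∀ i : Fin (M + 1), topLevels P.colTop P.colBot (i + 1) = P.colTop i :=
    topLevels_succ _ _
  have hbl : ∀ i : Fin (M + 1), -botLevels P.colTop P.colBot (i + 1) = -P.colBot i :=
    fun i => by rw [botLevels_succ]
  have ht0 : topLevels P.colTop P.colBot 0 = 0 := P.colBot_zero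
  have hb0 : botLevels P.colTop P.colBot 0 = 0 := P.colBot_zero
  have key : ∀ j l : Fin (M + 1), P.yMax = P.colTop j → P.yMin = P.colBot l →
      (P.IsConvex ↔
        (∀ i < M + 2, (i < (j : ℕ) + 1 →
          topLevels P.colTop P.colBot i ≤ topLevels P.colTop P.colBot (i + 1)) ∧
          ((j : ℕ) + 1 ≤ i →
          topLevels P.colTop P.colBot (i + 1) ≤ topLevels P.colTop P.colBot i)) ∧
        (∀ i < M + 2, (i < (l : ℕ) + 1 →
          -botLevels P.colTop P.colBot i ≤ -botLevels P.colTop P.colBot (i + 1)) ∧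
          ((l : ℕ) + 1 ≤ i →
          -botLevels P.colTop P.colBot (i + 1) ≤ -botLevels P.colTop P.colBot i))) := by
    intro j l hj hl
    have h1 := sub_le_sum_max (topLevels P.colTop P.colBot)
      (show (j : ℕ) + 1 ≤ M + 2 by omega)
    have h2 := sub_le_sum_max (fun i => -botLevels P.colTop P.colBot i)
      (show (l : ℕ) + 1 ≤ M + 2 by omega)
    rw [← sum_max_eq_iff (topLevels P.colTop P.colBot) (show (j : ℕ) + 1 ≤ M + 2 by omega),
      ← sum_max_eq_iff (fun i => -botLevels P.colTop P.colBot i)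
      (show (l : ℕ) + 1 ≤ M + 2 by omega), isConvex_iff_halfVertical, halfVertical_eq, hj, hl]
    rw [htl, ht0, ← sum_topN] at *
    rw [hbl, hb0, ← sum_botS] at *
    constructor
    · intro h; constructor <;> omega
    · intro h; omega
  obtain ⟨j, hj, hjmax⟩ := P.exists_yMax
  obtain ⟨l, hl, hlmin⟩ := P.exists_yMin
  constructor
  · intro h
    rw [key j l hj hl] at h
    exact ⟨⟨j, isPeak_of_steps htl h.1⟩,
      ⟨l, isPeak_of_steps (L := fun i => -botLevels P.colTop P.colBot i) hbl h.2⟩⟩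
  · rintro ⟨⟨j, hj⟩, ⟨l, hl⟩⟩
    rw [key j l (P.yMax_eq hj.le) (P.yMin_eq fun i => neg_le_neg_iff.1 (hl.le i))]
    refine ⟨hj.steps htl ?_ ?_, hl.steps (L := fun i => -botLevels P.colTop P.colBot i) hbl ?_ ?_⟩
    · rw [ht0, ← P.colBot_zero]; exact (P.colBot_lt 0).le
    · rw [topLevels_end]
    · rw [hb0, P.colBot_zero]
    · rw [botLevels_end]
      exact neg_le_neg (P.colBot_lt _).le

end ColumnConvexPolygon

end Polyomino
end

noncomputable section

namespace Polyomino

open ColumnConvexPolygon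

/-! ### Comonotone statistics of the columns -/

/-- A scalar statistic that is additive on comonotone functions and vanishes on constants. -/
structure IsComonotoneFn {ι : Type*} (w : (ι → ℤ) → ℤ) : Prop where
  add : ∀ f g : ι → ℤ, (∀ a b, f a < f b → g a ≤ g b) → w (f + g) = w f + w g
  const : ∀ c : ℤ, w (fun _ => c) = 0

theorem isComonotone_of_forall {ι : Type*} {k : ℕ} {w : (ι → ℤ) → Fin k → ℤ}
    (h : ∀ j, IsComonotoneFn fun f => w f j) : IsComonotone w :=
  ⟨fun f g hfg => funext fun j => (h j).add f g hfg, fun c => funext fun j => (h j).const c⟩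

theorem IsComonotoneFn.fn_add {ι : Type*} {u v : (ι → ℤ) → ℤ} (hu : IsComonotoneFn u)
    (hv : IsComonotoneFn v) : IsComonotoneFn fun f => u f + v f :=
  ⟨fun f g h => by rw [hu.add f g h, hv.add f g h]; ring,
    fun c => by rw [hu.const, hv.const, add_zero]⟩

theorem IsComonotoneFn.const_mul {ι : Type*} {u : (ι → ℤ) → ℤ} (hu : IsComonotoneFn u) (a : ℤ) :
    IsComonotoneFn fun f => a * u f :=
  ⟨fun f g h => by rw [hu.add f g h]; ring, fun c => by rw [hu.const, mul_zero]⟩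

theorem IsComonotoneFn.fn_sum {ι κ : Type*} (S : Finset κ) {u : κ → (ι → ℤ) → ℤ}
    (hu : ∀ i, IsComonotoneFn (u i)) : IsComonotoneFn fun f => ∑ i ∈ S, u i f :=
  ⟨fun f g h => by rw [← Finset.sum_add_distrib]; exact Finset.sum_congr rfl fun i _ => (hu i).add f g h,
    fun c => Finset.sum_eq_zero fun i _ => (hu i).const c⟩

theorem isComonotoneFn_sub {ι : Type*} (x y : ι) : IsComonotoneFn fun f : ι → ℤ => f x - f y :=
  ⟨fun f g _ => by simp only [Pi.add_apply]; ring, fun c => sub_self c⟩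

/-- For comonotone f and g the differences between x and y never have opposite signs, and the
positive part is additive on numbers of equal sign. So step counts qualify although they are not
linear in the heights. -/
theorem isComonotoneFn_max {ι : Type*} (x y : ι) :
    IsComonotoneFn fun f : ι → ℤ => max (f x - f y) 0 :=
  ⟨fun f g h => by
    have h1 := h x y
    have h2 := h y x
    simp only [Pi.add_apply]
    rcases lt_trichotomy (f x) (f y) with h3 | h3 | h3
    · have := h1 h3; omega
    · omega
    · have := h2 h3; omega, fun c => by simp⟩

variable {M k : ℕ}

theorem exists_topRun_eq {n : ℕ} (τ β : Fin (M + 1) → Fin n) (i : Fin (M + 2)) :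
    ∃ x y, ∀ f : Fin n → ℤ, topRun (f ∘ τ) (f ∘ β) i = f x - f y := by
  have h : ∀ j, ∃ x, ∀ f : Fin n → ℤ, topLevels (f ∘ τ) (f ∘ β) j = f x := by
    rintro (_ | j)
    · exact ⟨β 0, fun f => rfl⟩
    · by_cases hj : j < M + 1
      · exact ⟨τ ⟨j, hj⟩, fun f => dif_pos hj⟩
      · exact ⟨τ (Fin.last M), fun f => dif_neg hj⟩
  obtain ⟨x, hx⟩ := h (i + 1)
  obtain ⟨y, hy⟩ := h i
  exact ⟨x, y, fun f => by rw [topRun, hx, hy]⟩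

theorem exists_botRun_eq {n : ℕ} (τ β : Fin (M + 1) → Fin n) (i : Fin (M + 2)) :
    ∃ x y, ∀ f : Fin n → ℤ, botRun (f ∘ τ) (f ∘ β) i = f x - f y := by
  have h : ∀ j, ∃ x, ∀ f : Fin n → ℤ, botLevels (f ∘ τ) (f ∘ β) j = f x := by
    rintro (_ | j)
    · exact ⟨β 0, fun f => rfl⟩
    · by_cases hj : j < M + 1
      · exact ⟨β ⟨j, hj⟩, fun f => dif_pos hj⟩
      · exact ⟨τ (Fin.last M), fun f => dif_neg hj⟩
  obtain ⟨x, hx⟩ := h (i + 1)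
  obtain ⟨y, hy⟩ := h i
  exact ⟨x, y, fun f => by rw [botRun, hx, hy]⟩

/-- The value of a linear statistic in terms of the columns. -/
def columnStat (a b c d : Fin k → Fin (M + 2) → ℤ) (T B : Fin (M + 1) → ℤ) : Fin k → ℤ :=
  fun j => ∑ i, (a j i * max (topRun T B i) 0 + b j i * max (-topRun T B i) 0 +
    c j i * max (botRun T B i) 0 + d j i * max (-botRun T B i) 0)

theorem linearStat_eq (a b c d : Fin k → Fin (M + 2) → ℤ) (P : ColumnConvexPolygon (M + 1)) :
    linearStat a b c d P = columnStat a b c d P.colTop P.colBot := by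
  ext j
  simp only [linearStat, columnStat, topRun_col, botRun_col]
  rfl

/-- A statistic of the columns which is comonotone for every identification of heights. -/
def IsColumnStat (W : (Fin (M + 1) → ℤ) → (Fin (M + 1) → ℤ) → Fin k → ℤ) : Prop :=
  ∀ (n : ℕ) (τ β : Fin (M + 1) → Fin n), IsComonotone fun f : Fin n → ℤ => W (f ∘ τ) (f ∘ β)

theorem isColumnStat_columnStat (a b c d : Fin k → Fin (M + 2) → ℤ) :
    IsColumnStat (columnStat a b c d) := by
  intro n τ β
  refine isComonotone_of_forall fun j => IsComonotoneFn.fn_sum _ fun i => ?_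
  obtain ⟨x, y, hxy⟩ := exists_topRun_eq τ β i
  obtain ⟨z, t, hzt⟩ := exists_botRun_eq τ β i
  simp only [hxy, hzt, neg_sub]
  exact ((((isComonotoneFn_max x y).const_mul _).fn_add ((isComonotoneFn_max y x).const_mul _)).fn_add
    ((isComonotoneFn_max z t).const_mul _)).fn_add ((isComonotoneFn_max t z).const_mul _)

/-- Half of the vertical perimeter in terms of the columns. -/
def halfStat (T B : Fin (M + 1) → ℤ) : ℤ :=
  columnStat (k := 1) (fun _ _ => 1) (fun _ _ => 0) (fun _ _ => 0) (fun _ _ => 1) T B 0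

/-- The area in terms of the columns. -/
def areaStat (T B : Fin (M + 1) → ℤ) : ℤ := ∑ i, (T i - B i)

theorem halfVertical_eq_halfStat (P : ColumnConvexPolygon (M + 1)) :
    P.halfVertical = halfStat P.colTop P.colBot := by
  rw [P.halfVertical_eq, ← Finset.sum_add_distrib, halfStat, ← linearStat_eq]
  simp [linearStat]

theorem area_eq_areaStat (P : ColumnConvexPolygon (M + 1)) :
    P.area = areaStat P.colTop P.colBot := rfl

theorem isComonotoneFn_halfStat {n : ℕ} (τ β : Fin (M + 1) → Fin n) :
    IsComonotoneFn fun f : Fin n → ℤ => halfStat (f ∘ τ) (f ∘ β) := by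
  have h := isColumnStat_columnStat (k := 1) (fun _ _ => 1) (fun _ _ => 0) (fun _ _ => 0)
    (fun _ _ => 1) n τ β
  exact ⟨fun f g hfg => congrFun (h.add f g hfg) 0, fun c => congrFun (h.const c) 0⟩

theorem isComonotoneFn_areaStat {n : ℕ} (τ β : Fin (M + 1) → Fin n) :
    IsComonotoneFn fun f : Fin n → ℤ => areaStat (f ∘ τ) (f ∘ β) :=
  IsComonotoneFn.fn_sum _ fun i => isComonotoneFn_sub (τ i) (β i)

theorem isColumnStat_perimArea :
    IsColumnStat fun T B : Fin (M + 1) → ℤ => ![halfStat T B, areaStat T B] := fun n τ β =>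
  isComonotone_of_forall fun j => by
    fin_cases j
    · exact isComonotoneFn_halfStat τ β
    · exact isComonotoneFn_areaStat τ β

theorem isColumnStat_perimOnly :
    IsColumnStat fun T B : Fin (M + 1) → ℤ => ![halfStat T B] := fun n τ β =>
  isComonotone_of_forall fun j => by
    fin_cases j
    exact isComonotoneFn_halfStat τ β

theorem isColumnStat_areaOnly :
    IsColumnStat fun T B : Fin (M + 1) → ℤ => ![areaStat T B] := fun n τ β =>
  isComonotone_of_forall fun j => by
    fin_cases j
    exact isComonotoneFn_areaStat τ β

theorem topRun_add (T B T' B' : Fin (M + 1) → ℤ) (i : Fin (M + 2)) :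
    topRun (T + T') (B + B') i = topRun T B i + topRun T' B' i := by
  have h : ∀ j, topLevels (T + T') (B + B') j = topLevels T B j + topLevels T' B' j := by
    rintro (_ | j)
    · rfl
    · simp only [topLevels]; split_ifs <;> rfl
  simp only [topRun, h]
  ring

theorem botRun_add (T B T' B' : Fin (M + 1) → ℤ) (i : Fin (M + 2)) :
    botRun (T + T') (B + B') i = botRun T B i + botRun T' B' i := by
  have h : ∀ j, botLevels (T + T') (B + B') j = botLevels T B j + botLevels T' B' j := by
    rintro (_ | j)
    · rfl
    · simp only [botLevels]; split_ifs <;> rfl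
  simp only [botRun, h]
  ring

theorem areaStat_add (T B T' B' : Fin (M + 1) → ℤ) :
    areaStat (T + T') (B + B') = areaStat T B + areaStat T' B' := by
  simp only [areaStat, ← Finset.sum_add_distrib, Pi.add_apply]
  exact Finset.sum_congr rfl fun i _ => by ring

/-- The effect on a linear statistic of a translation of the columns that only changes top runs
that are north runs, bottom runs in `E` that are north runs, and other bottom runs that are south
runs. -/
theorem columnStat_add (a b c d : Fin k → Fin (M + 2) → ℤ) (E : Finset (Fin (M + 2)))
    {T B T' B' : Fin (M + 1) → ℤ}
    (ht : ∀ i, topRun T' B' i = 0 ∨ 0 ≤ topRun T B i ∧ 0 ≤ topRun T B i + topRun T' B' i)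
    (hE : ∀ i ∈ E, botRun T' B' i = 0 ∨ 0 ≤ botRun T B i ∧ 0 ≤ botRun T B i + botRun T' B' i)
    (hE' : ∀ i ∉ E, botRun T' B' i = 0 ∨ botRun T B i ≤ 0 ∧ botRun T B i + botRun T' B' i ≤ 0) :
    columnStat a b c d (T + T') (B + B') = columnStat a b c d T B + fun j =>
      ∑ i, (a j i * topRun T' B' i + if i ∈ E then c j i * botRun T' B' i
        else -(d j i * botRun T' B' i)) := by
  ext j
  simp only [columnStat, Pi.add_apply, ← Finset.sum_add_distrib]
  refine Finset.sum_congr rfl fun i _ => ?_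
  rw [topRun_add, botRun_add]
  have h1 : max (topRun T B i + topRun T' B' i) 0 = max (topRun T B i) 0 + topRun T' B' i := by
    have := ht i; omega
  have h2 : max (-(topRun T B i + topRun T' B' i)) 0 = max (-topRun T B i) 0 := by
    have := ht i; omega
  rw [h1, h2]
  split_ifs with hi
  · have h3 : max (botRun T B i + botRun T' B' i) 0 = max (botRun T B i) 0 + botRun T' B' i := by
      have := hE i hi; omega
    have h4 : max (-(botRun T B i + botRun T' B' i)) 0 = max (-botRun T B i) 0 := by
      have := hE i hi; omega
    rw [h3, h4]
    ring
  · have h3 : max (botRun T B i + botRun T' B' i) 0 = max (botRun T B i) 0 := by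
      have := hE' i hi; omega
    have h4 : max (-(botRun T B i + botRun T' B' i)) 0 =
        max (-botRun T B i) 0 - botRun T' B' i := by
      have := hE' i hi; omega
    rw [h3, h4]
    ring

/-! ### Families presented by partitions of a labelled relation -/

/-- A family of polygons of width `M + 1` whose column heights are the partitions of a labelled
relation on `n + 1` heights, the dual partitions being translates of the partitions. -/
structure Presentation (S : Set (ColumnConvexPolygon (M + 1))) (n : ℕ)
    (T₀ B₀ : Fin (M + 1) → ℤ) where
  A : (Fin (M + 1) → ℤ) → (Fin (M + 1) → ℤ) → Prop
  mem_iff : ∀ P, P ∈ S ↔ A P.colTop P.colBot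
  columns : ∀ T B, A T B → IsColumns T B
  r : Fin (n + 1) → Fin (n + 1) → Prop
  τ : Fin (M + 1) → Fin (n + 1)
  β : Fin (M + 1) → Fin (n + 1)
  heights : (Fin (M + 1) → ℤ) → (Fin (M + 1) → ℤ) → Fin (n + 1) → ℤ
  heights_comp : ∀ f : Fin (n + 1) → ℤ, heights (f ∘ τ) (f ∘ β) = f
  heights_τ : ∀ T B, A T B → heights T B ∘ τ = T
  heights_β : ∀ T B, A T B → heights T B ∘ β = B
  partition_iff : ∀ f, IsPartition r f ↔ A (f ∘ τ) (f ∘ β)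
  shift : Fin (n + 1) → ℤ
  shift_τ : shift ∘ τ = T₀
  shift_β : shift ∘ β = B₀
  shift_zero : B₀ 0 = 0
  dual_iff : ∀ f, IsDualPartition r f ↔ IsPartition r (f - shift)

namespace Presentation

variable {S : Set (ColumnConvexPolygon (M + 1))} {n : ℕ} {T₀ B₀ : Fin (M + 1) → ℤ}
  (p : Presentation S n T₀ B₀)

theorem bijOn_heights : Set.BijOn (fun P => p.heights P.colTop P.colBot) S
    {f | IsPartition p.r f ∧ f (p.β 0) = 0} := by
  refine ⟨fun P hP => ?_, fun P hP Q hQ h => ?_, fun f hf => ?_⟩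
  · have hA := (p.mem_iff P).1 hP
    refine ⟨?_, ?_⟩
    · rw [p.partition_iff, p.heights_τ _ _ hA, p.heights_β _ _ hA]
      exact hA
    · have := congrFun (p.heights_β _ _ hA) 0
      exact this.trans P.colBot_zero
  · have hA := (p.mem_iff P).1 hP
    have hA' := (p.mem_iff Q).1 hQ
    refine ext_col ?_ ?_
    · rw [← p.heights_τ _ _ hA, ← p.heights_τ _ _ hA']
      exact congrArg (· ∘ p.τ) h
    · rw [← p.heights_β _ _ hA, ← p.heights_β _ _ hA']
      exact congrArg (· ∘ p.β) h
  · have hA := (p.partition_iff f).1 hf.1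
    refine ⟨ofColumns (f ∘ p.τ) (f ∘ p.β) hf.2 (p.columns _ _ hA), ?_, ?_⟩
    · rw [p.mem_iff, colTop_ofColumns, colBot_ofColumns]
      exact hA
    · simp only
      rw [colTop_ofColumns, colBot_ofColumns, p.heights_comp]

/-- The shift vanishes at the normalised height `β 0`, so the translation respects the
normalisation. -/
theorem bijOn_shift : Set.BijOn (fun f => f + p.shift)
    {f | IsPartition p.r f ∧ f (p.β 0) = 0} {f | IsDualPartition p.r f ∧ f (p.β 0) = 0} := by
  have h0 : p.shift (p.β 0) = 0 := by
    have := congrFun p.shift_β 0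
    rw [p.shift_zero] at this
    exact this
  refine ⟨fun f hf => ⟨?_, ?_⟩, fun f _ g _ h => add_right_cancel h,
    fun f hf => ⟨f - p.shift, ⟨(p.dual_iff f).1 hf.1, ?_⟩, sub_add_cancel f _⟩⟩
  · rw [p.dual_iff, add_sub_cancel_right]
    exact hf.1
  · exact (congrArg₂ (· + ·) hf.2 h0).trans (add_zero 0)
  · rw [Pi.sub_apply, hf.2, h0, sub_zero]

/-- Self-reciprocity of the generating function of a presented family. -/
theorem reciprocity {W : (Fin (M + 1) → ℤ) → (Fin (M + 1) → ℤ) → Fin k → ℤ} (hW : IsColumnStat W)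
    {γ : Fin k → ℤ} (hγ : ∀ T B, p.A T B → W (T + T₀) (B + B₀) = W T B + γ)
    {w : ColumnConvexPolygon (M + 1) → Fin k → ℤ} (hw : ∀ P, w P = W P.colTop P.colBot)
    (hfin : ∀ v, {P | P ∈ S ∧ w P = v}.Finite) :
    ∃ R, IsRationalGF S w R ∧ invVars k R = (-1) ^ n * (monom γ * R) := by
  have h1 : ∀ P ∈ S, W (p.heights P.colTop P.colBot ∘ p.τ) (p.heights P.colTop P.colBot ∘ p.β) =
      w P := by
    intro P hP
    have hA := (p.mem_iff P).1 hP
    rw [p.heights_τ _ _ hA, p.heights_β _ _ hA, hw]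
  have hfin1 := finite_fiber_congr (g := fun f => W (f ∘ p.τ) (f ∘ p.β)) _ p.bijOn_heights h1 hfin
  have h2 : ∀ f ∈ {f | IsPartition p.r f ∧ f (p.β 0) = 0},
      W ((f + p.shift) ∘ p.τ) ((f + p.shift) ∘ p.β) = W (f ∘ p.τ) (f ∘ p.β) + γ := by
    intro f hf
    rw [← hγ _ _ ((p.partition_iff f).1 hf.1)]
    exact congrArg₂ W (congrArg (f ∘ p.τ + ·) p.shift_τ) (congrArg (f ∘ p.β + ·) p.shift_β)
  have hfin2 := finite_fiber_congr (f := fun f => W (f ∘ p.τ) (f ∘ p.β) + γ)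
    (g := fun f => W (f ∘ p.τ) (f ∘ p.β)) _ p.bijOn_shift h2
    (fun v => by simpa only [eq_sub_iff_add_eq] using hfin1 (v - γ))
  obtain ⟨R, hR, hR'⟩ := partition_reciprocity p.r (p.β 0) (hW _ p.τ p.β) hfin1 hfin2
  refine ⟨R, (isRationalGF_iff _ _ _).2 ⟨hfin, ?_⟩, ?_⟩
  · rw [countSeries_congr (g := fun f => W (f ∘ p.τ) (f ∘ p.β)) _ p.bijOn_heights h1]
    exact hR
  -- The dual partitions are translates of the partitions, so their series has the value u^γ R
  -- besides the one given by reciprocity; comparing the two gives the formula.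
  · rw [← countSeries_congr (f := fun f => W (f ∘ p.τ) (f ∘ p.β) + γ)
      (g := fun f => W (f ∘ p.τ) (f ∘ p.β)) _ p.bijOn_shift h2, countSeries_add_const] at hR'
    have := hR'.unique (hR.shift γ)
    rw [← this, ← mul_assoc, ← pow_add, ← two_mul, pow_mul]
    simp

end Presentation

end Polyomino
end

/-! ### Presentations from inequalities between column heights; the families in terms of columns. -/

noncomputable section

namespace Polyomino

open ColumnConvexPolygon

variable {M k : ℕ}

/-- The columns whose heights satisfy weak inequalities between tops (`RT`), weak inequalities
between bottoms (`RB`), and strict inequalities from bottoms to tops (`RBT`). -/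
def Satisfies (RT RB RBT : Fin (M + 1) → Fin (M + 1) → Prop) (T B : Fin (M + 1) → ℤ) : Prop :=
  (∀ i j, RT i j → T i ≤ T j) ∧ (∀ i j, RB i j → B i ≤ B j) ∧ ∀ i j, RBT i j → B i < T j

/-- A presentation with one height for each top and for each bottom; the bottoms are labelled
in the order `σ`. -/
def twoBlock {S : Set (ColumnConvexPolygon (M + 1))} {T₀ B₀ : Fin (M + 1) → ℤ}
    (RT RB RBT : Fin (M + 1) → Fin (M + 1) → Prop) (σ : Equiv.Perm (Fin (M + 1)))
    (hT : ∀ i j, RT i j → i < j ∧ T₀ j = T₀ i + 1)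
    (hB : ∀ i j, RB i j → σ i < σ j ∧ B₀ j = B₀ i + 1)
    (hBT : ∀ i j, RBT i j → T₀ j = B₀ i - 1) (h0 : B₀ 0 = 0)
    (hS : ∀ P, P ∈ S ↔ Satisfies RT RB RBT P.colTop P.colBot)
    (hcol : ∀ T B, Satisfies RT RB RBT T B → IsColumns T B) :
    Presentation S (M + 1 + M) T₀ B₀ where
  A := Satisfies RT RB RBT
  mem_iff := hS
  columns := hcol
  r x y := (∃ i j, RT i j ∧ x = Fin.castAdd (M + 1) i ∧ y = Fin.castAdd (M + 1) j) ∨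
    (∃ i j, RB i j ∧ x = Fin.natAdd (M + 1) (σ i) ∧ y = Fin.natAdd (M + 1) (σ j)) ∨
    ∃ i j, RBT i j ∧ x = Fin.natAdd (M + 1) (σ i) ∧ y = Fin.castAdd (M + 1) j
  τ := Fin.castAdd (M + 1)
  β i := Fin.natAdd (M + 1) (σ i)
  heights T B := Fin.append (m := M + 1) (n := M + 1) T (B ∘ σ.symm)
  heights_comp f := by
    have : (fun i => f (Fin.natAdd (M + 1) (σ i))) ∘ σ.symm =
      fun i => f (Fin.natAdd (M + 1) i) := by ext; simp
    exact (congrArg (Fin.append _) this).trans Fin.append_castAdd_natAdd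
  heights_τ T B _ := by ext i; exact Fin.append_left _ _ i
  heights_β T B _ := by
    ext i
    refine (Fin.append_right _ _ (σ i)).trans ?_
    simp
  partition_iff f := by
    -- Tops have smaller labels than bottoms, so relations from a bottom to a top decrease the label
    -- and are strict.
    have h1 : ∀ i j : Fin (M + 1), (Fin.castAdd (M + 1) i) < Fin.natAdd (M + 1) j := fun i j => by
      rw [Fin.lt_def]; simp; omega
    constructor
    · intro h
      exact ⟨fun i j hij => (h _ _ (Or.inl ⟨i, j, hij, rfl, rfl⟩)).1,
        fun i j hij => (h _ _ (Or.inr (Or.inl ⟨i, j, hij, rfl, rfl⟩))).1,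
        fun i j hij => (h _ _ (Or.inr (Or.inr ⟨i, j, hij, rfl, rfl⟩))).2 (h1 _ _)⟩
    · rintro ⟨ha, hb, hc⟩ _ _ (⟨i, j, hij, rfl, rfl⟩ | ⟨i, j, hij, rfl, rfl⟩ | ⟨i, j, hij, rfl, rfl⟩)
      · refine ⟨ha i j hij, fun hlt => absurd hlt ?_⟩
        have : (i : ℕ) < j := (hT i j hij).1
        rw [Fin.lt_def]; simp; omega
      · refine ⟨hb i j hij, fun hlt => absurd hlt ?_⟩
        have : (σ i : ℕ) < σ j := (hB i j hij).1
        rw [Fin.lt_def]; simp; omega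
      · exact ⟨(hc i j hij).le, fun _ => hc i j hij⟩
  shift := Fin.append (m := M + 1) (n := M + 1) T₀ (B₀ ∘ σ.symm)
  shift_τ := by ext i; exact Fin.append_left _ _ i
  shift_β := by
    ext i
    refine (Fin.append_right _ _ (σ i)).trans ?_
    simp
  shift_zero := h0
  dual_iff f := by
    have h1 : ∀ i j : Fin (M + 1), (Fin.castAdd (M + 1) i) < Fin.natAdd (M + 1) j := fun i j => by
      rw [Fin.lt_def]; simp; omega
    have e1 : ∀ i, (Fin.append (m := M + 1) (n := M + 1) T₀ (B₀ ∘ σ.symm)) (Fin.castAdd (M + 1) i) = T₀ i :=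
      Fin.append_left _ _
    have e2 : ∀ i, (Fin.append (m := M + 1) (n := M + 1) T₀ (B₀ ∘ σ.symm)) (Fin.natAdd (M + 1) (σ i)) = B₀ i := fun i => by
      rw [Fin.append_right]; simp
    -- Duality makes weak relations strict and strict ones weak. Over the integers this tightens the
    -- former by one and relaxes the latter by one, which are the increments that `hT`, `hB` and
    -- `hBT` prescribe for the shift.
    refine forall_congr' fun x => forall_congr' fun y => imp_congr_right ?_
    rintro (⟨i, j, hij, rfl, rfl⟩ | ⟨i, j, hij, rfl, rfl⟩ | ⟨i, j, hij, rfl, rfl⟩)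
    · obtain ⟨h2, h3⟩ := hT i j hij
      have h4 : Fin.castAdd (M + 1) i < Fin.castAdd (M + 1) j := h2
      simp only [Pi.sub_apply, e1]
      constructor
      · rintro ⟨-, h⟩
        have := h h4
        exact ⟨by omega, fun h5 => absurd h5 h4.not_gt⟩
      · rintro ⟨h, -⟩
        exact ⟨by omega, fun _ => by omega⟩
    · obtain ⟨h2, h3⟩ := hB i j hij
      have h4 : Fin.natAdd (M + 1) (σ i) < Fin.natAdd (M + 1) (σ j) := by
        have : (σ i : ℕ) < σ j := h2
        rw [Fin.lt_def]; simp; omega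
      simp only [Pi.sub_apply, e2]
      constructor
      · rintro ⟨-, h⟩
        have := h h4
        exact ⟨by omega, fun h5 => absurd h5 h4.not_gt⟩
      · rintro ⟨h, -⟩
        exact ⟨by omega, fun _ => by omega⟩
    · have h3 := hBT i j hij
      have h4 := h1 j (σ i)
      simp only [Pi.sub_apply, e1, e2]
      constructor
      · rintro ⟨h, -⟩
        exact ⟨by omega, fun _ => by omega⟩
      · rintro ⟨-, h⟩
        have := h h4
        exact ⟨by omega, fun h5 => absurd h5 h4.not_gt⟩

/-- The columns with a common bottom whose tops satisfy weak inequalities (`RT`), and strict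
inequalities with the bottom (`R`). -/
def SatisfiesFlat (RT : Fin (M + 1) → Fin (M + 1) → Prop) (R : Fin (M + 1) → Prop)
    (T B : Fin (M + 1) → ℤ) : Prop :=
  (∀ i, B i = B 0) ∧ (∀ i j, RT i j → T i ≤ T j) ∧ ∀ j, R j → B 0 < T j

/-- A presentation with one height for each top and one for the common bottom. -/
def oneBlock {S : Set (ColumnConvexPolygon (M + 1))} {T₀ : Fin (M + 1) → ℤ}
    (RT : Fin (M + 1) → Fin (M + 1) → Prop) (R : Fin (M + 1) → Prop)
    (hT : ∀ i j, RT i j → i < j ∧ T₀ j = T₀ i + 1) (hBT : ∀ j, R j → T₀ j = -1)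
    (hS : ∀ P, P ∈ S ↔ SatisfiesFlat RT R P.colTop P.colBot)
    (hcol : ∀ T B, SatisfiesFlat RT R T B → IsColumns T B) :
    Presentation S (M + 1) T₀ 0 where
  A := SatisfiesFlat RT R
  mem_iff := hS
  columns := hcol
  r x y := (∃ i j, RT i j ∧ x = Fin.castSucc i ∧ y = Fin.castSucc j) ∨
    ∃ j, R j ∧ x = Fin.last (M + 1) ∧ y = Fin.castSucc j
  τ := Fin.castSucc
  β _ := Fin.last (M + 1)
  heights T B := Fin.snoc (α := fun _ => ℤ) T (B 0)
  heights_comp f := by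
    ext x
    refine Fin.lastCases ?_ (fun i => ?_) x <;> simp
  heights_τ T B _ := by ext i; simp
  heights_β T B h := by ext i; simp [h.1 i]
  partition_iff f := by
    constructor
    · intro h
      exact ⟨fun _ => rfl, fun i j hij => (h _ _ (Or.inl ⟨i, j, hij, rfl, rfl⟩)).1,
        fun j hj => (h _ _ (Or.inr ⟨j, hj, rfl, rfl⟩)).2 (Fin.castSucc_lt_last j)⟩
    · rintro ⟨-, ha, hc⟩ _ _ (⟨i, j, hij, rfl, rfl⟩ | ⟨j, hj, rfl, rfl⟩)
      · refine ⟨ha i j hij, fun hlt => absurd hlt ?_⟩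
        rw [Fin.castSucc_lt_castSucc_iff]
        exact (hT i j hij).1.not_gt
      · exact ⟨(hc j hj).le, fun _ => hc j hj⟩
  shift := Fin.snoc (α := fun _ => ℤ) T₀ 0
  shift_τ := by ext i; simp
  shift_β := by ext i; simp
  shift_zero := rfl
  dual_iff f := by
    refine forall_congr' fun x => forall_congr' fun y => imp_congr_right ?_
    rintro (⟨i, j, hij, rfl, rfl⟩ | ⟨j, hj, rfl, rfl⟩)
    · obtain ⟨h2, h3⟩ := hT i j hij
      have h4 : i.castSucc < j.castSucc := h2
      simp only [Pi.sub_apply, Fin.snoc_castSucc]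
      constructor
      · rintro ⟨-, h⟩
        have := h h4
        exact ⟨by omega, fun h5 => absurd h5 h4.not_gt⟩
      · rintro ⟨h, -⟩
        exact ⟨by omega, fun _ => by omega⟩
    · have h3 := hBT j hj
      have h4 := Fin.castSucc_lt_last j
      simp only [Pi.sub_apply, Fin.snoc_castSucc, Fin.snoc_last]
      constructor
      · rintro ⟨h, -⟩
        exact ⟨by omega, fun _ => by omega⟩
      · rintro ⟨-, h⟩
        have := h h4
        exact ⟨by omega, fun h5 => absurd h5 h4.not_gt⟩

/-! ### Membership in the families in terms of the columns -/

theorem forall_step_iff_monotone {f : Fin (M + 1) → ℤ} :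
    (∀ i j : Fin (M + 1), (i : ℕ) + 1 = j → f i ≤ f j) ↔ Monotone f := by
  rw [Fin.monotone_iff_le_succ]
  constructor
  · intro h i
    exact h _ _ (by simp)
  · intro h i j hij
    have hi : (i : ℕ) < M := by omega
    have h1 := h ⟨i, hi⟩
    have e1 : (⟨i, hi⟩ : Fin M).castSucc = i := rfl
    have e2 : (⟨i, hi⟩ : Fin M).succ = j := Fin.ext hij
    rwa [e1, e2] at h1

theorem forall_step_iff_antitone {f : Fin (M + 1) → ℤ} :
    (∀ i j : Fin (M + 1), (i : ℕ) = j + 1 → f i ≤ f j) ↔ Antitone f := by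
  have h : Antitone f ↔ Monotone fun i => -f i :=
    ⟨fun h _ _ hab => neg_le_neg (h hab), fun h _ _ hab => neg_le_neg_iff.1 (h hab)⟩
  rw [h, ← forall_step_iff_monotone]
  exact ⟨fun h i j hij => neg_le_neg (h j i hij.symm), fun h i j hij => neg_le_neg_iff.1 (h j i hij.symm)⟩

/-- Past the peak f decreases, yet its last value is a maximum, so f is constant there. -/
theorem IsPeak.monotone {f : Fin (M + 1) → ℤ} {j : Fin (M + 1)} (h : IsPeak f j)
    (hl : ∀ i, f i ≤ f (Fin.last M)) : Monotone f := by
  intro a b hab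
  rcases le_total b j with hb | hb
  · exact h.1 a b hab hb
  · have h1 := h.2 b (Fin.last M) hb (Fin.le_last b)
    exact (hl a).trans h1

theorem IsPeak.antitone {f : Fin (M + 1) → ℤ} {j : Fin (M + 1)} (h : IsPeak f j)
    (hl : ∀ i, f i ≤ f 0) : Antitone f := by
  intro a b hab
  rcases le_total j a with hb | hb
  · exact h.2 a b hb hab
  · have h1 := h.1 0 a (Fin.zero_le a) hb
    exact (hl b).trans h1

theorem isPeak_last {f : Fin (M + 1) → ℤ} (h : Monotone f) : IsPeak f (Fin.last M) :=
  ⟨fun _ _ hab _ => h hab, fun a b ha hb => by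
    obtain rfl : a = Fin.last M := le_antisymm (Fin.le_last a) ha
    obtain rfl : b = Fin.last M := le_antisymm (Fin.le_last b) hb
    exact le_rfl⟩

theorem isPeak_zero {f : Fin (M + 1) → ℤ} (h : Antitone f) : IsPeak f 0 :=
  ⟨fun a b hab hb => by
    obtain rfl : b = 0 := le_antisymm hb (Fin.zero_le b)
    obtain rfl : a = 0 := le_antisymm hab (Fin.zero_le a)
    exact le_rfl, fun _ _ _ hab => h hab⟩

variable (P : ColumnConvexPolygon (M + 1))

/-- The south-east corner makes the bottoms decrease, and the south-west corner makes the first of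
them minimal; together they are constant. -/
theorem mem_ferrers_iff : P ∈ ferrers (M + 1) ↔
    (∀ i, P.colBot i = P.colBot 0) ∧ Monotone P.colTop := by
  simp only [ferrers, Set.mem_ofPred_eq, isConvex_iff, hasSW_iff, hasSE_iff, hasNE_iff]
  constructor
  · rintro ⟨⟨⟨j, hj⟩, ⟨l, hl⟩⟩, h1, h2, h3⟩
    refine ⟨fun i => le_antisymm ?_ (h1 i), hj.monotone h3⟩
    have h4 : Monotone fun i => -P.colBot i := hl.monotone fun i => neg_le_neg (h2 i)
    exact neg_le_neg_iff.1 (h4 (Fin.zero_le i))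
  · rintro ⟨h1, h2⟩
    exact ⟨⟨⟨_, isPeak_last h2⟩, ⟨_, isPeak_last fun i j _ => by simp only [h1]; exact le_rfl⟩⟩,
      fun i => (h1 i).ge, fun i => by rw [h1 i, h1], fun i => h2 (Fin.le_last i)⟩

theorem mem_stack_iff : P ∈ stackPolygons (M + 1) ↔ Antitone P.colBot ∧ Monotone P.colTop := by
  simp only [stackPolygons, Set.mem_ofPred_eq, isConvex_iff, hasSE_iff, hasNE_iff]
  constructor
  · rintro ⟨⟨⟨j, hj⟩, ⟨l, hl⟩⟩, h2, h3⟩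
    have h4 : Monotone fun i => -P.colBot i := hl.monotone fun i => neg_le_neg (h2 i)
    exact ⟨fun a b hab => neg_le_neg_iff.1 (h4 hab), hj.monotone h3⟩
  · rintro ⟨h1, h2⟩
    exact ⟨⟨⟨_, isPeak_last h2⟩, ⟨_, isPeak_last fun i j h => neg_le_neg (h1 h)⟩⟩,
      fun i => h1 (Fin.le_last i), fun i => h2 (Fin.le_last i)⟩

theorem mem_staircase_iff : P ∈ staircase (M + 1) ↔ Monotone P.colBot ∧ Monotone P.colTop := by
  simp only [staircase, Set.mem_ofPred_eq, isConvex_iff, hasSW_iff, hasNE_iff]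
  constructor
  · rintro ⟨⟨⟨j, hj⟩, ⟨l, hl⟩⟩, h2, h3⟩
    have h4 : Antitone fun i => -P.colBot i := hl.antitone fun i => neg_le_neg (h2 i)
    exact ⟨fun a b hab => neg_le_neg_iff.1 (h4 hab), hj.monotone h3⟩
  · rintro ⟨h1, h2⟩
    exact ⟨⟨⟨_, isPeak_last h2⟩, ⟨_, isPeak_zero fun i j h => neg_le_neg (h1 h)⟩⟩,
      fun i => h1 (Fin.zero_le i), fun i => h2 (Fin.le_last i)⟩

theorem mem_directedConvex_iff : P ∈ directedConvex (M + 1) ↔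
    Monotone P.colBot ∧ ∃ j, IsPeak P.colTop j := by
  simp only [directedConvex, Set.mem_ofPred_eq, isConvex_iff, hasSW_iff]
  constructor
  · rintro ⟨⟨hj, ⟨l, hl⟩⟩, h2⟩
    have h4 : Antitone fun i => -P.colBot i := hl.antitone fun i => neg_le_neg (h2 i)
    exact ⟨fun a b hab => neg_le_neg_iff.1 (h4 hab), hj⟩
  · rintro ⟨h1, h2⟩
    exact ⟨⟨h2, ⟨_, isPeak_zero fun i j h => neg_le_neg (h1 h)⟩⟩, fun i => h1 (Fin.zero_le i)⟩

theorem mem_bargraphs_iff : P ∈ bargraphs (M + 1) ↔ ∀ i, P.colBot i = P.colBot 0 := by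
  obtain ⟨l, hl, hmin⟩ := P.exists_yMin
  constructor
  · intro h i
    exact (h i).trans (h 0).symm
  · intro h i
    exact (h i).trans (by rw [hl, h l])

/-- The first and last runs of the bottom path are never south, so only differences of consecutive
bottoms matter. -/
theorem mem_directedColumnConvex_iff : P ∈ directedColumnConvex (M + 1) ↔ Monotone P.colBot := by
  rw [← forall_step_iff_monotone]
  have h0 : ∀ i, P.botS i = 0 ↔ botLevels P.colTop P.colBot i ≤
      botLevels P.colTop P.colBot (i + 1) := by
    intro i
    rw [botS, ← botRun_col, botRun]
    omega
  constructor
  · intro h i j hij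
    have h1 := (h0 ⟨j, by omega⟩).1 (h _)
    simp only at h1
    rw [botLevels_succ] at h1
    rw [← hij, botLevels_succ] at h1
    exact h1
  · intro h i
    rw [h0]
    rcases i with ⟨i, hi⟩
    rcases i with _ | i
    · exact le_rfl
    · have e1 := botLevels_succ P.colTop P.colBot ⟨i, by omega⟩
      simp only at e1 ⊢
      rw [e1]
      rcases Nat.lt_or_ge i M with hM | hM
      · have e2 := botLevels_succ P.colTop P.colBot ⟨i + 1, by omega⟩
        simp only at e2
        rw [e2]
        exact h _ _ rfl
      · obtain rfl : i = M := by omega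
        rw [botLevels_end]
        exact (P.colBot_lt _).le

end Polyomino
end

noncomputable section

namespace Polyomino

open ColumnConvexPolygon

variable {M k : ℕ}

/-! ### Presentations of the families -/

theorem IsColumns.of_steps {T B : Fin (M + 1) → ℤ} (h1 : ∀ i, B i < T i)
    (h2 : ∀ i j : Fin (M + 1), (i : ℕ) = j + 1 → B i < T j)
    (h3 : ∀ i j : Fin (M + 1), (i : ℕ) + 1 = j → B i < T j) : IsColumns T B := by
  intro i j hij hji
  rcases lt_trichotomy (i : ℕ) j with h | h | h
  · exact h2 j i (by omega)
  · obtain rfl : i = j := Fin.ext h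
    exact h1 i
  · exact h3 j i (by omega)

/-- Column-convex polygons as partitions. -/
def columnConvexPresentation (M : ℕ) :
    Presentation (columnConvex (M + 1)) (M + 1 + M) (fun _ => -1) (fun _ => 0) :=
  twoBlock (fun _ _ => False) (fun _ _ => False)
    (fun i j => (j : ℕ) ≤ i + 1 ∧ (i : ℕ) ≤ j + 1) (Equiv.refl _)
    (fun _ _ h => h.elim) (fun _ _ h => h.elim) (fun _ _ _ => by simp) rfl
    (fun P => ⟨fun _ => ⟨fun _ _ h => h.elim, fun _ _ h => h.elim,
      fun i j h => P.isColumns_col j i h.1 h.2⟩, fun _ => Set.mem_univ P⟩)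
    (fun _ _ h i j hij hji => h.2.2 j i ⟨hij, hji⟩)

/-- Bar-graphs as partitions. -/
def bargraphsPresentation (M : ℕ) :
    Presentation (bargraphs (M + 1)) (M + 1) (fun _ => -1) 0 :=
  oneBlock (fun _ _ => False) (fun _ => True) (fun _ _ h => h.elim) (fun _ _ => rfl)
    (fun P => by
      rw [mem_bargraphs_iff]
      exact ⟨fun h => ⟨h, fun _ _ h => h.elim, fun j _ => h j ▸ P.colBot_lt j⟩, fun h => h.1⟩)
    (fun _ _ h i j _ _ => by rw [h.1 j]; exact h.2.2 i trivial)

/-- Ferrers graphs as partitions. -/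
def ferrersPresentation (M : ℕ) :
    Presentation (ferrers (M + 1)) (M + 1) (fun i => (i : ℤ) - 1) 0 :=
  oneBlock (fun i j => (i : ℕ) + 1 = j) (fun j => j = 0)
    (fun i j h => ⟨by rw [Fin.lt_def]; omega, by omega⟩) (fun j h => by simp [h])
    (fun P => by
      rw [mem_ferrers_iff, ← forall_step_iff_monotone]
      exact ⟨fun h => ⟨h.1, h.2, fun j hj => hj ▸ P.colBot_lt 0⟩, fun h => ⟨h.1, h.2.1⟩⟩)
    (fun _ _ h i j _ _ => by
      rw [h.1 j]
      exact (h.2.2 0 rfl).trans_le (forall_step_iff_monotone.1 h.2.1 (Fin.zero_le i)))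

/-- Stacks as partitions. -/
def stackPresentation (M : ℕ) : Presentation (stackPolygons (M + 1)) (M + 1 + M)
    (fun i => (i : ℤ) - 1) (fun i => -(i : ℤ)) :=
  twoBlock (fun i j => (i : ℕ) + 1 = j) (fun i j => (i : ℕ) = j + 1) (fun i j => i = 0 ∧ j = 0)
    Fin.revPerm (fun i j h => ⟨by rw [Fin.lt_def]; omega, by omega⟩)
    (fun i j h => ⟨by simp only [Fin.revPerm_apply, Fin.rev_lt_rev]; rw [Fin.lt_def]; omega, by omega⟩)
    (fun i j h => by simp [h.1, h.2]) (by simp)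
    (fun P => by
      rw [mem_stack_iff, ← forall_step_iff_monotone, ← forall_step_iff_antitone]
      exact ⟨fun h => ⟨h.2, h.1, fun i j hij => by rw [hij.1, hij.2]; exact P.colBot_lt 0⟩,
        fun h => ⟨h.2.1, h.1⟩⟩)
    (fun _ _ h i j _ _ => ((forall_step_iff_antitone.1 h.2.1 (Fin.zero_le j)).trans_lt
      (h.2.2 0 0 ⟨rfl, rfl⟩)).trans_le (forall_step_iff_monotone.1 h.1 (Fin.zero_le i)))

theorem isColumns_of_monotone {T B : Fin (M + 1) → ℤ} (hB : Monotone B)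
    (h1 : ∀ i, B i < T i) (h2 : ∀ i j : Fin (M + 1), (i : ℕ) = j + 1 → B i < T j) :
    IsColumns T B :=
  IsColumns.of_steps h1 h2 fun i j hij =>
    (hB (by rw [Fin.le_def]; omega)).trans_lt (h1 j)

/-- Staircase polygons of width at least `2` as partitions. -/
def staircasePresentation (hM : 1 ≤ M) : Presentation (staircase (M + 1)) (M + 1 + M)
    (fun i => (i : ℤ)) (fun i => (i : ℤ)) :=
  twoBlock (fun i j => (i : ℕ) + 1 = j) (fun i j => (i : ℕ) + 1 = j) (fun i j => (i : ℕ) = j + 1)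
    (Equiv.refl _) (fun i j h => ⟨by rw [Fin.lt_def]; omega, by omega⟩)
    (fun i j h => ⟨by simp only [Equiv.refl_apply]; rw [Fin.lt_def]; omega, by omega⟩)
    (fun i j h => by omega) (by simp)
    (fun P => by
      rw [mem_staircase_iff, ← forall_step_iff_monotone, ← forall_step_iff_monotone]
      exact ⟨fun h => ⟨h.2, h.1, fun i j hij => P.isColumns_col j i (by omega) (by omega)⟩,
        fun h => ⟨h.2.1, h.1⟩⟩)
    -- Only B (j + 1) < T j is imposed: a relation B i < T i would require T₀ i = B₀ i - 1, whereas
    -- here T₀ = B₀. That inequality follows from a neighbouring column, which is where width at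
    -- least two is used.
    (fun T B h => by
      have hT := forall_step_iff_monotone.1 h.1
      have hB := forall_step_iff_monotone.1 h.2.1
      refine isColumns_of_monotone hB (fun i => ?_) h.2.2
      by_cases hi : (i : ℕ) < M
      · exact (hB (by rw [Fin.le_def]; simp)).trans_lt (h.2.2 ⟨i + 1, by omega⟩ i rfl)
      · refine (h.2.2 i ⟨i - 1, by omega⟩ ?_).trans_le (hT ?_)
        · simp only; omega
        · rw [Fin.le_def]; simp)

/-- Directed column-convex polygons as partitions. -/
def directedColumnConvexPresentation (M : ℕ) :
    Presentation (directedColumnConvex (M + 1)) (M + 1 + M)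
      (fun i => min (i : ℤ) (M - 1)) (fun i => (i : ℤ)) :=
  twoBlock (fun _ _ => False) (fun i j => (i : ℕ) + 1 = j)
    -- Since the tops are not monotone and no column follows the last one, the last column needs its
    -- own inequality. This forces its top to be shifted by M - 1 instead of M, hence the minimum in
    -- the shift.
    (fun i j => (i : ℕ) = j + 1 ∨ i = Fin.last M ∧ j = Fin.last M)
    (Equiv.refl _) (fun i j h => h.elim)
    (fun i j h => ⟨by simp only [Equiv.refl_apply]; rw [Fin.lt_def]; omega, by omega⟩)
    (fun i j h => by
      rcases h with h | ⟨rfl, rfl⟩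
      · omega
      · simp) (by simp)
    (fun P => by
      rw [mem_directedColumnConvex_iff, ← forall_step_iff_monotone]
      refine ⟨fun h => ⟨fun _ _ h => h.elim, h, fun i j hij => ?_⟩, fun h => h.2.1⟩
      rcases hij with h | ⟨rfl, rfl⟩
      · exact P.isColumns_col j i (by omega) (by omega)
      · exact P.colBot_lt _)
    (fun T B h => by
      have hB := forall_step_iff_monotone.1 h.2.1
      refine isColumns_of_monotone hB (fun i => ?_) fun i j hij => h.2.2 i j (Or.inl hij)
      by_cases hi : (i : ℕ) < M
      · exact (hB (by rw [Fin.le_def]; simp)).trans_lt (h.2.2 ⟨i + 1, by omega⟩ i (Or.inl rfl))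
      · obtain rfl : i = Fin.last M := Fin.ext (by rw [Fin.val_last]; omega)
        exact h.2.2 _ _ (Or.inr ⟨rfl, rfl⟩))

/-! ### The effect of the translations on linear statistics -/

theorem forall_run {p : Fin (M + 2) → Prop} (h0 : p 0) (hs : ∀ i : Fin M, p i.succ.castSucc)
    (hl : p (Fin.last (M + 1))) (i : Fin (M + 2)) : p i :=
  Fin.lastCases hl (fun i => Fin.cases h0 hs i) i

theorem topRun_zero (T B : Fin (M + 1) → ℤ) : topRun T B 0 = T 0 - B 0 := by
  simp [topRun, topLevels]

theorem botRun_zero (T B : Fin (M + 1) → ℤ) : botRun T B 0 = 0 := by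
  simp [botRun, botLevels]

theorem topRun_succ (T B : Fin (M + 1) → ℤ) (i : Fin M) :
    topRun T B i.succ.castSucc = T i.succ - T i.castSucc := by
  rw [topRun, ← topLevels_succ T B i.succ, ← topLevels_succ T B i.castSucc]
  rfl

theorem botRun_succ (T B : Fin (M + 1) → ℤ) (i : Fin M) :
    botRun T B i.succ.castSucc = B i.succ - B i.castSucc := by
  rw [botRun, ← botLevels_succ T B i.succ, ← botLevels_succ T B i.castSucc]
  rfl

theorem topRun_last (T B : Fin (M + 1) → ℤ) : topRun T B (Fin.last (M + 1)) = 0 := by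
  have h1 := topLevels_succ T B (Fin.last M)
  have h2 := topLevels_end T B
  rw [topRun]
  simp only [Fin.val_last] at *
  rw [h1, h2, sub_self]

theorem botRun_last (T B : Fin (M + 1) → ℤ) :
    botRun T B (Fin.last (M + 1)) = T (Fin.last M) - B (Fin.last M) := by
  have h1 := botLevels_succ T B (Fin.last M)
  have h2 := botLevels_end T B
  rw [botRun]
  simp only [Fin.val_last] at *
  rw [h1, h2]

/-- The translation `(T₀, B₀)` keeps the directions of the runs that it changes: north for the
top runs and for the bottom runs in `E`, south for the other bottom runs. -/
def KeepsRuns (E : Finset (Fin (M + 2))) (T₀ B₀ T B : Fin (M + 1) → ℤ) : Prop :=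
  (∀ i, topRun T₀ B₀ i = 0 ∨ 0 ≤ topRun T B i ∧ 0 ≤ topRun T B i + topRun T₀ B₀ i) ∧
  (∀ i ∈ E, botRun T₀ B₀ i = 0 ∨ 0 ≤ botRun T B i ∧ 0 ≤ botRun T B i + botRun T₀ B₀ i) ∧
  ∀ i ∉ E, botRun T₀ B₀ i = 0 ∨ botRun T B i ≤ 0 ∧ botRun T B i + botRun T₀ B₀ i ≤ 0

/-- The changes of the top runs telescope to the change of the total rise; besides them only the
bottom runs outside `E`, the south ones, count. -/
theorem halfStat_add {E : Finset (Fin (M + 2))} {T₀ B₀ T B : Fin (M + 1) → ℤ}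
    (h : KeepsRuns E T₀ B₀ T B) : halfStat (T + T₀) (B + B₀) = halfStat T B +
      ((T₀ (Fin.last M) - B₀ 0) + ∑ i, if i ∈ E then 0 else -botRun T₀ B₀ i) := by
  rw [halfStat, columnStat_add _ _ _ _ E h.1 h.2.1 h.2.2, Pi.add_apply, halfStat]
  congr 1
  rw [Finset.sum_add_distrib]
  congr 1
  · simp only [one_mul, topRun]
    rw [← Finset.sum_range (fun i => topLevels T₀ B₀ (i + 1) - topLevels T₀ B₀ i),
      Finset.sum_range_sub, topLevels_end]
    rfl
  · simp

/-- Lowering all tops by one changes only the first top run and the last bottom run, which are north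
runs of length at least one. -/
theorem keepsRuns_columnConvex {T B : Fin (M + 1) → ℤ}
    (h : (columnConvexPresentation M).A T B) :
    KeepsRuns Finset.univ (fun _ => -1) (fun _ => 0) T B := by
  have hc := (columnConvexPresentation M).columns T B h
  have h0 := hc 0 0 (by simp) (by simp)
  have hl := hc (Fin.last M) (Fin.last M) (by simp) (by simp)
  refine ⟨forall_run ?_ (fun i => ?_) ?_, forall_run ?_ (fun i => ?_) ?_,
    fun i hi => absurd (Finset.mem_univ i) hi⟩ <;>
  simp only [Finset.mem_univ, forall_const, topRun_zero, topRun_succ, topRun_last, botRun_zero,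
    botRun_succ, botRun_last] <;> omega

theorem keepsRuns_bargraphs {T B : Fin (M + 1) → ℤ} (h : (bargraphsPresentation M).A T B) :
    KeepsRuns Finset.univ (fun _ => -1) 0 T B := by
  have hc := (bargraphsPresentation M).columns T B h
  have h0 := hc 0 0 (by simp) (by simp)
  have hl := hc (Fin.last M) (Fin.last M) (by simp) (by simp)
  refine ⟨forall_run ?_ (fun i => ?_) ?_, forall_run ?_ (fun i => ?_) ?_,
    fun i hi => absurd (Finset.mem_univ i) hi⟩ <;>
  simp only [Finset.mem_univ, forall_const, topRun_zero, topRun_succ, topRun_last, botRun_zero,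
    botRun_succ, botRun_last,
    Pi.zero_apply] <;> omega

theorem keepsRuns_ferrers {T B : Fin (M + 1) → ℤ} (h : (ferrersPresentation M).A T B) :
    KeepsRuns Finset.univ (fun i => (i : ℤ) - 1) 0 T B := by
  have hc := (ferrersPresentation M).columns T B h
  have h0 := hc 0 0 (by simp) (by simp)
  have hl := hc (Fin.last M) (Fin.last M) (by simp) (by simp)
  have hs : ∀ i : Fin M, T i.castSucc ≤ T i.succ := fun i => h.2.1 _ _ (by simp)
  refine ⟨forall_run ?_ (fun i => ?_) ?_, forall_run ?_ (fun i => ?_) ?_,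
    fun i hi => absurd (Finset.mem_univ i) hi⟩ <;>
  simp only [Finset.mem_univ, forall_const, topRun_zero, topRun_succ, topRun_last, botRun_zero,
    botRun_succ, botRun_last,
    Pi.zero_apply, Fin.val_zero, Fin.val_succ, Fin.val_castSucc, Fin.val_last]
  · right; simp; omega
  · have := hs i; right; simp; omega
  · simp
  · simp
  · simp
  · right; omega

/-- Each inner top run gains a north step and each inner bottom run a south step; the last bottom
run, the only one in the exceptional set, remains weakly north. -/
theorem keepsRuns_stack {T B : Fin (M + 1) → ℤ} (h : (stackPresentation M).A T B) :
    KeepsRuns {Fin.last (M + 1)} (fun i => (i : ℤ) - 1) (fun i => -(i : ℤ)) T B := by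
  have hc := (stackPresentation M).columns T B h
  have h0 := hc 0 0 (by simp) (by simp)
  have hl := hc (Fin.last M) (Fin.last M) (by simp) (by simp)
  have hs : ∀ i : Fin M, T i.castSucc ≤ T i.succ := fun i => h.1 _ _ (by simp)
  have hb : ∀ i : Fin M, B i.succ ≤ B i.castSucc := fun i => h.2.1 _ _ (by simp)
  refine ⟨forall_run ?_ (fun i => ?_) ?_, fun i hi => ?_,
    forall_run ?_ (fun i => ?_) ?_⟩
  · rw [topRun_zero, topRun_zero]; simp; omega
  · rw [topRun_succ, topRun_succ]
    have := hs i
    simp; omega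
  · simp [topRun_last]
  · rw [Finset.mem_singleton.1 hi, botRun_last, botRun_last]
    simp only [Fin.val_last]
    omega
  · simp [botRun_zero]
  · intro _
    rw [botRun_succ, botRun_succ]
    have := hb i
    simp; omega
  · intro hi
    exact absurd (Finset.mem_singleton_self _) hi

theorem keepsRuns_staircase {hM : 1 ≤ M} {T B : Fin (M + 1) → ℤ}
    (h : (staircasePresentation hM).A T B) :
    KeepsRuns Finset.univ (fun i => (i : ℤ)) (fun i => (i : ℤ)) T B := by
  have hc := (staircasePresentation hM).columns T B h
  have hl := hc (Fin.last M) (Fin.last M) (by simp) (by simp)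
  have hs : ∀ i : Fin M, T i.castSucc ≤ T i.succ := fun i => h.1 _ _ (by simp)
  have hb : ∀ i : Fin M, B i.castSucc ≤ B i.succ := fun i => h.2.1 _ _ (by simp)
  refine ⟨forall_run ?_ (fun i => ?_) ?_, forall_run ?_ (fun i => ?_) ?_,
    fun i hi => absurd (Finset.mem_univ i) hi⟩ <;>
  simp only [Finset.mem_univ, forall_const, topRun_zero, topRun_succ, topRun_last, botRun_zero,
    botRun_succ, botRun_last,
    Fin.val_zero, Fin.val_succ, Fin.val_castSucc, Fin.val_last]
  · simp
  · have := hs i; right; simp; omega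
  · simp
  · simp
  · have := hb i; right; simp; omega
  · simp

/-! ### Self-reciprocity for all linear statistics -/

theorem Presentation.isSelfReciprocal {S : Set (ColumnConvexPolygon (M + 1))} {n : ℕ}
    {T₀ B₀ : Fin (M + 1) → ℤ} (p : Presentation S n T₀ B₀) {E : Finset (Fin (M + 2))}
    (hE : ∀ T B, p.A T B → KeepsRuns E T₀ B₀ T B) (a b c d : Fin k → Fin (M + 2) → ℤ)
    (hfin : ∀ v, {P | P ∈ S ∧ linearStat a b c d P = v}.Finite) :
    ∃ R, IsRationalGF S (linearStat a b c d) R ∧ IsSelfReciprocal R := by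
  obtain ⟨R, hR, hinv⟩ := p.reciprocity (isColumnStat_columnStat a b c d)
    (fun T B hA => columnStat_add a b c d E (hE T B hA).1 (hE T B hA).2.1 (hE T B hA).2.2)
    (w := linearStat a b c d) (linearStat_eq a b c d) hfin
  refine ⟨R, hR, ?_⟩
  rcases neg_one_pow_eq_or (RatFun k) n with h | h <;> rw [h] at hinv
  · exact ⟨_, Or.inl (hinv.trans (one_mul _))⟩
  · exact ⟨_, Or.inr (hinv.trans (neg_one_mul _))⟩

/-- Monotonicity is void for a single column, so width one falls under the column-convex
presentation. -/
theorem staircase_one : staircase 1 = columnConvex 1 := by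
  ext P
  rw [mem_staircase_iff (M := 0)]
  refine ⟨fun _ => Set.mem_univ P, fun _ => ⟨?_, ?_⟩⟩ <;>
  · intro i j _
    rw [show i = j from Fin.ext (by omega)]

theorem Family.isSelfReciprocal (F : Family) {m : ℕ} (hm : 1 ≤ m) (k : ℕ)
    (a b c d : Fin k → Fin (m + 1) → ℤ)
    (hfin : ∀ w, {P | P ∈ F.ofWidth m ∧ linearStat a b c d P = w}.Finite) :
    ∃ R : RatFun k, IsRationalGF (F.ofWidth m) (linearStat a b c d) R ∧ IsSelfReciprocal R := by
  obtain ⟨M, rfl⟩ : ∃ M, m = M + 1 := ⟨m - 1, by omega⟩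
  cases F with
  | ferrers =>
    exact (ferrersPresentation M).isSelfReciprocal (fun _ _ => keepsRuns_ferrers) a b c d hfin
  | stack => exact (stackPresentation M).isSelfReciprocal (fun _ _ => keepsRuns_stack) a b c d hfin
  | staircase =>
    rcases Nat.eq_zero_or_pos M with rfl | hM
    · have h : Family.staircase.ofWidth (0 + 1) = Polyomino.columnConvex 1 := staircase_one
      rw [h] at hfin ⊢
      exact (columnConvexPresentation 0).isSelfReciprocal (fun _ _ => keepsRuns_columnConvex)
        a b c d hfin
    · exact (staircasePresentation hM).isSelfReciprocal (fun _ _ => keepsRuns_staircase) a b c d hfin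
  | bargraphs =>
    exact (bargraphsPresentation M).isSelfReciprocal (fun _ _ => keepsRuns_bargraphs) a b c d hfin
  | columnConvex =>
    exact (columnConvexPresentation M).isSelfReciprocal (fun _ _ => keepsRuns_columnConvex)
      a b c d hfin

end Polyomino
end

/-! ### Finite fibres and the inversion relations that follow from reciprocity. -/

noncomputable section

namespace Polyomino

open ColumnConvexPolygon

variable {M k : ℕ}

/-! ### Finiteness of the fibres -/

theorem finite_of_bounded {a b : ℤ} {S : Set (ColumnConvexPolygon (M + 1))}
    (h : ∀ P ∈ S, ∀ i, a ≤ P.colBot i ∧ P.colTop i ≤ b) : S.Finite := by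
  refine Set.Finite.of_finite_image (f := fun P => (P.colTop, P.colBot))
    (((Set.finite_Icc (fun _ => a) (fun _ => b)).prod
      (Set.finite_Icc (fun _ => a) (fun _ => b))).subset ?_) ?_
  · rintro _ ⟨P, hP, rfl⟩
    have h1 := h P hP
    have h2 := P.colBot_lt
    refine ⟨⟨fun i => ?_, fun i => (h1 i).2⟩, ⟨fun i => (h1 i).1, fun i => ?_⟩⟩
    · exact (h1 i).1.trans (h2 i).le
    · exact (h2 i).le.trans (h1 i).2
  · intro P _ Q _ hPQ
    exact ext_col (congrArg Prod.fst hPQ) (congrArg Prod.snd hPQ)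

/-- A top is reached from height 0 by north steps of the top path, and half the vertical perimeter
counts all of these. -/
theorem colTop_le_halfVertical (P : ColumnConvexPolygon (M + 1)) (i : Fin (M + 1)) :
    P.colTop i ≤ P.halfVertical := by
  have h1 := sub_le_sum_max (topLevels P.colTop P.colBot) (show (i : ℕ) + 1 ≤ M + 2 by omega)
  have h2 : 0 ≤ ∑ i, P.botS i := Finset.sum_nonneg fun i _ => le_max_right _ _
  have h3 : topLevels P.colTop P.colBot 0 = 0 := P.colBot_zero
  rw [topLevels_succ, h3, ← sum_topN] at h1
  rw [halfVertical_eq]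
  omega

theorem neg_halfVertical_le_colBot (P : ColumnConvexPolygon (M + 1)) (i : Fin (M + 1)) :
    -P.halfVertical ≤ P.colBot i := by
  have h1 := sub_le_sum_max (fun i => -botLevels P.colTop P.colBot i)
    (show (i : ℕ) + 1 ≤ M + 2 by omega)
  have h2 : 0 ≤ ∑ i, P.topN i := Finset.sum_nonneg fun i _ => le_max_right _ _
  have h3 : botLevels P.colTop P.colBot 0 = 0 := P.colBot_zero
  rw [botLevels_succ, h3, ← sum_botS] at h1
  rw [halfVertical_eq]
  omega

theorem finite_halfVertical (S : Set (ColumnConvexPolygon (M + 1))) (h : ℤ) :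
    {P | P ∈ S ∧ P.halfVertical = h}.Finite := by
  refine finite_of_bounded (a := -h) (b := h) ?_
  rintro P ⟨-, rfl⟩ i
  exact ⟨neg_halfVertical_le_colBot P i, colTop_le_halfVertical P i⟩

theorem finite_perimArea (S : Set (ColumnConvexPolygon (M + 1))) (v : Fin 2 → ℤ) :
    {P | P ∈ S ∧ perimArea (M + 1) P = v}.Finite :=
  (finite_halfVertical S (v 0)).subset fun _ h => ⟨h.1, congrFun h.2 0⟩

theorem finite_perimOnly (S : Set (ColumnConvexPolygon (M + 1))) (v : Fin 1 → ℤ) :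
    {P | P ∈ S ∧ perimOnly (M + 1) P = v}.Finite :=
  (finite_halfVertical S (v 0)).subset fun _ h => ⟨h.1, congrFun h.2 0⟩

theorem colTop_sub_colBot_le_area (P : ColumnConvexPolygon (M + 1)) (i : Fin (M + 1)) :
    P.colTop i - P.colBot i ≤ P.area := by
  rw [area_eq_areaStat, areaStat]
  exact Finset.single_le_sum (f := fun i => P.colTop i - P.colBot i)
    (fun j _ => sub_nonneg.2 (P.colBot_lt j).le) (Finset.mem_univ i)

/-- Neighbouring columns overlap, so a bottom exceeds the previous one by less than the height of
the previous column, which is at most the area. -/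
theorem colBot_le_mul_area (P : ColumnConvexPolygon (M + 1)) (i : Fin (M + 1)) :
    P.colBot i ≤ i * P.area := by
  induction i using Fin.induction with
  | zero => simp [P.colBot_zero]
  | succ i ih =>
    have h1 := P.isColumns_col i.castSucc i.succ (by simp; omega) (by simp)
    have h2 := colTop_sub_colBot_le_area P i.castSucc
    simp only [Fin.val_castSucc, Fin.val_succ] at *
    push_cast
    linarith

theorem finite_areaOnly (v : Fin 1 → ℤ) :
    {P | P ∈ directedColumnConvex (M + 1) ∧ areaOnly (M + 1) P = v}.Finite := by
  refine finite_of_bounded (a := 0) (b := (M + 1) * v 0) ?_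
  rintro P ⟨hP, rfl⟩ i
  refine ⟨?_, ?_⟩
  · rw [← P.colBot_zero]
    exact (mem_directedColumnConvex_iff P).1 hP (Fin.zero_le i)
  · have h1 := colBot_le_mul_area P i
    have h2 := colTop_sub_colBot_le_area P i
    have h3 : (i : ℤ) ≤ M := by have := i.2; omega
    have h4 : 0 ≤ P.area := (sub_nonneg.2 (P.colBot_lt i).le).trans h2
    have h5 : areaOnly (M + 1) P 0 = P.area := rfl
    rw [h5]
    nlinarith

/-! ### Inversion of the width generating functions -/

theorem Presentation.perimArea_reciprocity {S : Set (ColumnConvexPolygon (M + 1))} {n : ℕ}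
    {T₀ B₀ : Fin (M + 1) → ℤ} (p : Presentation S n T₀ B₀) {E : Finset (Fin (M + 2))}
    (hE : ∀ T B, p.A T B → KeepsRuns E T₀ B₀ T B) {h a : ℤ}
    (hh : (T₀ (Fin.last M) - B₀ 0) + ∑ i, (if i ∈ E then 0 else -botRun T₀ B₀ i) = h)
    (ha : areaStat T₀ B₀ = a) :
    ∃ R, IsRationalGF S (perimArea (M + 1)) R ∧ invVars 2 R = (-1) ^ n * (monom ![h, a] * R) := by
  refine p.reciprocity isColumnStat_perimArea (fun T B hA => ?_) (fun P => ?_) (finite_perimArea S)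
  · rw [halfStat_add (hE T B hA), hh, areaStat_add, ha]
    simp
  · rw [perimArea, halfVertical_eq_halfStat, area_eq_areaStat]

theorem Presentation.perimOnly_reciprocity {S : Set (ColumnConvexPolygon (M + 1))} {n : ℕ}
    {T₀ B₀ : Fin (M + 1) → ℤ} (p : Presentation S n T₀ B₀) {E : Finset (Fin (M + 2))}
    (hE : ∀ T B, p.A T B → KeepsRuns E T₀ B₀ T B) {h : ℤ}
    (hh : (T₀ (Fin.last M) - B₀ 0) + ∑ i, (if i ∈ E then 0 else -botRun T₀ B₀ i) = h) :
    ∃ R, IsRationalGF S (perimOnly (M + 1)) R ∧ invVars 1 R = (-1) ^ n * (monom ![h] * R) := by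
  refine p.reciprocity isColumnStat_perimOnly (fun T B hA => ?_) (fun P => ?_) (finite_perimOnly S)
  · rw [halfStat_add (hE T B hA), hh]
    simp
  · rw [perimOnly, halfVertical_eq_halfStat]

theorem half_ferrers : ((M : ℤ) - 1 - (0 : Fin (M + 1) → ℤ) 0) +
    ∑ i, (if i ∈ Finset.univ then 0 else -botRun (fun i : Fin (M + 1) => (i : ℤ) - 1) 0 i) =
      ((M + 1 : ℕ) : ℤ) - 2 := by
  simp; ring

theorem half_stack : ((M : ℤ) - 1 - (-((0 : Fin (M + 1)) : ℕ) : ℤ)) +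
    ∑ i, (if i ∈ ({Fin.last (M + 1)} : Finset (Fin (M + 2))) then 0 else
      -botRun (fun i : Fin (M + 1) => (i : ℤ) - 1) (fun i => -(i : ℤ)) i) =
      2 * ((M + 1 : ℕ) : ℤ) - 3 := by
  rw [Fin.sum_univ_castSucc, Fin.sum_univ_succ]
  simp only [Finset.mem_singleton, Fin.castSucc_ne_last, if_false, if_true, botRun_succ,
    Fin.castSucc_zero, botRun_zero, Fin.val_succ, Fin.val_castSucc]
  simp
  ring

theorem sum_val (M : ℕ) : ∑ i : Fin (M + 1), 2 * (i : ℤ) = (M : ℤ) * (M + 1) := by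
  induction M with
  | zero => simp
  | succ M ih =>
    rw [Fin.sum_univ_castSucc]
    simp only [Fin.val_castSucc, Fin.val_last, ih]
    push_cast
    ring

theorem area_ferrers : areaStat (fun i : Fin (M + 1) => (i : ℤ) - 1) 0 =
    (((M + 1 : ℕ) : ℤ) ^ 2 - 3 * (M + 1 : ℕ)) / 2 := by
  have h := sum_val M
  rw [← Finset.mul_sum] at h
  rw [eq_comm, areaStat]
  -- The number m ^ 2 - 3 m is even, so the division in the exponent is exact.
  refine Int.ediv_eq_of_eq_mul_right two_ne_zero ?_
  simp only [Pi.zero_apply, sub_zero, Finset.sum_sub_distrib, mul_sub, h]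
  simp
  ring

theorem area_stack : areaStat (fun i : Fin (M + 1) => (i : ℤ) - 1) (fun i => -(i : ℤ)) =
    ((M + 1 : ℕ) : ℤ) ^ 2 - 2 * (M + 1 : ℕ) := by
  have h := sum_val M
  rw [areaStat]
  have : ∀ i : Fin (M + 1), ((i : ℤ) - 1 - -(i : ℤ)) = 2 * i - 1 := fun i => by ring
  simp only [this, Finset.sum_sub_distrib, h]
  simp
  ring

theorem area_directedColumnConvex :
    areaStat (fun i : Fin (M + 1) => min (i : ℤ) (M - 1)) (fun i => (i : ℤ)) = -1 := by
  rw [areaStat, Fin.sum_univ_castSucc]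
  have : ∀ i : Fin M, min ((i.castSucc : ℕ) : ℤ) (M - 1) - ((i.castSucc : ℕ) : ℤ) = 0 := by
    intro i
    have := i.2
    rw [Fin.val_castSucc]
    omega
  rw [Finset.sum_eq_zero fun i _ => this i]
  simp

/-- Two blocks of M + 1 heights leave 2 M + 1 gaps, an odd number. -/
theorem neg_one_pow_twoBlock (M : ℕ) (R : RatFun k) : (-1) ^ (M + 1 + M) * R = -R := by
  rw [show M + 1 + M = 2 * M + 1 by ring, pow_succ, pow_mul]
  simp

/-- Choose the generating functions of all widths simultaneously. -/
theorem exists_isWidthGF {F : (m : ℕ) → Set (ColumnConvexPolygon m)}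
    {f : (m : ℕ) → ColumnConvexPolygon m → Fin k → ℤ} {Q : ℕ → RatFun k → Prop}
    (h : ∀ M, ∃ R, IsRationalGF (F (M + 1)) (f (M + 1)) R ∧ Q (M + 1) R) :
    ∃ H, IsWidthGF F f H ∧ H 0 = 0 ∧ ∀ m, 1 ≤ m → Q m (H m) := by
  choose R hR hQ using h
  have h0 : F 0 = ∅ := Set.eq_empty_of_forall_notMem fun P => P.not_width_zero.elim
  refine ⟨fun m => Nat.casesOn m 0 R, fun m => ?_, rfl, fun m hm => ?_⟩
  · cases m with
    | zero =>
      rw [isRationalGF_iff]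
      refine ⟨fun w => ?_, ?_⟩
      · rw [h0]; simp
      · rw [countSeries_empty h0]
        exact HasVal.zero
    | succ m => exact hR m
  · cases m with
    | zero => omega
    | succ m => exact hQ m

theorem coeff_cst_mul_inverted (β : Fin k → ℤ) (c : RatFun k) (H : ℕ → RatFun k) (m : ℕ) :
    PowerSeries.coeff m (cst β * inverted c (PowerSeries.mk H)) =
      monom β * (c ^ m * invVars k (H m)) := by
  rw [cst, PowerSeries.coeff_C_mul, inverted, PowerSeries.coeff_rescale, PowerSeries.coeff_map,
    PowerSeries.coeff_mk]
  rfl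

theorem monom_mul_pow_mul {α β γ : Fin k → ℤ} {m : ℕ} (h : α + m • β + γ = 0) (R : RatFun k) :
    monom α * (monom β ^ m * (monom γ * R)) = R := by
  rw [← monom_nsmul, ← mul_assoc, ← mul_assoc, ← monom_add, ← monom_add, h, monom_zero, one_mul]

/-- The functional equation of the generating function of all widths. -/
theorem add_inverted_eq_zero {H : ℕ → RatFun k} (h0 : H 0 = 0) {α β : Fin k → ℤ}
    {γ : ℕ → Fin k → ℤ} (hγ : ∀ m, 1 ≤ m → α + m • β + γ m = 0)
    (h : ∀ m, 1 ≤ m → invVars k (H m) = -(monom (γ m) * H m)) :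
    PowerSeries.mk H + cst α * inverted (monom β) (PowerSeries.mk H) = 0 := by
  ext m
  rw [map_add, coeff_cst_mul_inverted, PowerSeries.coeff_mk, map_zero]
  rcases Nat.eq_zero_or_pos m with rfl | hm
  · simp [h0]
  · rw [h m hm, mul_neg, mul_neg, monom_mul_pow_mul (hγ m hm), add_neg_cancel]

/-- The sign (-1) ^ m is absorbed by substituting -x for x. -/
theorem sub_inverted_eq_zero {H : ℕ → RatFun k} (h0 : H 0 = 0) {α β : Fin k → ℤ}
    {γ : ℕ → Fin k → ℤ} (hγ : ∀ m, 1 ≤ m → α + m • β + γ m = 0)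
    (h : ∀ m, 1 ≤ m → invVars k (H m) = (-1) ^ m * monom (γ m) * H m) :
    PowerSeries.mk H - cst α * inverted (-monom β) (PowerSeries.mk H) = 0 := by
  ext m
  rw [map_sub, coeff_cst_mul_inverted, PowerSeries.coeff_mk, map_zero]
  rcases Nat.eq_zero_or_pos m with rfl | hm
  · simp [h0]
  · rw [h m hm, neg_pow]
    have h1 : ((-1 : RatFun k) ^ m) * (-1) ^ m = 1 := by rw [← mul_pow]; simp
    have h2 := monom_mul_pow_mul (hγ m hm) (H m)
    linear_combination -h2 - (monom α * (monom β ^ m * (monom (γ m) * H m))) * h1 + h2 * 0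

theorem columnConvex_inversion : ∃ H : ℕ → RatFun 2, IsWidthGF columnConvex perimArea H ∧
    (∀ m : ℕ, 1 ≤ m → invVars 2 (H m) = -(monom ![-1, -(m : ℤ)] * H m)) ∧
    PowerSeries.mk H + cst ![1, 0] * inverted (monom ![0, 1]) (PowerSeries.mk H) = 0 := by
  obtain ⟨H, hH, h0, h⟩ := exists_isWidthGF (F := columnConvex) (f := perimArea)
    (Q := fun m R => invVars 2 R = -(monom ![-1, -(m : ℤ)] * R)) (fun M => by
      simpa only [neg_one_pow_twoBlock] using
        (columnConvexPresentation M).perimArea_reciprocity (fun _ _ => keepsRuns_columnConvex)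
          (h := -1) (a := -((M + 1 : ℕ) : ℤ)) (by simp) (by simp [areaStat]))
  exact ⟨H, hH, h, add_inverted_eq_zero h0 (by intro m _; ext i; fin_cases i <;> simp) h⟩

theorem bargraphs_inversion : ∃ H : ℕ → RatFun 2, IsWidthGF bargraphs perimArea H ∧
    (∀ m : ℕ, 1 ≤ m → invVars 2 (H m) = (-1) ^ m * monom ![-1, -(m : ℤ)] * H m) ∧
    PowerSeries.mk H - cst ![1, 0] * inverted (-monom ![0, 1]) (PowerSeries.mk H) = 0 := by
  obtain ⟨H, hH, h0, h⟩ := exists_isWidthGF (F := bargraphs) (f := perimArea)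
    (Q := fun m R => invVars 2 R = (-1) ^ m * monom ![-1, -(m : ℤ)] * R) (fun M => by
      simpa only [mul_assoc] using
        (bargraphsPresentation M).perimArea_reciprocity (fun _ _ => keepsRuns_bargraphs)
          (h := -1) (a := -((M + 1 : ℕ) : ℤ)) (by simp) (by simp [areaStat]))
  exact ⟨H, hH, h, sub_inverted_eq_zero h0 (by intro m _; ext i; fin_cases i <;> simp) h⟩

theorem ferrers_inversion : ∃ H : ℕ → RatFun 2, IsWidthGF ferrers perimArea H ∧
    ∀ m : ℕ, 1 ≤ m → invVars 2 (H m) =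
      (-1) ^ m * monom ![(m : ℤ) - 2, ((m : ℤ) ^ 2 - 3 * m) / 2] * H m := by
  obtain ⟨H, hH, -, h⟩ := exists_isWidthGF (F := ferrers) (f := perimArea)
    (Q := fun m R => invVars 2 R =
      (-1) ^ m * monom ![(m : ℤ) - 2, ((m : ℤ) ^ 2 - 3 * m) / 2] * R) (fun M => by
      simpa only [mul_assoc] using
        (ferrersPresentation M).perimArea_reciprocity (fun _ _ => keepsRuns_ferrers)
          (h := ((M + 1 : ℕ) : ℤ) - 2) half_ferrers area_ferrers)
  exact ⟨H, hH, h⟩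

theorem ferrers_inversion_perimeter : ∃ H : ℕ → RatFun 1, IsWidthGF ferrers perimOnly H ∧
    PowerSeries.mk H - cst ![2] * inverted (-monom ![-1]) (PowerSeries.mk H) = 0 := by
  obtain ⟨H, hH, h0, h⟩ := exists_isWidthGF (F := ferrers) (f := perimOnly)
    (Q := fun m R => invVars 1 R = (-1) ^ m * monom ![(m : ℤ) - 2] * R) (fun M => by
      simpa only [mul_assoc] using
        (ferrersPresentation M).perimOnly_reciprocity (fun _ _ => keepsRuns_ferrers)
          (h := ((M + 1 : ℕ) : ℤ) - 2) half_ferrers)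
  exact ⟨H, hH, sub_inverted_eq_zero h0 (by intro m _; ext i; fin_cases i; simp; ring) h⟩

theorem stack_inversion : ∃ H : ℕ → RatFun 2, IsWidthGF stackPolygons perimArea H ∧
    ∀ m : ℕ, 1 ≤ m → invVars 2 (H m) =
      -(monom ![2 * (m : ℤ) - 3, (m : ℤ) ^ 2 - 2 * m] * H m) := by
  obtain ⟨H, hH, -, h⟩ := exists_isWidthGF (F := stackPolygons) (f := perimArea)
    (Q := fun m R => invVars 2 R = -(monom ![2 * (m : ℤ) - 3, (m : ℤ) ^ 2 - 2 * m] * R))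
    (fun M => by
      simpa only [neg_one_pow_twoBlock] using
        (stackPresentation M).perimArea_reciprocity (fun _ _ => keepsRuns_stack)
          (h := 2 * ((M + 1 : ℕ) : ℤ) - 3) half_stack area_stack)
  exact ⟨H, hH, h⟩

theorem stack_inversion_perimeter : ∃ H : ℕ → RatFun 1, IsWidthGF stackPolygons perimOnly H ∧
    PowerSeries.mk H + cst ![3] * inverted (monom ![-2]) (PowerSeries.mk H) = 0 := by
  obtain ⟨H, hH, h0, h⟩ := exists_isWidthGF (F := stackPolygons) (f := perimOnly)
    (Q := fun m R => invVars 1 R = -(monom ![2 * (m : ℤ) - 3] * R)) (fun M => by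
      simpa only [neg_one_pow_twoBlock] using
        (stackPresentation M).perimOnly_reciprocity (fun _ _ => keepsRuns_stack)
          (h := 2 * ((M + 1 : ℕ) : ℤ) - 3) half_stack)
  exact ⟨H, hH, add_inverted_eq_zero h0 (by intro m _; ext i; fin_cases i; simp; ring) h⟩

/-- The shift alters top runs, whose direction is not fixed in this family, so the perimeter need
not change by a constant. The area is linear in the heights and always changes by -1. -/
theorem directedColumnConvex_inversion : ∃ H : ℕ → RatFun 1,
    IsWidthGF directedColumnConvex areaOnly H ∧
    (∀ m : ℕ, 1 ≤ m → invVars 1 (H m) = -(monom ![-1] * H m)) ∧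
    PowerSeries.mk H + cst ![1] * inverted 1 (PowerSeries.mk H) = 0 := by
  obtain ⟨H, hH, h0, h⟩ := exists_isWidthGF (F := directedColumnConvex) (f := areaOnly)
    (Q := fun m R => invVars 1 R = -(monom ![-1] * R)) (fun M => by
      simpa only [neg_one_pow_twoBlock] using
        (directedColumnConvexPresentation M).reciprocity isColumnStat_areaOnly (γ := ![-1])
          (fun T B hA => by rw [areaStat_add, area_directedColumnConvex]; simp)
          (fun P => by rw [areaOnly, area_eq_areaStat]) finite_areaOnly)
  refine ⟨H, hH, h, ?_⟩
  rw [← monom_zero]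
  exact add_inverted_eq_zero h0 (by intro m _; ext i; fin_cases i; simp) h

/-! ### Staircase polygons -/

/-- A single column of height h contributes (y q)^h, for every h ≥ 1. -/
theorem isRationalGF_columnConvex_one : IsRationalGF (columnConvex 1) (perimArea 1)
    (monom ![1, 1] / (1 - monom ![1, 1])) := by
  have hb : Set.BijOn (fun P : ColumnConvexPolygon 1 => P.colTop) (columnConvex 1)
      (Set.Ici (fun _ : Fin 1 => 1)) := by
    refine ⟨fun P _ i => ?_, fun P _ Q _ h => ext_col h ?_, fun f hf => ?_⟩
    · have := P.colBot_lt i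
      rw [show i = 0 from Fin.ext (by omega)] at this ⊢
      rw [P.colBot_zero] at this
      exact this
    · ext i
      rw [show i = 0 from Fin.ext (by omega), P.colBot_zero, Q.colBot_zero]
    · refine ⟨ofColumns (M := 0) f 0 rfl fun i j _ _ => hf i, Set.mem_univ _, ?_⟩
      exact colTop_ofColumns _ _
  have hf : ∀ P ∈ columnConvex 1, ∑ i : Fin 1, P.colTop i • (![1, 1] : Fin 2 → ℤ) =
      perimArea 1 P := by
    intro P _
    have hp : ∀ f : Fin (0 + 1) → ℤ, IsPeak f 0 := fun f =>
      ⟨fun a b _ _ => by rw [show a = b from Fin.ext (by omega)],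
        fun a b _ _ => by rw [show a = b from Fin.ext (by omega)]⟩
    have h1 := P.isConvex_iff_halfVertical.1 (P.isConvex_iff.2 ⟨⟨0, hp _⟩, ⟨0, hp _⟩⟩)
    rw [P.yMax_eq (k := 0) (hp P.colTop).le,
      P.yMin_eq (k := 0) fun i => neg_le_neg_iff.1 ((hp fun i => -P.colBot i).le i),
      P.colBot_zero, sub_zero] at h1
    have h2 : P.area = P.colTop 0 := by
      rw [area_eq_areaStat, areaStat]
      simp [P.colBot_zero]
    rw [perimArea, h1, h2]
    ext i; fin_cases i <;> simp
  have hfin := finite_perimArea (M := 0) (columnConvex 1)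
  rw [isRationalGF_iff, countSeries_congr (g := fun f : Fin 1 → ℤ => ∑ i, f i • (![1, 1] : Fin 2 → ℤ)) _ hb hf]
  refine ⟨hfin, ?_⟩
  have := hasVal_Ici 1 (fun _ => 1) (fun _ => ![1, 1]) 
    (finite_fiber_congr (g := fun f : Fin 1 → ℤ => ∑ i, f i • (![1, 1] : Fin 2 → ℤ)) _ hb hf hfin)
  simpa using this

theorem staircase_inversion : ∃ H : ℕ → RatFun 2, IsWidthGF staircase perimArea H ∧
    (∀ m : ℕ, 2 ≤ m → invVars 2 (H m) = -(monom ![(m : ℤ) - 1, 0] * H m)) ∧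
    PowerSeries.mk H + cst ![1, 0] * inverted (monom ![-1, 0]) (PowerSeries.mk H) =
      -PowerSeries.X := by
  obtain ⟨H, hH, h0, h⟩ := exists_isWidthGF (F := staircase) (f := perimArea)
    (Q := fun m R => if m = 1 then R = monom ![1, 1] / (1 - monom ![1, 1])
      else invVars 2 R = -(monom ![(m : ℤ) - 1, 0] * R)) (fun M => by
      rcases Nat.eq_zero_or_pos M with rfl | hM
      · rw [zero_add, staircase_one]
        exact ⟨_, isRationalGF_columnConvex_one, by simp⟩
      · simpa only [neg_one_pow_twoBlock, Nat.add_eq_right, hM.ne', if_false] using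
          (staircasePresentation hM).perimArea_reciprocity (fun _ _ => keepsRuns_staircase)
            (h := ((M + 1 : ℕ) : ℤ) - 1) (a := 0) (by simp) (by simp [areaStat]))
  refine ⟨H, hH, fun m hm => by simpa [show m ≠ 1 by omega] using h m (by omega), ?_⟩
  ext m
  rw [map_add, coeff_cst_mul_inverted, PowerSeries.coeff_mk, map_neg, PowerSeries.coeff_X]
  rcases Nat.eq_zero_or_pos m with rfl | hm
  · simp [h0]
  · have hm' := h m hm
    split_ifs at hm' ⊢ with h1
    -- Width one: with z = y q the two terms are z / (1 - z) and 1 / (z - 1), whose sum is the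
    -- coefficient -1 on the right.
    · subst h1
      have hz : (1 : RatFun 2) - monom ![1, 1] ≠ 0 :=
        one_sub_monom_ne_zero fun h => by simpa using congrFun h 0
      have hz' := monom_ne_zero (![1, 1] : Fin 2 → ℤ)
      rw [hm', map_div₀, map_sub, map_one, invVars_monom, monom_neg, pow_one, ← mul_assoc,
        ← monom_add, show (![1, 0] + ![-1, 0] : Fin 2 → ℤ) = 0 by ext i; fin_cases i <;> simp,
        monom_zero, one_mul]
      have hz2 : (monom ![1, 1] : RatFun 2) - 1 ≠ 0 := fun h => hz (by linear_combination -h)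
      have : (monom ![1, 1] : RatFun 2)⁻¹ / (1 - (monom ![1, 1])⁻¹) = 1 / (monom ![1, 1] - 1) := by
        field_simp
      rw [this]
      field_simp
      ring
    · rw [hm', mul_neg, mul_neg, monom_mul_pow_mul, add_neg_cancel, neg_zero]
      ext i; fin_cases i
      · simp; ring
      · simp

end Polyomino
end

noncomputable section

namespace Polyomino

/-! ### Counting walks with time-dependent steps -/

section Walks

variable {S : Type*} [DecidableEq S] (Q : ℕ → S → Finset S)

/-- The sequences of length `r + 1` whose last term lies in `I` and whose other terms are obtained
one after the other, downwards, by the steps `Q`. -/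
def walks : (r : ℕ) → Finset S → Finset (Fin (r + 1) → S)
  | 0, I => I.image fun s _ => s
  | r + 1, I => I.biUnion fun s => (walks r (Q r s)).image fun f => Fin.snoc f s

/-- The number of walks with a given last term. -/
def walkCount : ℕ → S → ℤ
  | 0, _ => 1
  | r + 1, s => ∑ s' ∈ Q r s, walkCount r s'

theorem mem_walks : ∀ {r : ℕ} {I : Finset S} {f : Fin (r + 1) → S},
    f ∈ walks Q r I ↔ f (Fin.last r) ∈ I ∧ ∀ i : Fin r, f i.castSucc ∈ Q i (f i.succ)
  | 0, I, f => by
    simp only [walks, Finset.mem_image]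
    constructor
    · rintro ⟨s, hs, rfl⟩
      exact ⟨hs, fun i => i.elim0⟩
    · rintro ⟨h, -⟩
      exact ⟨_, h, funext fun i => by rw [show i = Fin.last 0 from Fin.ext (by omega)]⟩
  | r + 1, I, f => by
    simp only [walks, Finset.mem_biUnion, Finset.mem_image]
    constructor
    · rintro ⟨s, hs, g, hg, rfl⟩
      rw [mem_walks] at hg
      refine ⟨by rwa [Fin.snoc_last], Fin.lastCases ?_ fun i => ?_⟩
      · rw [Fin.snoc_castSucc, Fin.succ_last, Fin.snoc_last]
        exact hg.1
      · rw [Fin.snoc_castSucc, ← Fin.castSucc_succ, Fin.snoc_castSucc]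
        exact hg.2 i
    · rintro ⟨h1, h2⟩
      refine ⟨f (Fin.last _), h1, Fin.init f, ?_, Fin.snoc_init_self f⟩
      rw [mem_walks]
      refine ⟨h2 (Fin.last r), fun i => ?_⟩
      have := h2 i.castSucc
      rwa [← Fin.castSucc_succ] at this

theorem card_walks : ∀ (r : ℕ) (I : Finset S),
    ((walks Q r I).card : ℤ) = ∑ s ∈ I, walkCount Q r s
  | 0, I => by
    rw [walks, Finset.card_image_of_injective _ fun a b h => congrFun h 0]
    simp [walkCount]
  | r + 1, I => by
    rw [walks, Finset.card_biUnion]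
    · push_cast
      refine Finset.sum_congr rfl fun s _ => ?_
      rw [Finset.card_image_of_injective _ fun a b h => (Fin.snoc_injective2 h).1, card_walks,
        walkCount]
    · intro s _ s' _ hss
      rw [Function.onFun, Finset.disjoint_left]
      intro f hf hf'
      obtain ⟨g, -, rfl⟩ := Finset.mem_image.1 hf
      obtain ⟨g', -, h⟩ := Finset.mem_image.1 hf'
      exact hss (Fin.snoc_injective2 h).2.symm

end Walks

/-! ### Multichains in an interval -/

/-- The number of multichains of length `a` in a chain with `n` elements. -/
def mchains (n : ℤ) (a : ℕ) : ℤ := (n.toNat.multichoose a : ℤ)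

@[simp] theorem mchains_zero (n : ℤ) : mchains n 0 = 1 := by simp [mchains]

@[simp] theorem mchains_zero_succ (a : ℕ) : mchains 0 (a + 1) = 0 := by simp [mchains]

/-- Pascal's rule. Positivity of n is needed because `mchains` is constant for n ≤ 0. -/
theorem mchains_succ {n : ℤ} (hn : 0 < n) (a : ℕ) :
    mchains n (a + 1) - mchains (n - 1) (a + 1) = mchains n a := by
  obtain ⟨k, rfl⟩ : ∃ k : ℕ, n = (k + 1 : ℕ) := ⟨(n - 1).toNat, by omega⟩
  rw [mchains, mchains, mchains, show ((k + 1 : ℕ) : ℤ) - 1 = (k : ℕ) by push_cast; ring,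
    Int.toNat_natCast, Int.toNat_natCast, Nat.multichoose_succ_succ]
  push_cast
  ring

theorem sum_Ico_telescope {f F : ℤ → ℤ} {a b : ℤ} (hab : a ≤ b)
    (h : ∀ x, a ≤ x → x < b → F x - F (x + 1) = f x) : ∑ x ∈ Finset.Ico a b, f x = F a - F b := by
  induction b, hab using Int.leInduction with
  | base => simp
  | succ b hab ih =>
    rw [show Finset.Ico a (b + 1) = insert b (Finset.Ico a b) by ext; simp; omega,
      Finset.sum_insert (by simp), ih fun x h1 h2 => h x h1 (by omega), ← h b hab (by omega)]
    ring

theorem sum_mchains_sub {n a b : ℤ} (hab : a ≤ b) (hb : b ≤ n) (e : ℕ) :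
    ∑ x ∈ Finset.Ico a b, mchains (n - x) e = mchains (n - a) (e + 1) - mchains (n - b) (e + 1) :=
  sum_Ico_telescope (F := fun x => mchains (n - x) (e + 1)) hab fun x h1 h2 => by
    rw [← mchains_succ (by omega : 0 < n - x) e, sub_sub]

theorem sum_mchains_sub_end {n a : ℤ} (ha : a ≤ n) (e : ℕ) :
    ∑ x ∈ Finset.Ico a n, mchains (n - x) e = mchains (n - a) (e + 1) := by
  rw [sum_mchains_sub ha le_rfl, sub_self, mchains_zero_succ, sub_zero]

theorem sum_mchains {b : ℤ} (hb : 0 ≤ b) (e : ℕ) :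
    ∑ x ∈ Finset.Ico 0 b, mchains (x + 1) e = mchains b (e + 1) := by
  rw [sum_Ico_telescope (F := fun x => -mchains x (e + 1)) hb fun x h1 h2 => ?_]
  · simp
  · rw [← mchains_succ (by omega : 0 < x + 1) e, add_sub_cancel_right]
    ring

/-- Vandermonde convolution. -/
theorem sum_mchains_mul {n : ℤ} (hn : 1 ≤ n) (l e : ℕ) :
    ∑ x ∈ Finset.Ico 1 n, mchains x l * mchains (n - x) e = mchains (n - 1) (l + e + 1) := by
  induction l generalizing e with
  | zero => simp only [mchains_zero, one_mul, sum_mchains_sub_end hn, zero_add]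
  | succ l ih =>
    rw [show l + 1 + e + 1 = l + (e + 1) + 1 by ring, ← ih (e + 1)]
    -- Summation by parts: one unit of length moves from the left factor to the right one, and both
    -- boundary terms vanish.
    have h1 := sum_Ico_telescope (F := fun x => -(mchains (x - 1) (l + 1) * mchains (n - x) (e + 1)))
      (f := fun x => mchains x (l + 1) * mchains (n - (x + 1)) (e + 1) -
        mchains (x - 1) (l + 1) * mchains (n - x) (e + 1)) hn
      fun x h1 h2 => by simp only [add_sub_cancel_right]; ring
    simp only [sub_self, mchains_zero_succ, mul_zero, zero_mul, neg_zero] at h1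
    have h2 : ∑ x ∈ Finset.Ico 1 n, (mchains x l * mchains (n - x) (e + 1) -
        mchains x (l + 1) * mchains (n - x) e) = 0 := by
      rw [← h1]
      refine Finset.sum_congr rfl fun x hx => ?_
      rw [Finset.mem_Ico] at hx
      have h3 := mchains_succ (by omega : 0 < x) l
      have h4 := mchains_succ (by omega : 0 < n - x) e
      rw [← h3, ← h4, ← sub_sub]
      ring
    rw [Finset.sum_sub_distrib] at h2
    linarith

/-! ### The steps between consecutive columns -/

/-- The columns contained in a given column. -/
def innerColumns (s : ℤ × ℤ) : Finset (ℤ × ℤ) :=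
  (Finset.Ico (s.2 + 1) (s.1 + 1) ×ˢ Finset.Ico s.2 s.1).filter fun p => p.2 < p.1

theorem mem_innerColumns {s p : ℤ × ℤ} :
    p ∈ innerColumns s ↔ s.2 ≤ p.2 ∧ p.2 < p.1 ∧ p.1 ≤ s.1 := by
  simp only [innerColumns, Finset.mem_filter, Finset.mem_product, Finset.mem_Ico]
  omega

/-- Summing over the inner bottom and then over the inner top lengthens the multichain by one each
time. -/
theorem sum_innerColumns {t b : ℤ} (h : b ≤ t) (e : ℕ) :
    ∑ p ∈ innerColumns (t, b), mchains (p.1 - p.2) e = mchains (t - b) (e + 2) := by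
  rw [innerColumns, Finset.sum_filter, Finset.sum_product]
  have : ∀ x ∈ Finset.Ico (b + 1) (t + 1), (∑ y ∈ Finset.Ico b t,
      if y < x then mchains (x - y) e else 0) = mchains (x - b) (e + 1) := by
    intro x hx
    rw [Finset.mem_Ico] at hx
    rw [← Finset.sum_filter, show (Finset.Ico b t).filter (fun y => y < x) = Finset.Ico b x by
      ext y; simp; omega, sum_mchains_sub_end (by omega)]
  rw [Finset.sum_congr rfl this,
    sum_Ico_telescope (F := fun x => -mchains (x - 1 - b) (e + 2)) (by omega)]
  · simp
  · intro x h1 h2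
    rw [← mchains_succ (by omega : 0 < x - b) (e + 1), sub_right_comm x 1 b, add_sub_cancel_right]
    ring

end Polyomino
end

/-! ### Closed forms for the numbers of walks of columns. -/

noncomputable section

namespace Polyomino

theorem sum_innerColumns_mul (N : ℤ) (f g : ℤ → ℤ) :
    ∑ p ∈ innerColumns (N, 0), f p.1 * g p.2 =
      ∑ t ∈ Finset.Ico 1 (N + 1), f t * ∑ b ∈ Finset.Ico 0 t, g b := by
  rw [innerColumns, Finset.sum_filter, Finset.sum_product]
  refine Finset.sum_congr (by simp) fun t ht => ?_
  simp only [Finset.mem_Ico] at ht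
  simp only
  rw [← Finset.sum_filter, Finset.mul_sum]
  refine Finset.sum_congr ?_ fun _ _ => rfl
  ext b
  simp only [Finset.mem_filter, Finset.mem_Ico]
  omega

theorem walkCount_inner {Q : ℕ → ℤ × ℤ → Finset (ℤ × ℤ)} {s : ℕ}
    (hQ : ∀ i < s, Q i = innerColumns) :
    ∀ r ≤ s, ∀ t b : ℤ, b ≤ t → walkCount Q r (t, b) = mchains (t - b) (2 * r)
  | 0, _, t, b, _ => by simp [walkCount]
  | r + 1, hr, t, b, h => by
    rw [walkCount, hQ r hr, mul_add, ← sum_innerColumns h]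
    refine Finset.sum_congr rfl fun p hp => ?_
    rw [mem_innerColumns] at hp
    exact walkCount_inner hQ r (by omega) p.1 p.2 hp.2.1.le

/-! ### Columns that have the full height at a given place first -/

/-- Steps, from right to left of the time axis: `s` steps inwards, preceded by `j` steps that push
the top up to `n`, with bottoms at height at least `c`, preceded by steps that widen the column
until the bottom reaches `0`. -/
def peakSteps (c n : ℤ) (s j i : ℕ) (p : ℤ × ℤ) : Finset (ℤ × ℤ) :=
  if i < s then innerColumns p
  else if i < s + j then (if i = s then {n} else Finset.Ico p.1 n) ×ˢ Finset.Ico (max p.2 c) p.1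
  else Finset.Ico p.1 n ×ˢ (if i = s + j then {0} else Finset.Icc 0 p.2)

/-- While top and bottom both rise they must not collide, and the number of continuations is a 2 × 2
determinant in the two heights, as for pairs of non-intersecting paths. The induction sums the
determinant over the next bottom, which stays below the current top, and over the next top. -/
theorem walkCount_peakSteps_up {c n : ℤ} {s j : ℕ} : ∀ i < j, ∀ t b : ℤ, max b c ≤ t → t < n →
    walkCount (peakSteps c n s j) (s + (i + 1)) (t, b) =
      mchains (n - t) i * mchains (n - max b c) (2 * s + i + 1) -
        mchains (n - max b c) i * mchains (n - t) (2 * s + i + 1)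
  | 0, hi, t, b, hbt, htn => by
    rw [← add_assoc, add_zero, walkCount, peakSteps, if_neg (lt_irrefl s), if_pos (by omega),
      if_pos rfl, Finset.sum_product, Finset.sum_singleton]
    simp only
    rw [Finset.sum_congr rfl fun x hx => walkCount_inner (Q := peakSteps c n s j)
      (fun i hi => by funext p; rw [peakSteps, if_pos hi]) s le_rfl n x (by
        rw [Finset.mem_Ico] at hx; omega), sum_mchains_sub hbt htn.le]
    simp
  | i + 1, hi, t, b, hbt, htn => by
    rw [← add_assoc, walkCount, peakSteps, if_neg (by omega), if_pos (by omega),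
      if_neg (by omega), Finset.sum_product]
    simp only
    have h1 : ∀ x ∈ Finset.Ico t n, ∑ y ∈ Finset.Ico (max b c) t,
        walkCount (peakSteps c n s j) (s + (i + 1)) (x, y) =
        mchains (n - x) i * (mchains (n - max b c) (2 * s + i + 2) -
          mchains (n - t) (2 * s + i + 2)) - (mchains (n - max b c) (i + 1) -
          mchains (n - t) (i + 1)) * mchains (n - x) (2 * s + i + 1) := by
      intro x hx
      rw [Finset.mem_Ico] at hx
      rw [← sum_mchains_sub hbt htn.le, ← sum_mchains_sub hbt htn.le, Finset.mul_sum,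
        Finset.sum_mul, ← Finset.sum_sub_distrib]
      refine Finset.sum_congr rfl fun y hy => ?_
      rw [Finset.mem_Ico] at hy
      have hy' : max y c = y := by omega
      rw [walkCount_peakSteps_up i (by omega) x y (by omega) hx.2, hy']
    rw [Finset.sum_congr rfl h1, Finset.sum_sub_distrib, ← Finset.sum_mul, ← Finset.mul_sum,
      sum_mchains_sub_end htn.le, sum_mchains_sub_end htn.le]
    rw [show 2 * s + (i + 1) + 1 = 2 * s + i + 2 by ring,
      show 2 * s + i + 1 + 1 = 2 * s + i + 2 by ring]
    ring

/-- While the column widens, its top and bottom move independently, so the bottom enters only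
through a separate factor. -/
theorem walkCount_peakSteps_widen {n : ℤ} {s i : ℕ} : ∀ l : ℕ, ∀ t b : ℤ, 1 ≤ t → t < n → 0 ≤ b →
    walkCount (peakSteps 1 n s (i + 1)) (s + (i + 1) + (l + 1)) (t, b) =
      (mchains (n - t) (i + l + 1) * mchains (n - 1) (2 * s + i + 1) -
        mchains (n - 1) i * mchains (n - t) (2 * s + i + l + 2)) * mchains (b + 1) l
  | 0, t, b, ht, htn, hb => by
    rw [zero_add, walkCount, peakSteps, if_neg (by omega), if_neg (by omega), if_pos rfl,
      Finset.sum_product]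
    simp only [Finset.sum_singleton]
    rw [Finset.sum_congr rfl fun x hx => walkCount_peakSteps_up (c := 1) i (by omega) x 0 (by
      rw [Finset.mem_Ico] at hx; omega) (Finset.mem_Ico.1 hx).2, Finset.sum_sub_distrib,
      ← Finset.sum_mul, ← Finset.mul_sum, sum_mchains_sub_end htn.le, sum_mchains_sub_end htn.le]
    simp
  | l + 1, t, b, ht, htn, hb => by
    rw [← add_assoc, walkCount, peakSteps, if_neg (by omega), if_neg (by omega),
      if_neg (by omega), Finset.sum_product]
    simp only
    have h1 : ∀ x ∈ Finset.Ico t n, ∑ y ∈ Finset.Icc 0 b,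
        walkCount (peakSteps 1 n s (i + 1)) (s + (i + 1) + (l + 1)) (x, y) =
        (mchains (n - x) (i + l + 1) * mchains (n - 1) (2 * s + i + 1) -
        mchains (n - 1) i * mchains (n - x) (2 * s + i + l + 2)) * mchains (b + 1) (l + 1) := by
      intro x hx
      rw [Finset.mem_Ico] at hx
      rw [← sum_mchains (by omega : 0 ≤ b + 1) l, Finset.mul_sum,
        show Finset.Icc 0 b = Finset.Ico 0 (b + 1) by ext; simp]
      refine Finset.sum_congr rfl fun y hy => ?_
      rw [Finset.mem_Ico] at hy
      rw [walkCount_peakSteps_widen l x y (by omega) hx.2 hy.1]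
    rw [Finset.sum_congr rfl h1, ← Finset.sum_mul, Finset.sum_sub_distrib, ← Finset.sum_mul,
      ← Finset.mul_sum, sum_mchains_sub_end htn.le, sum_mchains_sub_end htn.le]
    rfl

/-- The possible first columns for `peakSteps`. -/
def peakStart (n : ℤ) : ℕ → Finset (ℤ × ℤ)
  | 0 => Finset.Ico 1 n ×ˢ {0}
  | _ + 1 => innerColumns (n - 1, 0)

/-- The Vandermonde convolution over the first top joins the multichains of tops and bottoms of the
widening phase. For l = 0 there is no such phase, and the first bottom is already 0. -/
theorem sum_walkCount_peakStart {n : ℤ} (hn : 1 ≤ n) (s i : ℕ) : ∀ l : ℕ,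
    ∑ p ∈ peakStart n l, walkCount (peakSteps 1 n s (i + 1)) (s + (i + 1) + l) p =
      mchains (n - 1) (2 * l + i + 1) * mchains (n - 1) (2 * s + i + 1) -
        mchains (n - 1) i * mchains (n - 1) (2 * s + 2 * l + i + 2)
  | 0 => by
    rw [peakStart, Finset.sum_product]
    simp only [Finset.sum_singleton, add_zero]
    rw [Finset.sum_congr rfl fun x hx => walkCount_peakSteps_up (c := 1) i (by omega) x 0 (by
      rw [Finset.mem_Ico] at hx; omega) (Finset.mem_Ico.1 hx).2, Finset.sum_sub_distrib,
      ← Finset.sum_mul, ← Finset.mul_sum, sum_mchains_sub_end hn, sum_mchains_sub_end hn]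
    simp
  | l + 1 => by
    rw [peakStart]
    have h1 : ∀ p ∈ innerColumns (n - 1, 0),
        walkCount (peakSteps 1 n s (i + 1)) (s + (i + 1) + (l + 1)) p =
        (mchains (n - p.1) (i + l + 1) * mchains (n - 1) (2 * s + i + 1) -
        mchains (n - 1) i * mchains (n - p.1) (2 * s + i + l + 2)) * mchains (p.2 + 1) l := by
      rintro ⟨t, b⟩ hp
      rw [mem_innerColumns] at hp
      simp only at hp
      exact walkCount_peakSteps_widen l t b (by omega) (by omega) (by omega)
    rw [Finset.sum_congr rfl h1, sum_innerColumns_mul (n - 1) (fun t =>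
      mchains (n - t) (i + l + 1) * mchains (n - 1) (2 * s + i + 1) -
        mchains (n - 1) i * mchains (n - t) (2 * s + i + l + 2)) (fun b => mchains (b + 1) l)]
    have h2 : ∀ t ∈ Finset.Ico 1 (n - 1 + 1), (mchains (n - t) (i + l + 1) *
        mchains (n - 1) (2 * s + i + 1) - mchains (n - 1) i * mchains (n - t) (2 * s + i + l + 2)) *
        ∑ b ∈ Finset.Ico 0 t, mchains (b + 1) l =
        mchains t (l + 1) * mchains (n - t) (i + l + 1) * mchains (n - 1) (2 * s + i + 1) -
        mchains (n - 1) i * (mchains t (l + 1) * mchains (n - t) (2 * s + i + l + 2)) := by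
      intro t ht
      rw [Finset.mem_Ico] at ht
      rw [sum_mchains (by omega)]
      ring
    rw [Finset.sum_congr rfl h2, sub_add_cancel, Finset.sum_sub_distrib, ← Finset.sum_mul,
      ← Finset.mul_sum, sum_mchains_mul hn, sum_mchains_mul hn]
    rw [show l + 1 + (i + l + 1) + 1 = 2 * (l + 1) + i + 1 by ring,
      show l + 1 + (2 * s + i + l + 2) + 1 = 2 * s + 2 * (l + 1) + i + 2 by ring]

/-- The possible first columns for directed walks. -/
def directedStart (n : ℤ) : ℕ → Finset (ℤ × ℤ)
  | 0 => {(n, 0)}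
  | _ + 1 => Finset.Ico 1 n ×ˢ {0}

/-- Pascal's rule rewrites the determinant as a difference of two products with adjacent indices, so
that the sum over the place of the peak telescopes in `ncard_directed_frames`. -/
theorem sum_walkCount_directedStart {n : ℤ} (hn : 1 ≤ n) (s : ℕ) : ∀ j : ℕ,
    ∑ p ∈ directedStart n j, walkCount (peakSteps 0 n s j) (s + j) p =
      mchains n j * mchains n (2 * s + j) -
        if j = 0 then 0 else mchains n (j - 1) * mchains n (2 * s + j + 1)
  | 0 => by
    rw [directedStart, Finset.sum_singleton, add_zero, walkCount_inner
      (fun i hi => by funext p; rw [peakSteps, if_pos hi]) s le_rfl n 0 (by omega)]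
    simp
  | i + 1 => by
    rw [directedStart, Finset.sum_product]
    simp only [Finset.sum_singleton]
    rw [Finset.sum_congr rfl fun x hx => walkCount_peakSteps_up (c := 0) i (by omega) x 0 (by
      rw [Finset.mem_Ico] at hx; omega) (Finset.mem_Ico.1 hx).2, Finset.sum_sub_distrib,
      ← Finset.sum_mul, ← Finset.mul_sum, sum_mchains_sub_end hn, sum_mchains_sub_end hn]
    have h1 := mchains_succ (by omega : 0 < n) i
    have h2 := mchains_succ (by omega : 0 < n) (2 * s + i + 1)
    simp only [max_self, sub_zero, Nat.add_eq_zero_iff, one_ne_zero, and_false, if_false,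
      Nat.add_sub_cancel, ← add_assoc]
    linear_combination mchains n i * h2 - mchains n (2 * s + i + 1) * h1

/-! ### Columns that have the full height between two given places -/

/-- Steps through a column of full height `n` at all the places from `p` to `p'`. -/
def fullSteps (n : ℤ) (p p' i : ℕ) (x : ℤ × ℤ) : Finset (ℤ × ℤ) :=
  if i < p then innerColumns x
  else if i ≤ p' then {(n, 0)} else Finset.Icc x.1 n ×ˢ Finset.Icc 0 x.2

theorem walkCount_fullSteps_full {n : ℤ} (hn : 0 ≤ n) {p p' : ℕ} : ∀ i, p + i ≤ p' →
    walkCount (fullSteps n p p') (p + i) (n, 0) = mchains n (2 * p)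
  | 0, _ => by
    rw [add_zero, walkCount_inner (fun i hi => by funext p; rw [fullSteps, if_pos hi]) p le_rfl
      n 0 hn, sub_zero]
  | i + 1, hi => by
    rw [← add_assoc, walkCount, fullSteps, if_neg (by omega), if_pos (by omega),
      Finset.sum_singleton, walkCount_fullSteps_full hn i (by omega)]

/-- Above the index p' tops and bottoms move independently, each giving a multichain; the nested
columns below the index p contribute the last factor. -/
theorem walkCount_fullSteps {n : ℤ} (hn : 0 ≤ n) {p p' : ℕ} (hp : p ≤ p') : ∀ (q : ℕ) (t b : ℤ),
    t ≤ n → 0 ≤ b → walkCount (fullSteps n p p') (p' + (q + 1)) (t, b) =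
      mchains (n + 1 - t) q * mchains (b + 1) q * mchains n (2 * p)
  | 0, t, b, _, _ => by
    obtain ⟨i, rfl⟩ := Nat.exists_eq_add_of_le hp
    rw [zero_add, walkCount, fullSteps, if_neg (by omega), if_pos le_rfl,
      Finset.sum_singleton, walkCount_fullSteps_full hn i le_rfl]
    simp
  | q + 1, t, b, ht, hb => by
    rw [← add_assoc, walkCount, fullSteps, if_neg (by omega), if_neg (by omega),
      Finset.sum_product]
    have h1 : ∀ x ∈ Finset.Icc t n, ∑ y ∈ Finset.Icc 0 b,
        walkCount (fullSteps n p p') (p' + (q + 1)) (x, y) =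
        mchains (n + 1 - x) q * mchains (b + 1) (q + 1) * mchains n (2 * p) := by
      intro x hx
      rw [Finset.mem_Icc] at hx
      rw [← sum_mchains (by omega), Finset.mul_sum, Finset.sum_mul,
        show Finset.Icc 0 b = Finset.Ico 0 (b + 1) by ext; simp]
      refine Finset.sum_congr rfl fun y hy => ?_
      rw [Finset.mem_Ico] at hy
      rw [walkCount_fullSteps hn hp q x y hx.2 hy.1]
    rw [Finset.sum_congr rfl h1, ← Finset.sum_mul, ← Finset.sum_mul,
      show Finset.Icc t n = Finset.Ico t (n + 1) by ext; simp,
      sum_mchains_sub_end (by omega)]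

/-- The possible first columns for `fullSteps`. -/
def fullStart (n : ℤ) : ℕ → Finset (ℤ × ℤ)
  | 0 => {(n, 0)}
  | _ + 1 => innerColumns (n, 0)

theorem sum_walkCount_fullStart {n : ℤ} (hn : 0 ≤ n) {p p' : ℕ} (hp : p ≤ p') : ∀ q : ℕ,
    ∑ x ∈ fullStart n q, walkCount (fullSteps n p p') (p' + q) x =
      mchains n (2 * q) * mchains n (2 * p)
  | 0 => by
    obtain ⟨i, rfl⟩ := Nat.exists_eq_add_of_le hp
    rw [fullStart, Finset.sum_singleton, add_zero, walkCount_fullSteps_full hn i le_rfl]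
    simp
  | q + 1 => by
    rw [fullStart]
    have h1 : ∀ x ∈ innerColumns (n, 0), walkCount (fullSteps n p p') (p' + (q + 1)) x =
        mchains (n + 1 - x.1) q * mchains (x.2 + 1) q * mchains n (2 * p) := by
      rintro ⟨t, b⟩ hx
      rw [mem_innerColumns] at hx
      exact walkCount_fullSteps hn hp q t b hx.2.2 hx.1
    rw [Finset.sum_congr rfl h1, ← Finset.sum_mul, sum_innerColumns_mul n
      (fun t => mchains (n + 1 - t) q) (fun b => mchains (b + 1) q)]
    have h2 : ∀ t ∈ Finset.Ico 1 (n + 1), mchains (n + 1 - t) q *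
        ∑ b ∈ Finset.Ico 0 t, mchains (b + 1) q =
        mchains t (q + 1) * mchains (n + 1 - t) q := by
      intro t ht
      rw [Finset.mem_Ico] at ht
      rw [sum_mchains (by omega), mul_comm]
    rw [Finset.sum_congr rfl h2, sum_mchains_mul (by omega), add_sub_cancel_right,
      show q + 1 + q + 1 = 2 * (q + 1) by ring]

end Polyomino
end

noncomputable section

namespace Polyomino

variable {M : ℕ}

/-! ### Convex polygons as walks of columns -/

theorem isPeak_iff_steps {g : Fin (M + 1) → ℤ} {s : Fin (M + 1)} : IsPeak g s ↔
    ∀ i : Fin M, ((i : ℕ) < s → g i.castSucc ≤ g i.succ) ∧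
      ((s : ℕ) ≤ i → g i.succ ≤ g i.castSucc) := by
  constructor
  · intro h i
    refine ⟨fun hi => h.1 _ _ ?_ ?_, fun hi => h.2 _ _ ?_ ?_⟩ <;> rw [Fin.le_def] <;>
      simp only [Fin.val_castSucc, Fin.val_succ] <;> omega
  · intro h
    -- The levels repeat the end values of g, so the additional steps at both ends are flat.
    refine isPeak_of_steps (L := fun k => g ⟨min (k - 1) M, by omega⟩) (fun i => ?_) fun i hi => ?_
    · congr 1
      exact Fin.ext (by simp only; omega)
    · by_cases hi' : 1 ≤ i ∧ i ≤ M
      · have h1 := h ⟨i - 1, by omega⟩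
        have e1 : (⟨min (i - 1) M, by omega⟩ : Fin (M + 1)) =
          (⟨i - 1, by omega⟩ : Fin M).castSucc := Fin.ext (by simp only [Fin.val_castSucc]; omega)
        have e2 : (⟨min (i + 1 - 1) M, by omega⟩ : Fin (M + 1)) =
          (⟨i - 1, by omega⟩ : Fin M).succ := Fin.ext (by simp only [Fin.val_succ]; omega)
        simp only [e1, e2]
        simp only at h1
        exact ⟨fun h => h1.1 (by omega), fun h => h1.2 (by omega)⟩
      · have e : (⟨min (i - 1) M, by omega⟩ : Fin (M + 1)) = ⟨min (i + 1 - 1) M, by omega⟩ :=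
          Fin.ext (by simp only; omega)
        simp only [e]
        exact ⟨fun _ => le_rfl, fun _ => le_rfl⟩

theorem isColumns_of_succ {T B : Fin (M + 1) → ℤ} (h1 : ∀ i, B i < T i)
    (h2 : ∀ i : Fin M, B i.succ < T i.castSucc ∧ B i.castSucc < T i.succ) : IsColumns T B := by
  refine IsColumns.of_steps h1 (fun i j hij => ?_) fun i j hij => ?_
  · obtain ⟨k, rfl, rfl⟩ : ∃ k : Fin M, i = k.succ ∧ j = k.castSucc :=
      ⟨⟨j, by omega⟩, Fin.ext hij, rfl⟩
    exact (h2 k).1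
  · obtain ⟨k, rfl, rfl⟩ : ∃ k : Fin M, j = k.succ ∧ i = k.castSucc :=
      ⟨⟨i, by omega⟩, Fin.ext hij.symm, rfl⟩
    exact (h2 k).2

theorem IsColumns.lt {T B : Fin (M + 1) → ℤ} (h : IsColumns T B) (i : Fin (M + 1)) : B i < T i :=
  h i i (by omega) (by omega)

theorem IsColumns.succ {T B : Fin (M + 1) → ℤ} (h : IsColumns T B) (i : Fin M) :
    B i.succ < T i.castSucc ∧ B i.castSucc < T i.succ :=
  ⟨h _ _ (by simp only [Fin.val_castSucc, Fin.val_succ]; omega)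
    (by simp only [Fin.val_castSucc, Fin.val_succ]; omega),
    h _ _ (by simp only [Fin.val_castSucc, Fin.val_succ]; omega)
    (by simp only [Fin.val_castSucc, Fin.val_succ]; omega)⟩

/-- The phases become implications between linear inequalities, the form in which `omega` treats all
of them at once. -/
theorem mem_peakSteps {c n : ℤ} {s j i : ℕ} {x y : ℤ × ℤ} : y ∈ peakSteps c n s j i x ↔
    (i < s → x.2 ≤ y.2 ∧ y.2 < y.1 ∧ y.1 ≤ x.1) ∧
    (s ≤ i → i < s + j → x.2 ≤ y.2 ∧ c ≤ y.2 ∧ y.2 < x.1) ∧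
    (i = s → i < s + j → y.1 = n) ∧
    (s < i → x.1 ≤ y.1 ∧ y.1 < n) ∧ (i = s → s + j ≤ i → x.1 ≤ y.1 ∧ y.1 < n) ∧
    (i = s + j → y.2 = 0) ∧ (s + j < i → 0 ≤ y.2 ∧ y.2 ≤ x.2) := by
  rw [peakSteps]
  split_ifs with h1 h2 h3 h4 <;>
    simp only [mem_innerColumns, Finset.mem_product, Finset.mem_singleton, Finset.mem_Ico,
      Finset.mem_Icc] <;> omega

/-- Index M is the leftmost column and the walk runs down to index 0. Strict bounds in the steps
make s the largest index with top n, and s + (i + 1) the smallest index with bottom 0, so different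
parameters give disjoint sets. Overlap of neighbours is a restriction only between these two places,
where top and bottom rise together; elsewhere neighbouring columns are nested. -/
theorem mem_walks_peakSteps {n : ℤ} {s i l : ℕ} (hM : s + (i + 1) + l = M)
    {f : Fin (M + 1) → ℤ × ℤ} :
    f ∈ walks (peakSteps 1 n s (i + 1)) M (peakStart n l) ↔
      IsColumns (fun a => (f a).1) (fun a => (f a).2) ∧
      (IsPeak (fun a => (f a).1) ⟨s, by omega⟩ ∧ (f ⟨s, by omega⟩).1 = n ∧
        ∀ a : Fin (M + 1), s < a → (f a).1 < n) ∧
      (IsPeak (fun a => -(f a).2) ⟨s + (i + 1), by omega⟩ ∧ (f ⟨s + (i + 1), by omega⟩).2 = 0 ∧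
        ∀ a : Fin (M + 1), (a : ℕ) < s + (i + 1) → 0 < (f a).2) := by
  have hstart : f (Fin.last M) ∈ peakStart n l ↔ 0 ≤ (f (Fin.last M)).2 ∧
      (l = 0 → (f (Fin.last M)).2 = 0) ∧ (f (Fin.last M)).2 < (f (Fin.last M)).1 ∧
      (f (Fin.last M)).1 < n := by
    cases l with
    | zero =>
      simp only [peakStart, Finset.mem_product, Finset.mem_singleton, Finset.mem_Ico, true_imp_iff]
      omega
    | succ l => simp only [peakStart, mem_innerColumns]; omega
  rw [mem_walks, hstart]
  simp only [mem_peakSteps, isPeak_iff_steps]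
  constructor
  · rintro ⟨h0, h⟩
    have hT : ∀ a : Fin (M + 1), s < a → (f a).1 < n := by
      refine Fin.lastCases (fun _ => h0.2.2.2) fun a ha => ?_
      have := h a
      simp only [Fin.val_castSucc] at ha
      omega
    have hTs : (f ⟨s, by omega⟩).1 = n := by
      have := h ⟨s, by omega⟩
      simp only [Fin.castSucc_mk, true_imp_iff] at this
      omega
    have hBu : (f ⟨s + (i + 1), by omega⟩).2 = 0 := by
      by_cases hl : l = 0
      · rw [show (⟨s + (i + 1), by omega⟩ : Fin (M + 1)) = Fin.last M from Fin.ext (by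
          simp only [Fin.val_last]; omega)]
        exact h0.2.1 hl
      · have := h ⟨s + (i + 1), by omega⟩
        simp only [Fin.castSucc_mk, true_imp_iff] at this
        omega
    have hB0 : ∀ a : Fin (M + 1), s + (i + 1) ≤ a → 0 ≤ (f a).2 := by
      refine Fin.lastCases (fun _ => h0.1) fun a ha => ?_
      have := h a
      simp only [Fin.val_castSucc] at ha
      omega
    have hpT : IsPeak (fun a => (f a).1) ⟨s, by omega⟩ := by
      refine isPeak_iff_steps.2 fun a => ?_
      have h1 := h a
      have h2 := hT a.succ
      simp only [Fin.val_succ] at h2 ⊢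
      omega
    have hpB : IsPeak (fun a => -(f a).2) ⟨s + (i + 1), by omega⟩ := by
      refine isPeak_iff_steps.2 fun a => ?_
      have h1 := h a
      have h2 := hB0 a.succ
      simp only [Fin.val_succ] at h2 ⊢
      omega
    -- That the column is nonempty is not a condition of the widening phase; it is inherited from
    -- the starting column.
    have hlt : ∀ a, (f a).2 < (f a).1 := by
      refine Fin.reverseInduction h0.2.2.1 fun a ih => ?_
      have h1 := h a
      have h2 := (isPeak_iff_steps.1 hpT a).2
      have h3 := (isPeak_iff_steps.1 hpB a).2
      simp only at h2 h3
      omega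
    refine ⟨isColumns_of_succ hlt fun a => ?_, ⟨isPeak_iff_steps.1 hpT, hTs, hT⟩,
      isPeak_iff_steps.1 hpB, hBu, fun a ha => ?_⟩
    · have h1 := h a
      have h2 := (isPeak_iff_steps.1 hpT a).2
      have h3 := (isPeak_iff_steps.1 hpB a).2
      have h4 := hlt a.castSucc
      have h5 := hlt a.succ
      simp only at h2 h3
      omega
    · have h1 := h ⟨s, by omega⟩
      by_cases has : (a : ℕ) ≤ s
      · have h2 := hpB.1 a ⟨s, by omega⟩ has (by rw [Fin.le_def]; simp)
        simp only [Fin.castSucc_mk, true_imp_iff] at h1 h2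
        omega
      · have h2 := h ⟨a, by omega⟩
        simp only [Fin.castSucc_mk, Fin.eta] at h2
        omega
  · rintro ⟨hc, ⟨hpT, hTs, hT⟩, hpB, hBu, hB⟩
    have hle := ((isPeak_iff_steps (g := fun a => -(f a).2) (s := ⟨s + (i + 1), by omega⟩)).2 hpB).le
    refine ⟨⟨?_, fun hl => ?_, hc.lt _, hT _ (by rw [Fin.val_last]; omega)⟩, fun a => ?_⟩
    · have := hle (Fin.last M)
      omega
    · rw [← hBu]
      congr 2
      exact Fin.ext (by simp only [Fin.val_last]; omega)
    · have h1 := hpT a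
      have h2 := hpB a
      have h3 := hc.succ a
      have h4 := hc.lt a.castSucc
      have h5 := hT a.castSucc
      have h6 := hB a.castSucc
      have h7 := hle a.castSucc
      have h8 : (a : ℕ) = s → (f a.castSucc).1 = n := fun h => by
        rw [← hTs]; congr 2; exact Fin.ext h
      have h9 : (a : ℕ) = s + (i + 1) → (f a.castSucc).2 = 0 := fun h => by
        rw [← hBu]; congr 2; exact Fin.ext h
      simp only [Fin.val_castSucc] at *
      omega

/-- The leftmost bottom is the lowest, so there is no widening phase and the bottoms only rise; s is
again the largest index with top n. -/
theorem mem_walks_directed {n : ℤ} (hn : 0 < n) {s j : ℕ} (hM : s + j = M) {f : Fin (M + 1) → ℤ × ℤ} :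
    f ∈ walks (peakSteps 0 n s j) M (directedStart n j) ↔
      IsColumns (fun a => (f a).1) (fun a => (f a).2) ∧
      (IsPeak (fun a => (f a).1) ⟨s, by omega⟩ ∧ (f ⟨s, by omega⟩).1 = n ∧
        ∀ a : Fin (M + 1), s < a → (f a).1 < n) ∧
      IsPeak (fun a => -(f a).2) (Fin.last M) ∧ (f (Fin.last M)).2 = 0 := by
  have hstart : f (Fin.last M) ∈ directedStart n j ↔ (f (Fin.last M)).2 = 0 ∧
      (j = 0 → (f (Fin.last M)).1 = n) ∧
      (j ≠ 0 → 0 < (f (Fin.last M)).1 ∧ (f (Fin.last M)).1 < n) := by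
    cases j with
    | zero =>
      simp only [directedStart, Finset.mem_singleton, Prod.ext_iff, true_imp_iff]
      omega
    | succ l =>
      simp only [directedStart, Finset.mem_product, Finset.mem_singleton, Finset.mem_Ico]
      omega
  rw [mem_walks, hstart]
  simp only [mem_peakSteps, isPeak_iff_steps]
  constructor
  · rintro ⟨h0, h⟩
    have hT : ∀ a : Fin (M + 1), s < a → (f a).1 < n := by
      refine Fin.lastCases (fun hs => ?_) fun a ha => ?_
      · rw [Fin.val_last] at hs
        omega
      · have := h a
        simp only [Fin.val_castSucc] at ha
        omega
    have hTs : (f ⟨s, by omega⟩).1 = n := by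
      by_cases hj : j = 0
      · rw [show (⟨s, by omega⟩ : Fin (M + 1)) = Fin.last M from Fin.ext (by
          simp only [Fin.val_last]; omega)]
        exact h0.2.1 hj
      · have := h ⟨s, by omega⟩
        simp only [Fin.castSucc_mk, true_imp_iff] at this
        omega
    have hpT : IsPeak (fun a => (f a).1) ⟨s, by omega⟩ := by
      refine isPeak_iff_steps.2 fun a => ?_
      have h1 := h a
      have h2 := hT a.succ
      have h3 := a.2
      simp only [Fin.val_succ] at h2 ⊢
      omega
    have hlt : ∀ a, (f a).2 < (f a).1 := by
      refine Fin.lastCases ?_ fun a => ?_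
      · by_cases hj : j = 0
        · rw [h0.1, h0.2.1 hj]; exact hn
        · rw [h0.1]; exact (h0.2.2 hj).1
      · have h1 := h a
        have h2 := (isPeak_iff_steps.1 hpT a).2
        have h3 := a.2
        simp only at h2
        omega
    refine ⟨isColumns_of_succ hlt fun a => ?_, ⟨isPeak_iff_steps.1 hpT, hTs, hT⟩, fun a => ?_, h0.1⟩
    · have h1 := h a
      have h2 := (isPeak_iff_steps.1 hpT a).2
      have h3 := a.2
      have h4 := hlt a.castSucc
      have h5 := hlt a.succ
      simp only at h2
      omega
    · have h1 := h a
      have h3 := a.2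
      simp only [Fin.val_last]
      omega
  · rintro ⟨hc, ⟨hpT, hTs, hT⟩, hpB, hBl⟩
    have hle := ((isPeak_iff_steps (g := fun a => -(f a).2) (s := Fin.last M)).2 hpB).le
    refine ⟨⟨hBl, fun hj => ?_, fun hj => ⟨hBl ▸ hc.lt _, hT _ (by rw [Fin.val_last]; omega)⟩⟩,
      fun a => ?_⟩
    · rw [← hTs]
      congr 2
      exact Fin.ext (by simp only [Fin.val_last]; omega)
    · have h1 := hpT a
      have h2 := hpB a
      have h3 := hc.succ a
      have h4 := hc.lt a.castSucc
      have h5 := hT a.castSucc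
      have h7 := hle a.castSucc
      have h8 : (a : ℕ) = s → (f a.castSucc).1 = n := fun h => by
        rw [← hTs]; congr 2; exact Fin.ext h
      have h9 := a.2
      simp only [Fin.val_castSucc, Fin.val_last] at *
      omega

theorem mem_fullSteps {n : ℤ} {p p' i : ℕ} {x y : ℤ × ℤ} : y ∈ fullSteps n p p' i x ↔
    (i < p → x.2 ≤ y.2 ∧ y.2 < y.1 ∧ y.1 ≤ x.1) ∧
    (p ≤ i → i ≤ p' → y.1 = n ∧ y.2 = 0) ∧
    (p ≤ i → p' < i → x.1 ≤ y.1 ∧ y.1 ≤ n ∧ 0 ≤ y.2 ∧ y.2 ≤ x.2) := by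
  rw [fullSteps]
  split_ifs with h1 h2 <;>
    simp only [mem_innerColumns, Finset.mem_product, Finset.mem_singleton, Finset.mem_Icc,
      Prod.ext_iff] <;> omega

/-- By unimodality all columns between two full ones are full. On their left the columns widen, on
their right they are nested inwards. -/
theorem mem_walks_fullSteps {n : ℤ} (hn : 0 < n) {p p' q : ℕ} (hp : p ≤ p') (hM : p' + q = M)
    {f : Fin (M + 1) → ℤ × ℤ} :
    f ∈ walks (fullSteps n p p') M (fullStart n q) ↔
      IsColumns (fun a => (f a).1) (fun a => (f a).2) ∧
      (IsPeak (fun a => (f a).1) ⟨p, by omega⟩ ∧ (f ⟨p, by omega⟩).1 = n ∧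
        (f ⟨p', by omega⟩).1 = n) ∧
      (IsPeak (fun a => -(f a).2) ⟨p, by omega⟩ ∧ (f ⟨p, by omega⟩).2 = 0 ∧
        (f ⟨p', by omega⟩).2 = 0) := by
  have hstart : f (Fin.last M) ∈ fullStart n q ↔
      0 ≤ (f (Fin.last M)).2 ∧ (f (Fin.last M)).2 < (f (Fin.last M)).1 ∧ (f (Fin.last M)).1 ≤ n ∧
      (q = 0 → (f (Fin.last M)).1 = n ∧ (f (Fin.last M)).2 = 0) := by
    cases q with
    | zero =>
      simp only [fullStart, Finset.mem_singleton, Prod.ext_iff, true_imp_iff]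
      omega
    | succ l => simp only [fullStart, mem_innerColumns]; omega
  rw [mem_walks, hstart]
  simp only [mem_fullSteps, isPeak_iff_steps]
  constructor
  · rintro ⟨h0, h⟩
    have hf : ∀ a : Fin (M + 1), p ≤ a → a ≤ p' → (f a).1 = n ∧ (f a).2 = 0 := by
      refine Fin.lastCases (fun h1 h2 => h0.2.2.2 ?_) fun a h1 h2 => ?_
      · rw [Fin.val_last] at h2; omega
      · simp only [Fin.val_castSucc] at h1 h2
        exact (h a).2.1 h1 h2
    have hin : ∀ a : Fin (M + 1), p ≤ a → (f a).1 ≤ n ∧ 0 ≤ (f a).2 := by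
      refine Fin.lastCases (fun h1 => ⟨h0.2.2.1, h0.1⟩) fun a h1 => ?_
      have h2 := h a
      simp only [Fin.val_castSucc] at h1
      omega
    have hpT : IsPeak (fun a => (f a).1) ⟨p, by omega⟩ := by
      refine isPeak_iff_steps.2 fun a => ?_
      have h1 := h a
      have h2 := hin a.succ
      simp only [Fin.val_succ] at h2 ⊢
      omega
    have hpB : IsPeak (fun a => -(f a).2) ⟨p, by omega⟩ := by
      refine isPeak_iff_steps.2 fun a => ?_
      have h1 := h a
      have h2 := hin a.succ
      simp only [Fin.val_succ] at h2 ⊢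
      omega
    have hlt : ∀ a, (f a).2 < (f a).1 := by
      refine Fin.reverseInduction h0.2.1 fun a ih => ?_
      have h1 := h a
      have h2 := (isPeak_iff_steps.1 hpT a).2
      have h3 := (isPeak_iff_steps.1 hpB a).2
      simp only at h2 h3
      omega
    refine ⟨isColumns_of_succ hlt fun a => ?_, ⟨isPeak_iff_steps.1 hpT, (hf _ le_rfl hp).1,
      (hf _ hp le_rfl).1⟩, isPeak_iff_steps.1 hpB, (hf _ le_rfl hp).2, (hf _ hp le_rfl).2⟩
    have h1 := isPeak_iff_steps.1 hpT a
    have h3 := isPeak_iff_steps.1 hpB a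
    have h4 := hlt a.castSucc
    have h5 := hlt a.succ
    simp only at h1 h3
    omega
  · rintro ⟨hc, ⟨hpT, hTp, hTp'⟩, hpB, hBp, hBp'⟩
    have hT' := (isPeak_iff_steps (g := fun a => (f a).1) (s := ⟨p, by omega⟩)).2 hpT
    have hB' := (isPeak_iff_steps (g := fun a => -(f a).2) (s := ⟨p, by omega⟩)).2 hpB
    refine ⟨⟨?_, hc.lt _, ?_, fun hq => ?_⟩, fun a => ?_⟩
    · have := hB'.le (Fin.last M)
      omega
    · rw [← hTp]
      exact hT'.le _
    · rw [← hTp', ← hBp', show Fin.last M = ⟨p', by omega⟩ from Fin.ext (by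
        simp only [Fin.val_last]; omega)]
      exact ⟨rfl, rfl⟩
    · have h1 := hpT a
      have h2 := hpB a
      have h3 := hc.lt a.castSucc
      have h4 := hT'.le a.castSucc
      have h5 := hB'.le a.castSucc
      have h6 : p ≤ a → a ≤ p' → (f a.castSucc).1 = n ∧ (f a.castSucc).2 = 0 := fun h7 h8 => by
        have e1 := hT'.2 a.castSucc ⟨p', by omega⟩ h7 h8
        have e2 := hB'.2 a.castSucc ⟨p', by omega⟩ h7 h8
        simp only at e1 e2
        omega
      omega

end Polyomino
end

noncomputable section

namespace Polyomino

open ColumnConvexPolygon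

variable {M : ℕ}

/-! ### Frames -/

/-- Between the given peak and another place of maximal value the function is squeezed to its
maximum. -/
theorem IsPeak.of_le {m : ℕ} {g : Fin m → ℤ} {j s : Fin m} (h : IsPeak g j) (hs : g j ≤ g s) :
    IsPeak g s := by
  refine ⟨fun a b hab hbs => ?_, fun a b hsa hab => ?_⟩
  · rcases le_total b j with hbj | hbj
    · exact h.1 a b hab hbj
    · exact ((h.le a).trans hs).trans (h.2 b s hbj hbs)
  · rcases le_total j a with hja | hja
    · exact h.2 a b hja hab
    · exact ((h.le b).trans hs).trans (h.1 s a hsa hja)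

theorem IsPeak.eq_of_between {m : ℕ} {g : Fin m → ℤ} {j a b c : Fin m} (h : IsPeak g j)
    (ha : g a = g j) (hb : g b = g j) (hac : a ≤ c) (hcb : c ≤ b) : g c = g j :=
  le_antisymm (h.le c) (hb ▸ (h.of_le ha.ge).2 c b hac hcb)

theorem IsPeak.rev {m : ℕ} {g : Fin m → ℤ} {j : Fin m} (h : IsPeak g j) :
    IsPeak (fun i => g i.rev) j.rev :=
  ⟨fun a b hab hbj => h.2 _ _ (Fin.le_rev_iff.1 hbj |> fun h => by simpa using h)
    (Fin.rev_le_rev.2 hab),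
    fun a b hja hab => h.1 _ _ (Fin.rev_le_rev.2 hab) (by simpa [Fin.rev_le_iff] using hja)⟩

theorem IsPeak.add_const {m : ℕ} {g : Fin m → ℤ} {j : Fin m} (h : IsPeak g j) (c : ℤ) :
    IsPeak (fun i => g i + c) j :=
  ⟨fun a b hab hbj => add_le_add_left (h.1 a b hab hbj) c,
    fun a b hja hab => add_le_add_left (h.2 a b hja hab) c⟩

/-- The columns, from right to left, of a convex polygon whose bounding rectangle has its bottom
at height `0` and its top at height `n`. -/
structure IsFrame (n : ℤ) (f : Fin (M + 1) → ℤ × ℤ) : Prop where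
  columns : IsColumns (fun a => (f a).1) (fun a => (f a).2)
  top : ∃ j, IsPeak (fun a => (f a).1) j ∧ (f j).1 = n
  bot : ∃ j, IsPeak (fun a => -(f a).2) j ∧ (f j).2 = 0

theorem IsFrame.peak_top {n : ℤ} {f : Fin (M + 1) → ℤ × ℤ} (h : IsFrame n f) {s : Fin (M + 1)}
    (hs : (f s).1 = n) : IsPeak (fun a => (f a).1) s := by
  obtain ⟨j, hj, hjn⟩ := h.top
  exact hj.of_le (by simp only [hs, hjn, le_refl])

theorem IsFrame.peak_bot {n : ℤ} {f : Fin (M + 1) → ℤ × ℤ} (h : IsFrame n f) {s : Fin (M + 1)}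
    (hs : (f s).2 = 0) : IsPeak (fun a => -(f a).2) s := by
  obtain ⟨j, hj, hjn⟩ := h.bot
  exact hj.of_le (by simp only [hs, hjn, le_refl])

theorem IsFrame.top_le {n : ℤ} {f : Fin (M + 1) → ℤ × ℤ} (h : IsFrame n f) (a : Fin (M + 1)) :
    (f a).1 ≤ n := by
  obtain ⟨j, hj, hjn⟩ := h.top
  exact hjn ▸ hj.le a

theorem IsFrame.bot_nonneg {n : ℤ} {f : Fin (M + 1) → ℤ × ℤ} (h : IsFrame n f)
    (a : Fin (M + 1)) : 0 ≤ (f a).2 := by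
  obtain ⟨j, hj, hjn⟩ := h.bot
  have := hj.le a
  omega

theorem IsFrame.top_between {n : ℤ} {f : Fin (M + 1) → ℤ × ℤ} (h : IsFrame n f)
    {a b c : Fin (M + 1)} (ha : (f a).1 = n) (hb : (f b).1 = n) (hac : a ≤ c) (hcb : c ≤ b) :
    (f c).1 = n :=
  ((h.peak_top ha).eq_of_between rfl (hb.trans ha.symm) hac hcb).trans ha

theorem IsFrame.bot_between {n : ℤ} {f : Fin (M + 1) → ℤ × ℤ} (h : IsFrame n f)
    {a b c : Fin (M + 1)} (ha : (f a).2 = 0) (hb : (f b).2 = 0) (hac : a ≤ c) (hcb : c ≤ b) :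
    (f c).2 = 0 :=
  (neg_inj.1 ((h.peak_bot ha).eq_of_between rfl (neg_inj.2 (hb.trans ha.symm)) hac hcb)).trans ha

/-- The frame of a polygon. -/
def frame (P : ColumnConvexPolygon (M + 1)) (i : Fin (M + 1)) : ℤ × ℤ :=
  (P.colTop i.rev - P.yMin, P.colBot i.rev - P.yMin)

theorem IsColumns.rev_sub {T B : Fin (M + 1) → ℤ} (h : IsColumns T B) (c : ℤ) :
    IsColumns (fun i => T i.rev - c) (fun i => B i.rev - c) := fun i j hij hji =>
  sub_lt_sub_right (h i.rev j.rev (by simp only [Fin.val_rev]; omega)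
    (by simp only [Fin.val_rev]; omega)) c

/-- The bottom of the bounding rectangle is moved to height 0. By convexity half the vertical
perimeter is the height of the rectangle, so the top is then at n. -/
theorem bijOn_frame (n : ℤ) : Set.BijOn frame
    {P : ColumnConvexPolygon (M + 1) | P ∈ convexPolygons (M + 1) ∧ P.halfVertical = n}
    {f | IsFrame n f} := by
  refine ⟨?_, ?_, ?_⟩
  · rintro P ⟨hP, hn⟩
    have hP' : P.IsConvex := hP
    obtain ⟨⟨j, hj⟩, l, hl⟩ := P.isConvex_iff.1 hP'
    refine ⟨P.isColumns_col.rev_sub _, ⟨j.rev, ?_, ?_⟩, ⟨l.rev, ?_, ?_⟩⟩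
    · exact hj.rev.add_const (-P.yMin)
    · rw [← hn, P.isConvex_iff_halfVertical.1 hP', P.yMax_eq hj.le, frame, Fin.rev_rev]
    · have := hl.rev.add_const P.yMin
      simpa only [frame, neg_sub', sub_neg_eq_add] using this
    · rw [frame, Fin.rev_rev, P.yMin_eq fun i => neg_le_neg_iff.1 (hl.le i)]
      exact sub_self _
  · rintro P - Q - hPQ
    -- The translation can be recovered from the frame: the first bottom of a polygon is 0, so its
    -- entry in the frame is minus the lowest height.
    have h0 : P.yMin = Q.yMin := by
      have := congrArg Prod.snd (congrFun hPQ (Fin.last M))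
      simp only [frame, Fin.rev_last, P.colBot_zero, Q.colBot_zero] at this
      omega
    refine ext_col (funext fun i => ?_) (funext fun i => ?_)
    · have := congrArg Prod.fst (congrFun hPQ i.rev)
      simp only [frame, Fin.rev_rev] at this
      omega
    · have := congrArg Prod.snd (congrFun hPQ i.rev)
      simp only [frame, Fin.rev_rev] at this
      omega
  · intro f hf
    have hf' : IsFrame n f := hf
    obtain ⟨j, hj, hjn⟩ := hf'.top
    obtain ⟨l, hl, hl0⟩ := hf'.bot
    have hc := hf'.columns.rev_sub (f (Fin.last M)).2
    set P := ofColumns _ _ (by simp) hc with hPdef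
    have hT : P.colTop = fun i => (f i.rev).1 - (f (Fin.last M)).2 := colTop_ofColumns _ hc
    have hB : P.colBot = fun i => (f i.rev).2 - (f (Fin.last M)).2 := colBot_ofColumns _ hc
    have hpT : IsPeak P.colTop j.rev := by
      rw [hT]
      exact hj.rev.add_const (-(f (Fin.last M)).2)
    have hpB : IsPeak (fun i => -P.colBot i) l.rev := by
      have := hl.rev.add_const (f (Fin.last M)).2
      simpa only [hB, neg_sub', sub_neg_eq_add] using this
    have hmin : P.yMin = -(f (Fin.last M)).2 := by
      rw [P.yMin_eq fun i => neg_le_neg_iff.1 (hpB.le i), hB]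
      simp only [Fin.rev_rev]
      rw [hl0, zero_sub]
    have hcv : P.IsConvex := P.isConvex_iff.2 ⟨⟨_, hpT⟩, ⟨_, hpB⟩⟩
    refine ⟨P, ⟨hcv, ?_⟩, ?_⟩
    · rw [P.isConvex_iff_halfVertical.1 hcv, hmin, P.yMax_eq hpT.le, hT]
      simp only [Fin.rev_rev]
      rw [hjn]
      ring
    · funext i
      rw [frame, hmin, hT, hB]
      simp

theorem frame_directed {P : ColumnConvexPolygon (M + 1)} : P ∈ directedConvex (M + 1) ↔
    P ∈ convexPolygons (M + 1) ∧ IsPeak (fun a => -(frame P a).2) (Fin.last M) := by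
  have h1 : Monotone P.colBot ↔ IsPeak (fun i => -P.colBot i) 0 :=
    ⟨fun h => isPeak_zero fun a b hab => neg_le_neg (h hab),
      fun h a b hab => neg_le_neg_iff.1 (h.2 a b (Fin.zero_le a) hab)⟩
  have h2 : IsPeak (fun a => -(frame P a).2) (Fin.last M) ↔ IsPeak (fun i => -P.colBot i) 0 := by
    constructor
    · intro h
      have := h.rev.add_const (-P.yMin)
      simp only [frame, Fin.rev_rev, Fin.rev_last] at this
      simpa only [neg_sub, sub_add_eq_add_sub, add_neg_cancel, zero_sub] using this
    · intro h
      have := h.rev.add_const P.yMin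
      simpa only [frame, neg_sub', sub_neg_eq_add, Fin.rev_zero] using this
  rw [mem_directedConvex_iff, h2, h1]
  have : P ∈ convexPolygons (M + 1) ↔ P.IsConvex := Iff.rfl
  rw [this, isConvex_iff]
  exact ⟨fun h => ⟨⟨h.2, ⟨_, h.1⟩⟩, h.1⟩, fun h => ⟨h.2, h.1.1⟩⟩

theorem ncard_convex_eq (n : ℤ) :
    {P : ColumnConvexPolygon (M + 1) | P ∈ convexPolygons (M + 1) ∧ P.halfVertical = n}.ncard =
      {f : Fin (M + 1) → ℤ × ℤ | IsFrame n f}.ncard := by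
  have h := bijOn_frame (M := M) n
  rw [← h.image_eq, h.injOn.ncard_image]

theorem ncard_directedConvex_eq (n : ℤ) :
    {P : ColumnConvexPolygon (M + 1) | P ∈ directedConvex (M + 1) ∧ P.halfVertical = n}.ncard =
      {f : Fin (M + 1) → ℤ × ℤ | IsFrame n f ∧
        IsPeak (fun a => -(f a).2) (Fin.last M)}.ncard := by
  have h := bijOn_frame (M := M) n
  have h2 : frame '' {P | P ∈ directedConvex (M + 1) ∧ P.halfVertical = n} =
      {f : Fin (M + 1) → ℤ × ℤ | IsFrame n f ∧ IsPeak (fun a => -(f a).2) (Fin.last M)} := by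
    ext f
    constructor
    · rintro ⟨P, ⟨hP, hn⟩, rfl⟩
      rw [frame_directed] at hP
      exact ⟨h.mapsTo ⟨hP.1, hn⟩, hP.2⟩
    · rintro ⟨hf, hp⟩
      obtain ⟨P, ⟨hP, hn⟩, rfl⟩ := h.surjOn hf
      exact ⟨P, ⟨frame_directed.2 ⟨hP, hp⟩, hn⟩, rfl⟩
  have h3 : Set.InjOn frame
      {P : ColumnConvexPolygon (M + 1) | P ∈ directedConvex (M + 1) ∧ P.halfVertical = n} :=
    h.injOn.mono (by
      rintro P ⟨hP, hn⟩
      exact ⟨(frame_directed.1 hP).1, hn⟩)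
  rw [← h2, h3.ncard_image]

end Polyomino
end

noncomputable section

namespace Polyomino

variable {M : ℕ}

/-! ### The number of directed convex polygons -/

theorem exists_greatest {p : Fin (M + 1) → Prop} (h : ∃ a, p a) :
    ∃ s, p s ∧ ∀ a, s < a → ¬p a := by
  classical
  obtain ⟨a, ha⟩ := h
  obtain ⟨s, hs, hmax⟩ := (Finset.univ.filter p).exists_max_image id ⟨a, by simpa using ha⟩
  refine ⟨s, (Finset.mem_filter.1 hs).2, fun b hb hpb => ?_⟩
  exact absurd hb (not_lt.2 (hmax b (by simpa using hpb)))

theorem exists_smallest {p : Fin (M + 1) → Prop} (h : ∃ a, p a) :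
    ∃ s, p s ∧ ∀ a, a < s → ¬p a := by
  classical
  obtain ⟨a, ha⟩ := h
  obtain ⟨s, hs, hmax⟩ := (Finset.univ.filter p).exists_min_image id ⟨a, by simpa using ha⟩
  refine ⟨s, (Finset.mem_filter.1 hs).2, fun b hb hpb => ?_⟩
  exact absurd hb (not_lt.2 (hmax b (by simpa using hpb)))

/-- Classify the frames by the largest index s whose top is n. Each class is counted by a difference
of consecutive values of `mchains n (M - s) * mchains n (M + s)`, and only the value at s = 0
survives. -/
theorem ncard_directed_frames {n : ℤ} (hn : 1 ≤ n) :
    (({f : Fin (M + 1) → ℤ × ℤ | IsFrame n f ∧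
      IsPeak (fun a => -(f a).2) (Fin.last M)}.ncard : ℕ) : ℤ) = mchains n M ^ 2 := by
  have hset : {f : Fin (M + 1) → ℤ × ℤ | IsFrame n f ∧
      IsPeak (fun a => -(f a).2) (Fin.last M)} = ((Finset.range (M + 1)).biUnion fun s =>
        walks (peakSteps 0 n s (M - s)) M (directedStart n (M - s)) :
          Finset (Fin (M + 1) → ℤ × ℤ)) := by
    ext f
    simp only [Finset.coe_biUnion, Set.mem_iUnion, Finset.mem_coe, Finset.mem_range,
      Set.mem_ofPred_eq]
    constructor
    · rintro ⟨hf, hp⟩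
      obtain ⟨j, -, hj⟩ := hf.top
      obtain ⟨l, hl, hl0⟩ := hf.bot
      obtain ⟨s, hs, hmax⟩ := exists_greatest (p := fun a => (f a).1 = n) ⟨j, hj⟩
      refine ⟨s, s.2, (mem_walks_directed (by omega) (by omega)).2 ⟨hf.columns,
        ⟨hf.peak_top hs, hs, fun a ha => lt_of_le_of_ne (hf.top_le a) (hmax a ha)⟩, hp, ?_⟩⟩
      have h1 := hp.le l
      have h2 := hf.bot_nonneg (Fin.last M)
      omega
    · rintro ⟨s, hs, hf⟩
      obtain ⟨h1, h2, h3⟩ := (mem_walks_directed (by omega) (by omega)).1 hf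
      exact ⟨⟨h1, ⟨_, h2.1, h2.2.1⟩, ⟨_, h3⟩⟩, h3.1⟩
  rw [hset, Set.ncard_coe_finset, Finset.card_biUnion]
  · push_cast
    have h1 : ∀ s ∈ Finset.range (M + 1),
        ((walks (peakSteps 0 n s (M - s)) M (directedStart n (M - s))).card : ℤ) =
        (if s < M + 1 then mchains n (M - s) * mchains n (M + s) else 0) -
        (if s + 1 < M + 1 then mchains n (M - (s + 1)) * mchains n (M + (s + 1)) else 0) := by
      intro s hs
      rw [Finset.mem_range] at hs
      have h2 := sum_walkCount_directedStart hn s (M - s)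
      rw [show s + (M - s) = M by omega] at h2
      rw [card_walks, h2, if_pos hs, show 2 * s + (M - s) = M + s by omega]
      congr 1
      split_ifs <;> first | omega | rfl
    rw [Finset.sum_congr rfl h1, Finset.sum_range_sub']
    simp
    ring
  · intro s hs s' hs' hss
    rw [Function.onFun, Finset.disjoint_left]
    intro f hf hf'
    simp only [Finset.coe_range, Set.mem_Iio] at hs hs'
    obtain ⟨-, h2, -⟩ := (mem_walks_directed (by omega) (by omega)).1 hf
    obtain ⟨-, h3, -⟩ := (mem_walks_directed (by omega) (by omega)).1 hf'
    rcases Nat.lt_or_gt_of_ne hss with h | h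
    · exact absurd h3.2.1 (h2.2.2 _ h).ne
    · exact absurd h2.2.1 (h3.2.2 _ h).ne

/-! ### The number of convex polygons -/

/-- The frames that reach their full height to the left of the places where they are at
height `0`, seen from right to left. -/
def peakFrames (M : ℕ) (n : ℤ) : Finset (Fin (M + 1) → ℤ × ℤ) :=
  ((Finset.range M).sigma fun i => Finset.HasAntidiagonal.antidiagonal (M - 1 - i)).biUnion fun x =>
    walks (peakSteps 1 n x.2.1 (x.1 + 1)) M (peakStart n x.2.2)

theorem mem_peakFrames {n : ℤ} {f : Fin (M + 1) → ℤ × ℤ} : f ∈ peakFrames M n ↔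
    IsFrame n f ∧ ∀ a b, (f a).1 = n → (f b).2 = 0 → a < b := by
  simp only [peakFrames, Finset.mem_biUnion, Finset.mem_sigma, Finset.mem_range,
    Finset.HasAntidiagonal.mem_antidiagonal]
  constructor
  · rintro ⟨⟨i, s, l⟩, ⟨hi, hsl⟩, hf⟩
    simp only at hi hsl hf
    obtain ⟨h1, h2, h3⟩ := (mem_walks_peakSteps (by omega)).1 hf
    refine ⟨⟨h1, ⟨_, h2.1, h2.2.1⟩, ⟨_, h3.1, h3.2.1⟩⟩, fun a b ha hb => ?_⟩
    have h4 : (a : ℕ) ≤ s := not_lt.1 fun h => (h2.2.2 a h).ne ha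
    have h5 : s + (i + 1) ≤ b := not_lt.1 fun h => (h3.2.2 b h).ne' hb
    exact Fin.lt_def.2 (by omega)
  · rintro ⟨hf, hlt⟩
    obtain ⟨j, -, hj⟩ := hf.top
    obtain ⟨l, -, hl⟩ := hf.bot
    obtain ⟨s, hs, hsmax⟩ := exists_greatest (p := fun a => (f a).1 = n) ⟨j, hj⟩
    obtain ⟨u, hu, humin⟩ := exists_smallest (p := fun a => (f a).2 = 0) ⟨l, hl⟩
    have hsu : (s : ℕ) < u := hlt s u hs hu
    obtain ⟨i, hi⟩ : ∃ i, (u : ℕ) = s + (i + 1) := ⟨u - s - 1, by omega⟩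
    obtain ⟨l, hl⟩ : ∃ l, s + (i + 1) + l = M := ⟨M - u, by omega⟩
    have e : (⟨s + (i + 1), by omega⟩ : Fin (M + 1)) = u := Fin.ext hi.symm
    refine ⟨⟨i, s, l⟩, ⟨by simp only; omega, by simp only; omega⟩,
      (mem_walks_peakSteps hl).2 ⟨hf.columns, ⟨hf.peak_top hs, hs,
        fun a ha => lt_of_le_of_ne (hf.top_le a) (hsmax a ha)⟩, ?_⟩⟩
    rw [e]
    exact ⟨hf.peak_bot hu, hu, fun a ha => lt_of_le_of_ne (hf.bot_nonneg a)
      (Ne.symm (humin a (Fin.lt_def.2 (by omega))))⟩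

/-- A frame determines the largest index with top n and the smallest index with bottom 0, so the
union is disjoint. -/
theorem card_peakFrames {n : ℤ} (hn : 1 ≤ n) : ((peakFrames M n).card : ℤ) =
    ∑ i ∈ Finset.range M, ∑ x ∈ Finset.HasAntidiagonal.antidiagonal (M - 1 - i),
      (mchains (n - 1) (2 * x.2 + i + 1) * mchains (n - 1) (2 * x.1 + i + 1) -
        mchains (n - 1) i * mchains (n - 1) (2 * x.1 + 2 * x.2 + i + 2)) := by
  rw [peakFrames, Finset.card_biUnion]
  · push_cast
    rw [Finset.sum_sigma]
    refine Finset.sum_congr rfl fun i hi => Finset.sum_congr rfl fun x hx => ?_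
    rw [Finset.mem_range] at hi
    rw [Finset.HasAntidiagonal.mem_antidiagonal] at hx
    rw [card_walks, ← sum_walkCount_peakStart hn]
    simp only
    rw [show x.1 + (i + 1) + x.2 = M by omega]
  · rintro ⟨i, s, l⟩ h ⟨i', s', l'⟩ h' hne
    rw [Function.onFun, Finset.disjoint_left]
    intro f hf hf'
    simp only [Finset.coe_sigma, Set.mem_sigma_iff, Finset.mem_coe, Finset.mem_range,
      Finset.HasAntidiagonal.mem_antidiagonal] at h h' hf hf'
    obtain ⟨-, h2, h3⟩ := (mem_walks_peakSteps (by omega)).1 hf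
    obtain ⟨-, h2', h3'⟩ := (mem_walks_peakSteps (by omega)).1 hf'
    have e1 : ¬s < s' := fun h => (h2.2.2 _ h).ne h2'.2.1
    have e2 : ¬s' < s := fun h => (h2'.2.2 _ h).ne h2.2.1
    have e3 : ¬s + (i + 1) < s' + (i' + 1) := fun h => (h3'.2.2 _ h).ne' h3.2.1
    have e4 : ¬s' + (i' + 1) < s + (i + 1) := fun h => (h3.2.2 _ h).ne' h3'.2.1
    obtain rfl : s = s' := by omega
    obtain rfl : i = i' := by omega
    obtain rfl : l = l' := by omega
    exact hne rfl

/-- The frames with a column of full height at all the places from `p` to `p'`. -/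
def fullFrames (M : ℕ) (n : ℤ) (p p' : ℕ) : Finset (Fin (M + 1) → ℤ × ℤ) :=
  walks (fullSteps n p p') M (fullStart n (M - p'))

theorem mem_fullFrames {n : ℤ} (hn : 1 ≤ n) {p p' : Fin (M + 1)} (hp : p ≤ p')
    {f : Fin (M + 1) → ℤ × ℤ} : f ∈ fullFrames M n p p' ↔
    IsFrame n f ∧ f p = (n, 0) ∧ f p' = (n, 0) := by
  rw [fullFrames, mem_walks_fullSteps (by omega) hp (by omega)]
  simp only [Prod.ext_iff]
  constructor
  · rintro ⟨h1, h2, h3⟩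
    exact ⟨⟨h1, ⟨_, h2.1, h2.2.1⟩, ⟨_, h3.1, h3.2.1⟩⟩, ⟨h2.2.1, h3.2.1⟩, h2.2.2, h3.2.2⟩
  · rintro ⟨hf, h1, h2⟩
    exact ⟨hf.columns, ⟨hf.peak_top h1.1, h1.1, h2.1⟩, hf.peak_bot h1.2, h1.2, h2.2⟩

theorem card_fullFrames {n : ℤ} (hn : 1 ≤ n) {p p' : ℕ} (hp : p ≤ p') (hM : p' ≤ M) :
    ((fullFrames M n p p').card : ℤ) = mchains n (2 * (M - p')) * mchains n (2 * p) := by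
  rw [fullFrames, card_walks, ← sum_walkCount_fullStart (by omega) hp,
    show p' + (M - p') = M by omega]

/-- A union of finite sets such that every element belongs to the sets of an interval. -/
theorem card_biUnion_interval {α : Type*} [DecidableEq α] (A : ℕ → Finset α) (q : ℕ)
    (h : ∀ p x, p ≤ q → x ∈ A p → x ∈ A (q + 1) → x ∈ A q) :
    (((Finset.range (q + 2)).biUnion A).card : ℤ) + (A q ∩ A (q + 1)).card =
      ((Finset.range (q + 1)).biUnion A).card + (A (q + 1)).card := by
  have h1 : (Finset.range (q + 2)).biUnion A = (Finset.range (q + 1)).biUnion A ∪ A (q + 1) := by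
    rw [Finset.range_add_one, Finset.biUnion_insert, Finset.union_comm]
  have h2 : A q ∩ A (q + 1) = (Finset.range (q + 1)).biUnion A ∩ A (q + 1) := by
    ext x
    simp only [Finset.mem_inter, Finset.mem_biUnion, Finset.mem_range]
    constructor
    · rintro ⟨h1, h2⟩
      exact ⟨⟨q, by omega, h1⟩, h2⟩
    · rintro ⟨⟨p, hp, h1⟩, h2⟩
      exact ⟨h p x (by omega) h1 h2, h2⟩
  rw [h1, h2]
  exact_mod_cast Finset.card_union_add_card_inter _ _

theorem fullFrames_inter {n : ℤ} (hn : 1 ≤ n) {q : ℕ} (hq : q < M) :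
    fullFrames M n q q ∩ fullFrames M n (q + 1) (q + 1) = fullFrames M n q (q + 1) := by
  ext f
  have h1 := mem_fullFrames (M := M) hn (f := f) (le_refl (⟨q, by omega⟩ : Fin (M + 1)))
  have h2 := mem_fullFrames (M := M) hn (f := f) (le_refl (⟨q + 1, by omega⟩ : Fin (M + 1)))
  have h3 := mem_fullFrames (M := M) hn (f := f)
    (show (⟨q, by omega⟩ : Fin (M + 1)) ≤ ⟨q + 1, by omega⟩ by rw [Fin.le_def]; simp)
  simp only at h1 h2 h3
  rw [Finset.mem_inter, h1, h2, h3]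
  tauto

/-- The full columns of a frame form an interval, so the number of them minus the number of adjacent
pairs of them is one: the difference counts each frame once. -/
theorem card_biUnion_fullFrames {n : ℤ} (hn : 1 ≤ n) : ∀ q ≤ M,
    (((Finset.range (q + 1)).biUnion fun p => fullFrames M n p p).card : ℤ) =
      ∑ p ∈ Finset.range (q + 1), mchains n (2 * (M - p)) * mchains n (2 * p) -
        ∑ p ∈ Finset.range q, mchains n (2 * (M - (p + 1))) * mchains n (2 * p)
  | 0, _ => by
    simp only [zero_add, Finset.range_one, Finset.singleton_biUnion, Finset.sum_singleton,
      Finset.range_zero, Finset.sum_empty, sub_zero]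
    rw [card_fullFrames hn le_rfl (Nat.zero_le M), Nat.sub_zero]
  | q + 1, hq => by
    have h := card_biUnion_interval (fun p => fullFrames M n p p) q (fun p f hp h1 h2 => by
      have e1 := (mem_fullFrames hn (f := f) (le_refl (⟨p, by omega⟩ : Fin (M + 1)))).1 h1
      have e2 := (mem_fullFrames hn (f := f) (le_refl (⟨q + 1, by omega⟩ : Fin (M + 1)))).1 h2
      refine (mem_fullFrames hn (f := f) (le_refl (⟨q, by omega⟩ : Fin (M + 1)))).2 ⟨e1.1, ?_⟩
      rw [and_self]
      exact Prod.ext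
        (e1.1.top_between (congrArg Prod.fst e1.2.1) (congrArg Prod.fst e2.2.1) hp (by
          rw [Fin.le_def]; simp))
        (e1.1.bot_between (congrArg Prod.snd e1.2.1) (congrArg Prod.snd e2.2.1) hp (by
          rw [Fin.le_def]; simp)))
    rw [fullFrames_inter hn (by omega), card_fullFrames hn (by omega) (by omega),
      card_fullFrames hn le_rfl hq, card_biUnion_fullFrames hn q (by omega)] at h
    rw [Finset.sum_range_succ (fun p => mchains n (2 * (M - p)) * mchains n (2 * p)) (q + 1),
      Finset.sum_range_succ (fun p => mchains n (2 * (M - (p + 1))) * mchains n (2 * p)) q]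
    linarith

/-- The reflection of a frame in a horizontal line. -/
def flip (n : ℤ) (f : Fin (M + 1) → ℤ × ℤ) (a : Fin (M + 1)) : ℤ × ℤ := (n - (f a).2, n - (f a).1)

theorem flip_flip (n : ℤ) (f : Fin (M + 1) → ℤ × ℤ) : flip n (flip n f) = f := by
  funext a
  simp [flip]

theorem IsFrame.flip {n : ℤ} {f : Fin (M + 1) → ℤ × ℤ} (h : IsFrame n f) :
    IsFrame n (flip n f) := by
  obtain ⟨j, hj, hjn⟩ := h.top
  obtain ⟨l, hl, hl0⟩ := h.bot
  refine ⟨fun i k hik hki => ?_, ⟨l, ?_, ?_⟩, ⟨j, ?_, ?_⟩⟩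
  · have := h.columns k i (by omega) (by omega)
    simp only [Polyomino.flip] at this ⊢
    omega
  · simpa only [Polyomino.flip, neg_add_eq_sub] using hl.add_const n
  · simp only [Polyomino.flip, hl0, sub_zero]
  · simpa only [Polyomino.flip, neg_sub, ← sub_eq_add_neg] using hj.add_const (-n)
  · simp only [Polyomino.flip, hjn, sub_self]

/-- The indices with top n and those with bottom 0 form two intervals. Either one precedes the
other, the two orders being exchanged by `flip`, or they share a full column. -/
theorem ncard_frames {n : ℤ} (hn : 1 ≤ n) :
    (({f : Fin (M + 1) → ℤ × ℤ | IsFrame n f}.ncard : ℕ) : ℤ) =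
      2 * (∑ i ∈ Finset.range M, ∑ x ∈ Finset.HasAntidiagonal.antidiagonal (M - 1 - i),
      (mchains (n - 1) (2 * x.2 + i + 1) * mchains (n - 1) (2 * x.1 + i + 1) -
        mchains (n - 1) i * mchains (n - 1) (2 * x.1 + 2 * x.2 + i + 2))) +
      (∑ p ∈ Finset.range (M + 1), mchains n (2 * (M - p)) * mchains n (2 * p) -
        ∑ p ∈ Finset.range M, mchains n (2 * (M - (p + 1))) * mchains n (2 * p)) := by
  set F := (Finset.range (M + 1)).biUnion fun p => fullFrames M n p p with hF
  have hmemF : ∀ f, f ∈ F ↔ IsFrame n f ∧ ∃ a, (f a).1 = n ∧ (f a).2 = 0 := by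
    intro f
    simp only [hF, Finset.mem_biUnion, Finset.mem_range]
    constructor
    · rintro ⟨p, hp, hf⟩
      have := (mem_fullFrames hn (f := f) (le_refl (⟨p, hp⟩ : Fin (M + 1)))).1 hf
      exact ⟨this.1, _, congrArg Prod.fst this.2.1, congrArg Prod.snd this.2.1⟩
    · rintro ⟨hf, a, h1, h2⟩
      exact ⟨a, a.2, (mem_fullFrames hn (f := f) (le_refl a)).2
        ⟨hf, Prod.ext h1 h2, Prod.ext h1 h2⟩⟩
  have hmemR : ∀ f, f ∈ (peakFrames M n).image (flip n) ↔
      IsFrame n f ∧ ∀ a b, (f a).1 = n → (f b).2 = 0 → b < a := by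
    intro f
    rw [Finset.mem_image]
    constructor
    · rintro ⟨g, hg, rfl⟩
      rw [mem_peakFrames] at hg
      refine ⟨hg.1.flip, fun a b ha hb => hg.2 b a ?_ ?_⟩
      · simp only [flip] at hb; omega
      · simp only [flip] at ha; omega
    · rintro ⟨hf, h⟩
      refine ⟨flip n f, mem_peakFrames.2 ⟨hf.flip, fun a b ha hb => h b a ?_ ?_⟩, flip_flip n f⟩
      · simp only [flip] at hb; omega
      · simp only [flip] at ha; omega
  have hset : {f : Fin (M + 1) → ℤ × ℤ | IsFrame n f} =
      ((peakFrames M n ∪ (peakFrames M n).image (flip n)) ∪ F : Finset _) := by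
    ext f
    rw [Finset.mem_coe, Finset.mem_union, Finset.mem_union, hmemF, hmemR, mem_peakFrames,
      ← and_or_left, ← and_or_left, Set.mem_ofPred_eq]
    refine (and_iff_left_of_imp fun hf => ?_).symm
    by_contra hcon
    simp only [not_or, not_forall, not_lt, not_exists] at hcon
    obtain ⟨⟨⟨a, b, ha, hb, hba⟩, a', b', ha', hb', hab'⟩, hcon⟩ := hcon
    -- Two intervals neither of which precedes the other meet: at b' if b' ≤ a, and at a otherwise.
    rcases le_total b' a with h | h
    · exact hcon b' ⟨hf.top_between ha' ha hab' h, hb'⟩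
    · exact hcon a ⟨ha, hf.bot_between hb hb' hba h⟩
  have hinj : Function.Injective (flip n : (Fin (M + 1) → ℤ × ℤ) → _) :=
    Function.Involutive.injective (flip_flip n)
  rw [hset, Set.ncard_coe_finset, Finset.card_union_of_disjoint, Finset.card_union_of_disjoint,
    Finset.card_image_of_injective _ hinj]
  · push_cast
    rw [card_biUnion_fullFrames hn M le_rfl, card_peakFrames hn]
    ring
  · rw [Finset.disjoint_left]
    intro f h1 h2
    obtain ⟨⟨j, -, hj⟩, ⟨l, -, hl⟩⟩ := And.intro (mem_peakFrames.1 h1).1.top (mem_peakFrames.1 h1).1.bot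
    exact lt_asymm ((mem_peakFrames.1 h1).2 j l hj hl) (((hmemR f).1 h2).2 j l hj hl)
  · rw [Finset.disjoint_left]
    intro f h1 h2
    obtain ⟨-, a, ha, hb⟩ := (hmemF f).1 h2
    rcases Finset.mem_union.1 h1 with h | h
    · exact lt_irrefl a ((mem_peakFrames.1 h).2 a a ha hb)
    · exact lt_irrefl a (((hmemR f).1 h).2 a a ha hb)

end Polyomino
end

noncomputable section

namespace Polyomino

/-! ### Summation identities for multiset numbers -/

section Multichoose

variable (ν : ℕ)

theorem multichoose_succ_add (a : ℕ) : ((ν + 1).multichoose (a + 1) : ℤ) =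
    (ν + 1).multichoose a + ν.multichoose (a + 1) := by
  rw [Nat.multichoose_succ_succ]
  push_cast
  ring

theorem mul_multichoose_succ (b : ℕ) :
    (ν : ℤ) * (ν + 1).multichoose b = (b + 1) * ν.multichoose (b + 1) := by
  rw [Nat.multichoose_eq, Nat.multichoose_eq]
  have h := Nat.choose_succ_right_eq (ν + b) b
  rw [Nat.add_sub_cancel] at h
  rw [show ν + 1 + b - 1 = ν + b by omega, show ν + (b + 1) - 1 = ν + b by omega]
  zify at h
  linarith

theorem succ_mul_multichoose (a : ℕ) :
    ((a : ℤ) + 1) * ν.multichoose (a + 1) = (ν + a) * ν.multichoose a := by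
  rw [← mul_multichoose_succ]
  cases a with
  | zero => simp
  | succ a =>
    have h := mul_multichoose_succ ν a
    rw [multichoose_succ_add]
    push_cast
    linear_combination h

/-- The closed form for an arbitrary upper limit k is what makes induction possible; the inductive
step is the absorption identities together with Pascal's rule. Only k = M is used later. -/
theorem sum_sub_mul_multichoose (M : ℕ) : ∀ k ≤ 2 * M,
    ∑ i ∈ Finset.range k, (2 * M - 2 * i : ℤ) * (ν.multichoose i * ν.multichoose (2 * M - i)) =
      k * ν.multichoose k * (ν + 1).multichoose (2 * M - k)
  | 0, _ => by simp
  | k + 1, hk => by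
    rw [Finset.sum_range_succ, sum_sub_mul_multichoose M k (by omega)]
    obtain ⟨b, hb⟩ : ∃ b, 2 * M = k + (b + 1) := ⟨2 * M - k - 1, by omega⟩
    have h0 : (2 * M : ℤ) = k + (b + 1) := by exact_mod_cast hb
    rw [h0, hb, show k + (b + 1) - k = b + 1 by omega, show k + (b + 1) - (k + 1) = b by omega]
    have h1 := succ_mul_multichoose ν k
    have h2 := multichoose_succ_add ν b
    have h3 := mul_multichoose_succ ν b
    push_cast
    rw [h1, h2]
    linear_combination -(ν.multichoose k : ℤ) * h3

theorem mk_multichoose_mul_pow (x : ℕ) :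
    (PowerSeries.mk fun a => (x.multichoose a : ℤ)) * (1 - PowerSeries.X) ^ x = 1 := by
  induction x with
  | zero =>
    ext a
    rw [pow_zero, mul_one, PowerSeries.coeff_mk, PowerSeries.coeff_one]
    cases a <;> simp
  | succ x ih =>
    refine Eq.trans ?_ ih
    rw [pow_succ', ← mul_assoc]
    congr 1
    ext a
    rw [mul_sub, mul_one, map_sub, PowerSeries.coeff_mk, PowerSeries.coeff_mk]
    cases a with
    | zero => simp
    | succ a =>
      rw [PowerSeries.coeff_succ_mul_X, PowerSeries.coeff_mk, multichoose_succ_add]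
      ring

/-- Vandermonde convolution. -/
theorem sum_multichoose_mul (x y k : ℕ) :
    ∑ p ∈ Finset.HasAntidiagonal.antidiagonal k, (x.multichoose p.1 : ℤ) * y.multichoose p.2 =
      (x + y).multichoose k := by
  have h : (PowerSeries.mk fun a => (x.multichoose a : ℤ)) *
      (PowerSeries.mk fun a => (y.multichoose a : ℤ)) =
      PowerSeries.mk fun a => ((x + y).multichoose a : ℤ) := by
    have h0 : (1 - PowerSeries.X : PowerSeries ℤ) ^ (x + y) ≠ 0 := fun h => by
      have := mk_multichoose_mul_pow (x + y)
      rw [h, mul_zero] at this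
      exact zero_ne_one this
    refine mul_right_cancel₀ h0 ?_
    rw [mk_multichoose_mul_pow, pow_add, mul_mul_mul_comm, mk_multichoose_mul_pow,
      mk_multichoose_mul_pow, one_mul]
  have h1 := congrArg (PowerSeries.coeff k) h
  simpa only [PowerSeries.coeff_mul, PowerSeries.coeff_mk] using h1

/-! ### Reorganisation of the sums -/

/-- The weight `1 - (M + d) % 2` is the indicator of d ≡ M modulo 2, written so that parity terms
can later cancel linearly. -/
theorem sum_range_parity (F : ℤ → ℤ) (M : ℕ) : ∑ s ∈ Finset.range (M + 1), F (2 * s - M) =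
    ∑ d ∈ Finset.Icc (-M : ℤ) M, (1 - (M + d) % 2) * F d := by
  have h1 : ∀ d ∈ Finset.Icc (-M : ℤ) M, (1 - (M + d) % 2) * F d =
      if (M + d) % 2 = 0 then F d else 0 := by
    intro d _
    split_ifs with h
    · rw [h]; ring
    · rw [show (M + d) % 2 = 1 by omega]; ring
  rw [Finset.sum_congr rfl h1, ← Finset.sum_filter]
  refine Finset.sum_nbij' (fun s => 2 * (s : ℤ) - M) (fun d => ((M + d) / 2).toNat) ?_ ?_ ?_ ?_ ?_
  all_goals simp only [Finset.mem_range, Finset.mem_filter, Finset.mem_Icc,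
    implies_true]
  · intro s hs; omega
  · intro d hd; omega
  · intro s hs; omega
  · intro d hd; omega

/-- A given d occurs once for each k < M with |d| ≤ k and k ≡ d modulo 2; the weight on the right is
twice the number of these k. -/
theorem sum_sum_range_parity (F : ℤ → ℤ) (M : ℕ) :
    2 * ∑ k ∈ Finset.range M, ∑ s ∈ Finset.range (k + 1), F (2 * s - k) =
      ∑ d ∈ Finset.Icc (-M : ℤ) M, (M - |d| + (M + d) % 2) * F d := by
  induction M with
  | zero => simp
  | succ M ih =>
    have h1 : ∑ d ∈ Finset.Icc (-(M + 1 : ℕ) : ℤ) (M + 1 : ℕ),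
        ((M + 1 : ℕ) - |d| + ((M + 1 : ℕ) + d) % 2) * F d =
        ∑ d ∈ Finset.Icc (-M : ℤ) M, ((M + 1 : ℕ) - |d| + ((M + 1 : ℕ) + d) % 2) * F d := by
      refine (Finset.sum_subset (fun d hd => ?_) fun d hd hd' => ?_).symm
      · rw [Finset.mem_Icc] at hd ⊢
        omega
      · rw [Finset.mem_Icc] at hd hd'
        have : d = -(M + 1 : ℕ) ∨ d = (M + 1 : ℕ) := by omega
        rcases this with rfl | rfl
        · rw [abs_neg, abs_of_nonneg (by omega)]
          simp
        · rw [abs_of_nonneg (by omega), show (((M + 1 : ℕ) : ℤ) + (M + 1 : ℕ)) % 2 = 0 by omega]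
          simp
    rw [Finset.sum_range_succ, mul_add, ih, h1, sum_range_parity, Finset.mul_sum,
      ← Finset.sum_add_distrib]
    refine Finset.sum_congr rfl fun d _ => ?_
    rw [show (((M + 1 : ℕ) : ℤ) + d) % 2 = 1 - (M + d) % 2 by omega]
    push_cast
    ring

theorem sum_Icc_eq_antidiagonal (f : ℕ → ℕ → ℤ) (M : ℕ) :
    ∑ d ∈ Finset.Icc (-M : ℤ) M, f (M + d).toNat (M - d).toNat =
      ∑ p ∈ Finset.HasAntidiagonal.antidiagonal (2 * M), f p.1 p.2 := by
  refine Finset.sum_nbij' (fun d => ((M + d).toNat, (M - d).toNat)) (fun p => (p.1 : ℤ) - M)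
    ?_ ?_ ?_ ?_ ?_
  all_goals simp only [Finset.HasAntidiagonal.mem_antidiagonal, Finset.mem_Icc,
    Prod.ext_iff, implies_true]
  · intro d hd; omega
  · intro p hp; omega
  · intro d hd; omega
  · intro p hp; omega

theorem sum_abs_mul (f : ℕ → ℤ) (M : ℕ) :
    ∑ d ∈ Finset.Icc (-M : ℤ) M, |d| * (f (M + d).toNat * f (M - d).toNat) =
      ∑ i ∈ Finset.range M, (2 * M - 2 * i : ℤ) * (f i * f (2 * M - i)) := by
  have h1 : Finset.Icc (-M : ℤ) M = Finset.Ico (-M : ℤ) 0 ∪ ({0} ∪ Finset.Ioc (0 : ℤ) M) := by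
    ext d
    simp only [Finset.mem_Icc, Finset.mem_union, Finset.mem_Ico, Finset.mem_singleton,
      Finset.mem_Ioc]
    omega
  have h2 : ∑ d ∈ Finset.Ico (-M : ℤ) 0, |d| * (f (M + d).toNat * f (M - d).toNat) =
      ∑ i ∈ Finset.range M, (M - i : ℤ) * (f i * f (2 * M - i)) := by
    refine Finset.sum_nbij' (fun d => (M + d).toNat) (fun i => (i : ℤ) - M) ?_ ?_ ?_ ?_ ?_
    all_goals simp only [Finset.mem_range, Finset.mem_Ico]
    · intro d hd; omega
    · intro p hp; omega
    · intro d hd; omega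
    · intro p hp; omega
    · intro d hd
      rw [abs_of_neg hd.2, show (M - d).toNat = 2 * M - (M + d).toNat by omega]
      congr 1
      omega
  have h3 : ∑ d ∈ Finset.Ioc (0 : ℤ) M, |d| * (f (M + d).toNat * f (M - d).toNat) =
      ∑ i ∈ Finset.range M, (M - i : ℤ) * (f i * f (2 * M - i)) := by
    refine Finset.sum_nbij' (fun d => (M - d).toNat) (fun i => M - (i : ℤ)) ?_ ?_ ?_ ?_ ?_
    all_goals simp only [Finset.mem_range, Finset.mem_Ioc]
    · intro d hd; omega
    · intro p hp; omega
    · intro d hd; omega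
    · intro p hp; omega
    · intro d hd
      rw [abs_of_pos hd.1, show (M + d).toNat = 2 * M - (M - d).toNat by omega, mul_comm (f _)]
      congr 1
      omega
  rw [h1, Finset.sum_union, Finset.sum_union, h2, h3, Finset.sum_singleton, abs_zero, zero_mul,
    zero_add, ← Finset.sum_add_distrib]
  · refine Finset.sum_congr rfl fun i _ => ?_
    ring
  · rw [Finset.disjoint_left]
    intro d h1 h2
    rw [Finset.mem_singleton] at h1
    rw [Finset.mem_Ioc] at h2
    omega
  · rw [Finset.disjoint_left]
    intro d h1 h2
    rw [Finset.mem_union, Finset.mem_singleton, Finset.mem_Ioc] at h2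
    rw [Finset.mem_Ico] at h1
    omega

theorem sum_antidiagonal_odd (f : ℕ → ℕ → ℤ) (K : ℕ) :
    ∑ p ∈ Finset.HasAntidiagonal.antidiagonal (2 * K + 1), f p.1 p.2 =
      ∑ p ∈ Finset.HasAntidiagonal.antidiagonal K,
        (f (2 * p.1) (2 * p.2 + 1) + f (2 * p.1 + 1) (2 * p.2)) := by
  have h : ∀ (u : ℕ → ℤ) (n : ℕ), ∑ i ∈ Finset.range (2 * n), u i =
      ∑ p ∈ Finset.range n, (u (2 * p) + u (2 * p + 1)) := by
    intro u n
    induction n with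
    | zero => simp
    | succ n ih =>
      rw [mul_add, mul_one, Finset.sum_range_succ, Finset.sum_range_succ, ih,
        Finset.sum_range_succ _ n]
      ring
  rw [Finset.Nat.sum_antidiagonal_eq_sum_range_succ_mk,
    Finset.Nat.sum_antidiagonal_eq_sum_range_succ_mk, show (2 * K + 1).succ = 2 * (K + 1) by omega, h]
  refine Finset.sum_congr rfl fun p hp => ?_
  rw [Finset.mem_range] at hp
  simp only
  rw [show 2 * K + 1 - 2 * p = 2 * (K - p) + 1 by omega,
    show 2 * K + 1 - (2 * p + 1) = 2 * (K - p) by omega]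

/-- Even and odd sections of a series and of its differences. -/
theorem sum_even_sections {g ψ : ℕ → ℤ} (h0 : ψ 0 = g 0) (h : ∀ a, g (a + 1) = g a + ψ (a + 1))
    (K : ℕ) :
    ∑ p ∈ Finset.HasAntidiagonal.antidiagonal (K + 1), g (2 * p.1) * g (2 * p.2) -
      ∑ p ∈ Finset.HasAntidiagonal.antidiagonal K, g (2 * p.1) * g (2 * p.2) -
      ∑ p ∈ Finset.HasAntidiagonal.antidiagonal (K + 1), ψ (2 * p.1) * ψ (2 * p.2) =
      ∑ p ∈ Finset.HasAntidiagonal.antidiagonal (2 * K + 1), g p.1 * ψ p.2 := by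
  set Ge : PowerSeries ℤ := PowerSeries.mk fun p => g (2 * p)
  set Go : PowerSeries ℤ := PowerSeries.mk fun p => g (2 * p + 1)
  -- Even and odd sections turn the recurrence into ψ_even = Ge - X Go and ψ_odd = Go - Ge, after
  -- which the claim is a ring identity.
  have he : (PowerSeries.mk fun p => ψ (2 * p) : PowerSeries ℤ) = Ge - PowerSeries.X * Go := by
    ext p
    cases p with
    | zero => simp [Ge, h0]
    | succ p =>
      rw [map_sub, PowerSeries.coeff_succ_X_mul, PowerSeries.coeff_mk, PowerSeries.coeff_mk,
        PowerSeries.coeff_mk, mul_add, mul_one]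
      linarith [h (2 * p + 1)]
  have ho : (PowerSeries.mk fun p => ψ (2 * p + 1) : PowerSeries ℤ) = Go - Ge := by
    ext p
    rw [map_sub, PowerSeries.coeff_mk, PowerSeries.coeff_mk, PowerSeries.coeff_mk]
    linarith [h (2 * p)]
  have h1 := congrArg (PowerSeries.coeff (K + 1)) (show Ge * Ge - PowerSeries.X * (Ge * Ge) -
    (PowerSeries.mk fun p => ψ (2 * p)) * (PowerSeries.mk fun p => ψ (2 * p)) =
    PowerSeries.X * (Ge * (PowerSeries.mk fun p => ψ (2 * p + 1)) +
      Go * PowerSeries.mk fun p => ψ (2 * p)) by rw [he, ho]; ring)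
  rw [map_sub, map_sub, PowerSeries.coeff_succ_X_mul, PowerSeries.coeff_succ_X_mul, map_add] at h1
  simp only [PowerSeries.coeff_mul, PowerSeries.coeff_mk, Ge, Go] at h1
  rw [h1, sum_antidiagonal_odd (fun a b => g a * ψ b), Finset.sum_add_distrib]

end Multichoose

/-- The number of convex polygons of width `M + 1` and height `n`, as a function of `n ≥ 1`. -/
theorem ncard_frames_eq {M : ℕ} (ν : ℕ) :
    (({f : Fin (M + 1) → ℤ × ℤ | IsFrame (ν + 1 : ℕ) f}.ncard : ℕ) : ℤ) =
      (M + 1) * (2 * ν).multichoose (2 * M) +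
        (if M = 0 then 0 else ((2 * ν + 1).multichoose (2 * M - 1) : ℤ)) -
        2 * (M * ((ν + 1).multichoose M * ν.multichoose M)) := by
  rw [ncard_frames (by omega)]
  have hg : ∀ a, mchains (ν + 1 : ℕ) a = (ν + 1).multichoose a := fun a => rfl
  have hψ : ∀ a, mchains ((ν + 1 : ℕ) - 1) a = ν.multichoose a := fun a => by
    rw [mchains]
    congr 2
    omega
  simp only [hg, hψ]
  set g : ℕ → ℤ := fun a => (ν + 1).multichoose a with hgdef
  set ψ : ℕ → ℤ := fun a => ν.multichoose a with hψdef
  set F : ℤ → ℤ := fun d => ψ (M + d).toNat * ψ (M - d).toNat with hF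
  -- With k = M - 1 - i the two indices are M + d and M - d for d = 2 s - k; this symmetric form
  -- allows the sums over ψ to be combined.
  have hT1 : ∑ i ∈ Finset.range M, ∑ x ∈ Finset.HasAntidiagonal.antidiagonal (M - 1 - i),
      ψ (2 * x.2 + i + 1) * ψ (2 * x.1 + i + 1) =
      ∑ k ∈ Finset.range M, ∑ s ∈ Finset.range (k + 1), F (2 * s - k) := by
    rw [← Finset.sum_range_reflect]
    refine Finset.sum_congr rfl fun k hk => ?_
    rw [Finset.mem_range] at hk
    rw [show M - 1 - (M - 1 - k) = k by omega, Finset.Nat.sum_antidiagonal_eq_sum_range_succ_mk]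
    refine Finset.sum_congr rfl fun s hs => ?_
    rw [Finset.mem_range] at hs
    simp only [hF]
    rw [mul_comm]
    congr 2 <;> omega
  have hT2 : ∑ i ∈ Finset.range M, ∑ x ∈ Finset.HasAntidiagonal.antidiagonal (M - 1 - i),
      2 * (ψ i * ψ (2 * x.1 + 2 * x.2 + i + 2)) =
      ∑ i ∈ Finset.range M, (2 * M - 2 * i : ℤ) * (ψ i * ψ (2 * M - i)) := by
    refine Finset.sum_congr rfl fun i hi => ?_
    rw [Finset.mem_range] at hi
    have h1 : ∀ x ∈ Finset.HasAntidiagonal.antidiagonal (M - 1 - i),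
        2 * (ψ i * ψ (2 * x.1 + 2 * x.2 + i + 2)) = 2 * (ψ i * ψ (2 * M - i)) := by
      intro x hx
      rw [Finset.HasAntidiagonal.mem_antidiagonal] at hx
      rw [show 2 * x.1 + 2 * x.2 + i + 2 = 2 * M - i by omega]
    rw [Finset.sum_congr rfl h1, Finset.sum_const, Finset.Nat.card_antidiagonal,
      show M - 1 - i + 1 = M - i by omega, nsmul_eq_mul, Nat.cast_sub hi.le]
    ring
  have hE : ∑ p ∈ Finset.HasAntidiagonal.antidiagonal M, ψ (2 * p.1) * ψ (2 * p.2) =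
      ∑ d ∈ Finset.Icc (-M : ℤ) M, (1 - (M + d) % 2) * F d := by
    rw [← sum_range_parity, Finset.Nat.sum_antidiagonal_eq_sum_range_succ_mk]
    refine Finset.sum_congr rfl fun s hs => ?_
    rw [Finset.mem_range] at hs
    simp only [hF]
    congr 2 <;> omega
  have hB1 : ∑ p ∈ Finset.range (M + 1), g (2 * (M - p)) * g (2 * p) =
      ∑ p ∈ Finset.HasAntidiagonal.antidiagonal M, g (2 * p.1) * g (2 * p.2) := by
    rw [Finset.Nat.sum_antidiagonal_eq_sum_range_succ_mk]
    exact Finset.sum_congr rfl fun _ _ => mul_comm _ _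
  have hW : ∑ p ∈ Finset.range (M + 1), g (2 * (M - p)) * g (2 * p) -
      ∑ p ∈ Finset.range M, g (2 * (M - (p + 1))) * g (2 * p) -
      ∑ p ∈ Finset.HasAntidiagonal.antidiagonal M, ψ (2 * p.1) * ψ (2 * p.2) =
      if M = 0 then 0 else ((2 * ν + 1).multichoose (2 * M - 1) : ℤ) := by
    cases M with
    | zero => simp [hgdef, hψdef]
    | succ K =>
      have hB2 : ∑ p ∈ Finset.range (K + 1), g (2 * (K + 1 - (p + 1))) * g (2 * p) =
          ∑ p ∈ Finset.HasAntidiagonal.antidiagonal K, g (2 * p.1) * g (2 * p.2) := by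
        rw [Finset.Nat.sum_antidiagonal_eq_sum_range_succ_mk]
        refine Finset.sum_congr rfl fun p _ => ?_
        rw [mul_comm, Nat.add_sub_add_right]
      rw [hB1, hB2, sum_even_sections (by simp [hgdef, hψdef]) (multichoose_succ_add ν),
        if_neg (by omega), show 2 * (K + 1) - 1 = 2 * K + 1 by omega,
        show 2 * ν + 1 = ν + 1 + ν by ring, ← sum_multichoose_mul]
  have hS : ∑ d ∈ Finset.Icc (-M : ℤ) M, F d = (2 * ν).multichoose (2 * M) := by
    rw [two_mul ν, ← sum_multichoose_mul,
      ← sum_Icc_eq_antidiagonal fun a b => (ν.multichoose a : ℤ) * ν.multichoose b]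
  have hA : ∑ d ∈ Finset.Icc (-M : ℤ) M, |d| * F d =
      M * ((ν + 1).multichoose M * ν.multichoose M) := by
    rw [sum_abs_mul ψ, sum_sub_mul_multichoose ν M M (by omega), show 2 * M - M = M by omega]
    ring
  -- The parity terms cancel, and the weights add up to M + 1 - 2 |d|.
  have hcomb : ∑ d ∈ Finset.Icc (-M : ℤ) M, (M - |d| + (M + d) % 2) * F d -
      ∑ d ∈ Finset.Icc (-M : ℤ) M, |d| * F d +
      ∑ d ∈ Finset.Icc (-M : ℤ) M, (1 - (M + d) % 2) * F d =
      (M + 1) * ∑ d ∈ Finset.Icc (-M : ℤ) M, F d -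
        2 * ∑ d ∈ Finset.Icc (-M : ℤ) M, |d| * F d := by
    rw [Finset.mul_sum, Finset.mul_sum, ← Finset.sum_sub_distrib, ← Finset.sum_sub_distrib,
      ← Finset.sum_add_distrib]
    refine Finset.sum_congr rfl fun d _ => ?_
    ring
  rw [← sum_sum_range_parity, ← hT1, ← hE, hS, hA] at hcomb
  have hT2' := hT2
  rw [← sum_abs_mul ψ, hA] at hT2'
  simp only [← Finset.mul_sum] at hT2'
  simp only [Finset.sum_sub_distrib, ← Finset.mul_sum]
  simp only [hgdef, hψdef] at hcomb hT2' hW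
  linarith

end Polyomino
end

noncomputable section

namespace Polyomino

/-! ### Rising factorials divided by factorials -/

/-- The polynomial `x (x + 1) ⋯ (x + a - 1) / a!`. -/
def risingChoose (a : ℕ) : Polynomial ℝ :=
  Polynomial.C ((a.factorial : ℝ)⁻¹) * ascPochhammer ℝ a

theorem risingChoose_eval (a : ℕ) (x : ℝ) :
    (risingChoose a).eval x = (a.factorial : ℝ)⁻¹ * (ascPochhammer ℝ a).eval x := by
  rw [risingChoose, Polynomial.eval_C_mul]

theorem risingChoose_eval_natCast (a n : ℕ) :
    (risingChoose a).eval (n : ℝ) = n.multichoose a := by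
  rw [risingChoose_eval, ascPochhammer_nat_eq_natCast_ascFactorial,
    inv_mul_eq_iff_eq_mul₀ (by positivity), Nat.ascFactorial_eq_factorial_mul_choose',
    Nat.multichoose_eq]
  push_cast
  rfl

/-- Reciprocity for binomial coefficients, the source of the symmetries of the counting polynomials.
-/
theorem risingChoose_eval_neg (a : ℕ) (x : ℝ) :
    (risingChoose a).eval (-x) = (-1) ^ a * (risingChoose a).eval (x - a + 1) := by
  rw [risingChoose_eval, risingChoose_eval, ascPochhammer_eval_neg_eq_descPochhammer,
    descPochhammer_eval_eq_ascPochhammer]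
  ring

theorem risingChoose_eval_neg_natCast {a n : ℕ} (h : n < a) :
    (risingChoose a).eval (-(n : ℝ)) = 0 := by
  rw [risingChoose_eval, ascPochhammer_eval_neg_coe_nat_of_lt h, mul_zero]

theorem risingChoose_eval_intCast {a : ℕ} {n : ℤ} (h : n ≤ 0) (h' : -n < a) :
    (risingChoose a).eval (n : ℝ) = 0 := by
  obtain ⟨m, hm⟩ := Int.eq_ofNat_of_zero_le (neg_nonneg.2 h)
  have h2 : (n : ℝ) = -(m : ℝ) := by
    rw [← neg_eq_iff_eq_neg]; exact_mod_cast hm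
  rw [h2]
  exact risingChoose_eval_neg_natCast (by omega)

theorem risingChoose_succ_sub (a : ℕ) (x : ℝ) :
    (risingChoose (a + 1)).eval x - (risingChoose (a + 1)).eval (x - 1) =
      (risingChoose a).eval x := by
  have h1 : (ascPochhammer ℝ (a + 1)).eval x = (ascPochhammer ℝ a).eval x * (x + a) := by
    rw [ascPochhammer_succ_eval]
  have h2 : (ascPochhammer ℝ (a + 1)).eval (x - 1) = (x - 1) * (ascPochhammer ℝ a).eval x := by
    rw [ascPochhammer_succ_left, Polynomial.eval_mul, Polynomial.eval_X, Polynomial.eval_comp]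
    simp
  rw [risingChoose_eval, risingChoose_eval, risingChoose_eval, h1, h2, Nat.factorial_succ]
  push_cast
  have : (a.factorial : ℝ) ≠ 0 := by positivity
  field_simp
  ring

theorem risingChoose_one_eval (x : ℝ) : (risingChoose 1).eval x = x := by
  simp [risingChoose]

/-! ### Polynomial sequences as series in one variable -/

-- The backward difference lowers the degree. On series over all integers it is multiplication by 1
-- - y.
open Polynomial in
theorem polynomial_difference_induction {C : ℝ[X] → Prop} (h0 : C 0)
    (h : ∀ P, C (P - taylor (-1) P) → C P) (P : ℝ[X]) : C P := by
  induction hn : P.degree using WellFoundedLT.induction generalizing P with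
  | ind n ih =>
    subst hn
    by_cases hP : P = 0
    · rwa [hP]
    · refine h P (ih _ ?_ _ rfl)
      exact degree_sub_lt_left (degree_taylor P _).symm hP (leadingCoeff_taylor (r := -1) P).symm

/-- The series `∑_w P(w) y^w` over all integers `w`. -/
def fullLine (P : Polynomial ℝ) : Series 1 := fun w => P.eval (w 0 : ℝ)

/-- The series `∑_{w ≥ 1} P(w) y^w`. -/
def halfLine (P : Polynomial ℝ) : Series 1 := fun w => if 1 ≤ w 0 then P.eval (w 0 : ℝ) else 0

theorem halfLine_apply (P : Polynomial ℝ) {w : Fin 1 → ℤ} {n : ℤ} (h : w 0 = n) :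
    halfLine P w = if 1 ≤ n then P.eval (n : ℝ) else 0 := by
  subst h
  rfl

theorem vecOne_ne_zero : (![1] : Fin 1 → ℤ) ≠ 0 := fun h => by simpa using congrFun h 0

theorem vecOne_eq_iff {v : ℤ} {w : Fin 1 → ℤ} : ![v] = w ↔ w 0 = v := by
  rw [funext_iff]
  simp [eq_comm]

/-- Multiplication by 1 - y replaces P by its backward difference, so by induction the product has
value 0, and 1 - y can be divided out. -/
theorem hasVal_fullLine (P : Polynomial ℝ) : HasVal (fullLine P) 0 := by
  induction P using polynomial_difference_induction with
  | h0 =>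
    convert HasVal.zero using 1
    ext w
    simp [fullLine]
  | h P ih =>
    have h := HasVal.of_act (s := fullLine P) (R := 0) (one_sub_single_ne_zero vecOne_ne_zero) (by
      convert ih using 1
      ext w
      rw [act_sub, act_one, Pi.sub_apply, act_single]
      simp [fullLine, Polynomial.taylor_eval, sub_eq_add_neg])
    rwa [zero_div] at h

theorem halfLine_taylor (P : Polynomial ℝ) : halfLine (Polynomial.taylor (-1) P) =
    act (AddMonoidAlgebra.single ![1] 1) (halfLine P) +
      toSeries (AddMonoidAlgebra.single ![1] (P.eval 0)) := by
  ext w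
  rw [Pi.add_apply, act_single, halfLine_apply P (n := w 0 - 1) rfl, halfLine_apply _ (w := w) rfl,
    Polynomial.taylor_eval]
  simp only [toSeries, AddMonoidAlgebra.coeff_single, Finsupp.single_apply, vecOne_eq_iff]
  rcases lt_trichotomy (w 0) 1 with h | h | h
  · rw [if_neg (by omega), if_neg (by omega), if_neg (by omega)]
    ring
  · rw [if_pos (by omega), if_neg (by omega), if_pos h, h]
    simp
  · rw [if_pos (by omega), if_pos (by omega), if_neg (by omega)]
    push_cast
    rw [one_mul, add_zero, sub_eq_add_neg]

/-- Multiplication by 1 - y again gives the backward difference, up to the boundary term P(0) y. -/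
theorem exists_hasVal_halfLine (P : Polynomial ℝ) : ∃ R, HasVal (halfLine P) R := by
  induction P using polynomial_difference_induction with
  | h0 =>
    refine ⟨0, ?_⟩
    convert HasVal.zero using 1
    ext w
    simp [halfLine]
  | h P ih =>
    obtain ⟨R, hR⟩ := ih
    refine ⟨_, HasVal.of_act (one_sub_single_ne_zero vecOne_ne_zero) (R := R +
      algebraMap (Laurent 1) _ (AddMonoidAlgebra.single ![1] (P.eval 0))) ?_⟩
    convert hR.add (hasVal_toSeries (AddMonoidAlgebra.single ![1] (P.eval 0))) using 1
    have h : halfLine (P - Polynomial.taylor (-1) P) =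
        halfLine P - halfLine (Polynomial.taylor (-1) P) := by
      ext w
      simp only [halfLine, Pi.sub_apply, Polynomial.eval_sub]
      split_ifs
      · rfl
      · rw [sub_zero]
    rw [act_sub, act_one, h, halfLine_taylor]
    abel

theorem HasVal.halfLine_taylor {P : Polynomial ℝ} {R : RatFun 1} (h : HasVal (halfLine P) R) :
    HasVal (halfLine (Polynomial.taylor (-1) P))
      (monom ![1] * (R + algebraMap ℝ (RatFun 1) (P.eval 0))) := by
  rw [Polyomino.halfLine_taylor]
  convert (h.act (AddMonoidAlgebra.single ![1] 1)).add
    (hasVal_toSeries (AddMonoidAlgebra.single ![1] (P.eval 0))) using 1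
  rw [mul_add, IsScalarTower.algebraMap_apply ℝ (Laurent 1) (RatFun 1), monom, ← map_mul,
    show algebraMap ℝ (Laurent 1) (P.eval 0) = AddMonoidAlgebra.single 0 (P.eval 0) from rfl,
    AddMonoidAlgebra.single_mul_single, add_zero, one_mul]

/-- The sum over all integers has value 0, so the sum over w ≤ 0 has minus the value of the sum over
w ≥ 1. Reflecting the exponents and translating by v turns the former into a series that starts at
v. -/
theorem HasVal.halfLine_reflect {P : Polynomial ℝ} {R : RatFun 1} (h : HasVal (halfLine P) R)
    (v : ℤ) : HasVal (fun w => if v ≤ w 0 then P.eval ((v : ℝ) - w 0) else 0)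
      (-(monom ![v] * invVars 1 R)) := by
  have h1 := (((hasVal_fullLine P).sub h).inv).shift ![v]
  rw [zero_sub, map_neg, mul_neg] at h1
  convert h1 using 1
  ext w
  have h3 : (-(w - ![v])) 0 = v - w 0 := neg_sub _ _
  rw [Pi.sub_apply, halfLine_apply P h3, fullLine, h3]
  by_cases h2 : v ≤ w 0
  · rw [if_pos h2, if_neg (by omega), sub_zero, Int.cast_sub]
  · rw [if_neg h2, if_pos (by omega), sub_self]

/-- The zeros of P from v to 0 remove the terms of the reflected series with exponents from v to 0,
so that it effectively starts at 1. -/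
theorem HasVal.halfLine_comp {P Q : Polynomial ℝ} {R : RatFun 1} (h : HasVal (halfLine P) R)
    {v : ℤ} (hv : v ≤ 1) (h0 : ∀ n : ℤ, v ≤ n → n ≤ 0 → P.eval (n : ℝ) = 0)
    (hQ : ∀ n : ℤ, 1 ≤ n → Q.eval (n : ℝ) = P.eval ((v : ℝ) - n)) :
    HasVal (halfLine Q) (-(monom ![v] * invVars 1 R)) := by
  convert h.halfLine_reflect v using 1
  ext w
  simp only [halfLine]
  split_ifs with h1 h2 h2
  · exact hQ _ h1
  · omega
  · rw [← Int.cast_sub, h0 _ (by omega) (by omega)]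
  · rfl

end Polyomino
end

/-! ### Directed convex polygons: inversion from the counting polynomial. -/

noncomputable section

namespace Polyomino

open ColumnConvexPolygon

variable {M : ℕ}

theorem countSeries_eq_halfLine {S : Set (ColumnConvexPolygon (M + 1))} {P : Polynomial ℝ}
    (h : ∀ n : ℤ, 1 ≤ n → ({p | p ∈ S ∧ p.halfVertical = n}.ncard : ℝ) = P.eval (n : ℝ)) :
    countSeries S (perimOnly (M + 1)) = halfLine P := by
  ext w
  simp only [countSeries, perimOnly, vecOne_eq_iff, halfLine, eq_comm (a := w 0)]
  split_ifs with h1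
  · exact h _ h1
  · rw [Nat.cast_eq_zero, Set.ncard_eq_zero (finite_halfVertical S _)]
    refine Set.eq_empty_of_forall_notMem fun p hp => h1 ?_
    have h2 := colTop_le_halfVertical p 0
    have h3 := p.colBot_lt 0
    rw [p.colBot_zero] at h3
    rw [hp.2] at h2
    omega

theorem directedConvex_inversion : ∃ H : ℕ → RatFun 1, IsWidthGF directedConvex perimOnly H ∧
    (∀ m : ℕ, 1 ≤ m → invVars 1 (H m) = -(monom ![(m : ℤ) - 2] * H m)) ∧
    PowerSeries.mk H + cst ![2] * inverted (monom ![-1]) (PowerSeries.mk H) = 0 := by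
  obtain ⟨H, hH, h0, h⟩ := exists_isWidthGF (F := directedConvex) (f := perimOnly)
    (Q := fun m R => invVars 1 R = -(monom ![(m : ℤ) - 2] * R)) (fun M => by
      -- The counting polynomial P satisfies P(1 - M - x) = P(x) and vanishes at 1 - M, ..., 0, as
      -- `HasVal.halfLine_comp` requires.
      obtain ⟨R, hR⟩ := exists_hasVal_halfLine (risingChoose M ^ 2)
      refine ⟨R, (isRationalGF_iff _ _ _).2 ⟨finite_perimOnly _, ?_⟩, ?_⟩
      · rw [countSeries_eq_halfLine (P := risingChoose M ^ 2)]
        · exact hR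
        · intro n hn
          have h1 := ncard_directed_frames (M := M) hn
          rw [← ncard_directedConvex_eq, mchains] at h1
          obtain ⟨ν, rfl⟩ := Int.eq_ofNat_of_zero_le (by omega : 0 ≤ n)
          rw [Int.toNat_natCast] at h1
          rw [Int.cast_natCast, Polynomial.eval_pow, risingChoose_eval_natCast]
          exact_mod_cast h1
      · have h1 := hR.halfLine_comp (v := 1 - M) (Q := risingChoose M ^ 2) (by omega)
          (fun n hn hn' => by
            rw [Polynomial.eval_pow, risingChoose_eval_intCast hn' (by omega)]
            simp)
          (fun n _ => by
            rw [Polynomial.eval_pow, Polynomial.eval_pow,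
              show (((1 - M : ℤ) : ℝ) - n) = -((n : ℝ) + M - 1) by push_cast; ring,
              risingChoose_eval_neg, mul_pow, ← pow_mul, mul_comm M, pow_mul, neg_one_sq, one_pow,
              one_mul]
            congr 2
            ring)
        have h2 := hR.unique h1
        have h3 : (monom ![((M + 1 : ℕ) : ℤ) - 2] * monom ![1 - (M : ℤ)] : RatFun 1) = 1 := by
          rw [← monom_add, ← monom_zero]
          congr 1
          ext i; fin_cases i; simp; ring
        linear_combination (monom ![((M + 1 : ℕ) : ℤ) - 2] : RatFun 1) * h2 -
          invVars 1 R * h3)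
  refine ⟨H, hH, h, add_inverted_eq_zero h0 (fun m _ => ?_) h⟩
  ext i; fin_cases i; simp; ring

end Polyomino
end

/-! ### Convex polygons: the counting polynomial and its defect of symmetry. -/

noncomputable section

namespace Polyomino

open ColumnConvexPolygon Polynomial

variable {M : ℕ}

theorem eval_comp_linear (P : ℝ[X]) (a b x : ℝ) :
    (P.comp (C a * X + C b)).eval x = P.eval (a * x + b) := by
  simp [eval_comp]

/-- The number of convex polygons of width `M + 1` with half vertical perimeter `x ≥ 1`. -/
def convexCount (M : ℕ) : ℝ[X] :=
  C ((M : ℝ) + 1) * (risingChoose (2 * M)).comp (C 2 * X + C (-2)) +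
    (if M = 0 then 0 else (risingChoose (2 * M - 1)).comp (C 2 * X + C (-1))) -
    C (2 * (M : ℝ)) * (risingChoose M * (risingChoose M).comp (C 1 * X + C (-1)))

theorem convexCount_zero : convexCount 0 = 1 := by
  simp [convexCount, risingChoose]

theorem convexCount_eval (hM : M ≠ 0) (x : ℝ) : (convexCount M).eval x =
    (M + 1) * (risingChoose (2 * M)).eval (2 * x - 2) + (risingChoose (2 * M - 1)).eval (2 * x - 1) -
      2 * M * ((risingChoose M).eval x * (risingChoose M).eval (x - 1)) := by
  simp only [convexCount, if_neg hM, eval_sub, eval_add, eval_mul, eval_C, eval_comp_linear,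
    one_mul, ← sub_eq_add_neg]

theorem ncard_convex_halfVertical {n : ℤ} (hn : 1 ≤ n) :
    ({P | P ∈ convexPolygons (M + 1) ∧ P.halfVertical = n}.ncard : ℝ) =
      (convexCount M).eval (n : ℝ) := by
  obtain ⟨ν, rfl⟩ : ∃ ν : ℕ, n = (ν + 1 : ℕ) := ⟨(n - 1).toNat, by omega⟩
  rw [ncard_convex_eq]
  have h := congrArg (Int.cast (R := ℝ)) (ncard_frames_eq (M := M) ν)
  rcases Nat.eq_zero_or_pos M with rfl | hM
  · simpa [convexCount_zero] using h
  · rw [Int.cast_natCast] at h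
    rw [h, if_neg hM.ne', convexCount_eval hM.ne',
      show (2 * (((ν + 1 : ℕ) : ℤ) : ℝ) - 2) = (2 * ν : ℕ) by push_cast; ring,
      show (2 * (((ν + 1 : ℕ) : ℤ) : ℝ) - 1) = (2 * ν + 1 : ℕ) by push_cast; ring,
      show ((((ν + 1 : ℕ) : ℤ) : ℝ) - 1) = (ν : ℕ) by push_cast; ring,
      Int.cast_natCast, risingChoose_eval_natCast, risingChoose_eval_natCast,
      risingChoose_eval_natCast, risingChoose_eval_natCast]
    push_cast
    ring

/-- The values at odd integers of an odd `risingChoose`. -/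
def oddCount (i : ℕ) : ℝ[X] := (risingChoose (2 * i + 1)).comp (C 2 * X + C (-1))

theorem oddCount_eval (i : ℕ) (x : ℝ) :
    (oddCount i).eval x = (risingChoose (2 * i + 1)).eval (2 * x - 1) := by
  rw [oddCount, eval_comp_linear, ← sub_eq_add_neg]

theorem oddCount_eval_intCast {i : ℕ} {n : ℤ} (h : n ≤ 0) (h' : -n < i) :
    (oddCount i).eval (n : ℝ) = 0 := by
  rw [oddCount_eval, show 2 * (n : ℝ) - 1 = ((2 * n - 1 : ℤ) : ℝ) by push_cast; ring]
  exact risingChoose_eval_intCast (by omega) (by push_cast; omega)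

/-- Reflection replaces 2 x - 2 by 2 x - 1 in the first term, which by Pascal's rule adds i + 2
copies of `oddCount i`; it changes the sign of the second term, which costs two copies, and
preserves the product. The i copies that remain are the origin of the derivative in the relation for
convex polygons. -/
theorem convexCount_reflect (i : ℕ) (x : ℝ) : (convexCount (i + 1)).eval (1 - i - x) =
    (convexCount (i + 1)).eval x + i * (oddCount i).eval x := by
  have h1 : (risingChoose (2 * (i + 1))).eval (2 * (1 - i - x) - 2) =
      (risingChoose (2 * (i + 1))).eval (2 * x - 1) := by
    rw [show 2 * (1 - i - x) - 2 = -(2 * x + 2 * i) by ring, risingChoose_eval_neg, pow_mul,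
      neg_one_sq, one_pow, one_mul]
    congr 1
    push_cast
    ring
  have h2 : (risingChoose (2 * i + 1)).eval (2 * (1 - i - x) - 1) =
      -(risingChoose (2 * i + 1)).eval (2 * x - 1) := by
    rw [show 2 * (1 - i - x) - 1 = -(2 * x + 2 * i - 1) by ring, risingChoose_eval_neg, pow_succ,
      pow_mul, neg_one_sq, one_pow, one_mul, neg_one_mul]
    congr 2
    push_cast
    ring
  have h3 : (risingChoose (i + 1)).eval (1 - i - x) * (risingChoose (i + 1)).eval (1 - i - x - 1) =
      (risingChoose (i + 1)).eval x * (risingChoose (i + 1)).eval (x - 1) := by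
    rw [show 1 - i - x - 1 = -(x + i) by ring, show 1 - i - x = -(x + i - 1) by ring,
      risingChoose_eval_neg, risingChoose_eval_neg, mul_mul_mul_comm, ← mul_pow, neg_mul_neg,
      one_mul, one_pow, one_mul, mul_comm]
    congr 2 <;> push_cast <;> ring
  have h4 := risingChoose_succ_sub (2 * i + 1) (2 * x - 1)
  rw [show 2 * x - 1 - 1 = 2 * x - 2 by ring] at h4
  rw [convexCount_eval i.succ_ne_zero, convexCount_eval i.succ_ne_zero, h1, h3, oddCount_eval]
  simp only [show 2 * (i + 1) = 2 * i + 1 + 1 by ring, Nat.add_sub_cancel]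
  rw [h2]
  push_cast
  linear_combination ((i : ℝ) + 2) * h4

theorem convexCount_eval_intCast {i : ℕ} {n : ℤ} (h : 1 - i ≤ n) (h' : n ≤ 0) :
    (convexCount (i + 1)).eval (n : ℝ) = 0 := by
  rw [convexCount_eval i.succ_ne_zero,
    show 2 * (n : ℝ) - 2 = ((2 * n - 2 : ℤ) : ℝ) by push_cast; ring,
    show 2 * (n : ℝ) - 1 = ((2 * n - 1 : ℤ) : ℝ) by push_cast; ring,
    risingChoose_eval_intCast (by omega) (by push_cast; omega),
    risingChoose_eval_intCast (by omega) (by omega),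
    risingChoose_eval_intCast (n := n) h' (by push_cast; omega)]
  ring

theorem convexCount_inversion {i : ℕ} {R A : RatFun 1} (hR : HasVal (halfLine (convexCount (i + 1))) R)
    (hA : HasVal (halfLine (oddCount i)) A) :
    R + monom ![1 - (i : ℤ)] * invVars 1 R = -(i * A) := by
  have h := hR.halfLine_comp (v := 1 - i) (Q := convexCount (i + 1) + C (i : ℝ) * oddCount i)
    (by omega) (fun n => convexCount_eval_intCast) (fun n _ => by
      rw [Int.cast_sub, Int.cast_one, Int.cast_natCast, convexCount_reflect, eval_add, eval_mul,
        eval_C])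
  have h2 := hR.add (hA.smul (i : ℝ))
  rw [map_natCast] at h2
  have h3 := h.unique (S := R + (i : RatFun 1) * A) (by
    convert h2 using 1
    ext w
    simp only [halfLine, Pi.add_apply, Pi.smul_apply, eval_add, eval_mul, eval_C, smul_eq_mul]
    split_ifs
    · rfl
    · ring)
  linear_combination -h3

/-- In width one there is one polygon for each n ≥ 1, and the sums over n ≥ 1 and over n ≥ 2 differ
by y. -/
theorem convexCount_zero_inversion {R : RatFun 1} (hR : HasVal (halfLine (convexCount 0)) R) :
    R + monom ![2] * invVars 1 R = monom ![1] := by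
  have h := hR.sub (hR.halfLine_reflect 2)
  rw [sub_neg_eq_add] at h
  refine h.unique ?_
  rw [monom]
  convert hasVal_toSeries (AddMonoidAlgebra.single ![1] 1 : Laurent 1) using 1
  ext w
  simp only [halfLine, convexCount_zero, eval_one, Pi.sub_apply, toSeries,
    AddMonoidAlgebra.coeff_single, Finsupp.single_apply, vecOne_eq_iff]
  rcases lt_trichotomy (w 0) 1 with h | h | h
  · rw [if_neg (by omega), if_neg (by omega), if_neg (by omega), sub_zero]
  · rw [if_pos (by omega), if_neg (by omega), if_pos h, sub_zero]
  · rw [if_pos (by omega), if_pos (by omega), if_neg (by omega), sub_self]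

end Polyomino
end

/-! ### The generating function of the defects, and the relation for convex polygons. -/

noncomputable section

namespace Polyomino

open ColumnConvexPolygon Polynomial

theorem risingChoose_second_difference (a : ℕ) (x : ℝ) :
    (risingChoose (a + 2)).eval x - 2 * (risingChoose (a + 2)).eval (x - 1) +
      (risingChoose (a + 2)).eval (x - 2) = (risingChoose a).eval x := by
  have h1 := risingChoose_succ_sub (a + 1) x
  have h2 := risingChoose_succ_sub (a + 1) (x - 1)
  have h3 := risingChoose_succ_sub a x
  rw [show x - 1 - 1 = x - 2 by ring] at h2
  linear_combination h1 - h2 + h3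

/-- With S the shift by one, (1 - S²)² = (1 + S)² (1 - S)². -/
theorem risingChoose_second_difference_two (a : ℕ) (x : ℝ) :
    (risingChoose (a + 2)).eval x - 2 * (risingChoose (a + 2)).eval (x - 2) +
      (risingChoose (a + 2)).eval (x - 4) =
      (risingChoose a).eval x + 2 * (risingChoose a).eval (x - 1) + (risingChoose a).eval (x - 2) := by
  have h0 := risingChoose_second_difference a x
  have h1 := risingChoose_second_difference a (x - 1)
  have h2 := risingChoose_second_difference a (x - 2)
  rw [show x - 1 - 1 = x - 2 by ring, show x - 1 - 2 = x - 3 by ring] at h1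
  rw [show x - 2 - 1 = x - 3 by ring, show x - 2 - 2 = x - 4 by ring] at h2
  linear_combination h0 + 2 * h1 + h2

theorem oddCount_second_difference (i : ℕ) (x : ℝ) :
    (oddCount (i + 1)).eval x - 2 * (oddCount (i + 1)).eval (x - 1) +
      (oddCount (i + 1)).eval (x - 2) =
      (risingChoose (2 * i + 1)).eval (2 * x - 1) + 2 * (risingChoose (2 * i + 1)).eval (2 * x - 2) +
        (risingChoose (2 * i + 1)).eval (2 * x - 3) := by
  have h := risingChoose_second_difference_two (2 * i + 1) (2 * x - 1)
  rw [show 2 * x - 1 - 2 = 2 * (x - 1) - 1 by ring,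
    show 2 * x - 1 - 4 = 2 * (x - 2) - 1 by ring, show 2 * x - 1 - 1 = 2 * x - 2 by ring,
    show 2 * i + 1 + 2 = 2 * (i + 1) + 1 by ring] at h
  rw [oddCount_eval, oddCount_eval, oddCount_eval, h]
  congr 2
  ring

theorem oddCount_zero_eval (x : ℝ) : (oddCount 0).eval x = 2 * x - 1 := by
  rw [oddCount_eval, mul_zero, zero_add, risingChoose_one_eval]

theorem oddCount_zero_recurrence (x : ℝ) :
    (oddCount 0).eval x - 2 * (oddCount 0).eval (x - 1) + (oddCount 0).eval (x - 2) = 0 := by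
  simp only [oddCount_zero_eval]
  ring

theorem oddCount_one_recurrence (x : ℝ) :
    (oddCount 1).eval x - 2 * (oddCount 1).eval (x - 1) + (oddCount 1).eval (x - 2) =
      2 * (oddCount 0).eval x + 2 * (oddCount 0).eval (x - 1) := by
  rw [oddCount_second_difference 0]
  simp only [oddCount_zero_eval, mul_zero, zero_add, risingChoose_one_eval]
  ring

/-- This is the recurrence encoded by Δ = (1 - y)² - 2 (1 + y) x + x², where y shifts the argument
and x shifts the index. -/
theorem oddCount_recurrence (i : ℕ) (x : ℝ) :
    (oddCount (i + 2)).eval x - 2 * (oddCount (i + 2)).eval (x - 1) +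
      (oddCount (i + 2)).eval (x - 2) =
      2 * (oddCount (i + 1)).eval x + 2 * (oddCount (i + 1)).eval (x - 1) -
        (oddCount i).eval x := by
  have h := risingChoose_second_difference (2 * i + 1) (2 * x - 1)
  rw [show 2 * x - 1 - 1 = 2 * x - 2 by ring, show 2 * x - 1 - 2 = 2 * x - 3 by ring,
    show 2 * i + 1 + 2 = 2 * (i + 1) + 1 by ring] at h
  rw [oddCount_second_difference (i + 1), oddCount_eval, oddCount_eval, oddCount_eval,
    show 2 * (x - 1) - 1 = 2 * x - 3 by ring]
  linear_combination -h

/-- A linear relation between polynomials and their shifts, passed to the values of the series. -/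
theorem HasVal.halfLine_recurrence {P₀ P₁ P₂ : ℝ[X]} {R₀ R₁ R₂ : RatFun 1}
    (h₀ : HasVal (halfLine P₀) R₀) (h₁ : HasVal (halfLine P₁) R₁) (h₂ : HasVal (halfLine P₂) R₂)
    (h : ∀ x, P₂.eval x - 2 * P₂.eval (x - 1) + P₂.eval (x - 2) =
      2 * P₁.eval x + 2 * P₁.eval (x - 1) - P₀.eval x) :
    (1 - monom ![1]) ^ 2 * R₂ - 2 * (1 + monom ![1]) * R₁ + R₀ =
      algebraMap ℝ (RatFun 1) (2 * P₂.eval 0 - P₂.eval (-1) + 2 * P₁.eval 0) * monom ![1] -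
        algebraMap ℝ (RatFun 1) (P₂.eval 0) * monom ![1] ^ 2 := by
  -- A shift of a half line leaves a boundary term from the value at 0, and a double shift also one
  -- from the value at -1; they make up the right-hand side.
  have h2' := h₂.halfLine_taylor
  have h1' := h₁.add h₁.halfLine_taylor
  have hs := (((h₂.sub (h2'.add h2')).add h2'.halfLine_taylor).sub (h1'.add h1')).add h₀
  have h0 := hs.unique (S := 0) (by
    convert HasVal.zero using 1
    ext w
    simp only [halfLine, Pi.add_apply, Pi.sub_apply, taylor_eval, Pi.zero_apply]
    split_ifs
    · have h3 := h (w 0)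
      rw [sub_eq_add_neg _ (1 : ℝ), show (w 0 : ℝ) - 2 = w 0 + -1 + -1 by ring] at h3
      linear_combination h3
    · ring)
  simp only [taylor_eval, zero_add, map_sub, map_add, map_mul, map_ofNat] at h0 ⊢
  linear_combination h0

/-! ### The inversion relation of convex polygons -/

theorem discr_eq : discr = PowerSeries.C ((1 - monom ![1]) ^ 2) -
    PowerSeries.C (2 * (1 + monom ![1])) * PowerSeries.X + PowerSeries.X ^ 2 := by
  simp only [discr, cst, map_pow, map_sub, map_mul, map_add, map_one, map_ofNat]
  ring

theorem constantCoeff_discr_ne_zero : PowerSeries.constantCoeff discr ≠ 0 := by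
  rw [discr_eq]
  simpa using one_sub_monom_ne_zero vecOne_ne_zero

theorem mk_mul_discr_eq {A : ℕ → RatFun 1} {a b : RatFun 1}
    (h0 : (1 - monom ![1]) ^ 2 * A 0 = a)
    (h1 : (1 - monom ![1]) ^ 2 * A 1 - 2 * (1 + monom ![1]) * A 0 = b)
    (h : ∀ i, (1 - monom ![1]) ^ 2 * A (i + 2) - 2 * (1 + monom ![1]) * A (i + 1) + A i = 0) :
    PowerSeries.mk A * discr = PowerSeries.C a + PowerSeries.C b * PowerSeries.X := by
  have h2 : PowerSeries.mk A * discr = PowerSeries.C ((1 - monom ![1]) ^ 2) * PowerSeries.mk A -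
      PowerSeries.C (2 * (1 + monom ![1])) * (PowerSeries.mk A * PowerSeries.X) +
      PowerSeries.mk A * PowerSeries.X * PowerSeries.X := by
    rw [discr_eq]
    ring
  rw [h2]
  ext i
  simp only [map_add, map_sub, PowerSeries.coeff_C_mul, PowerSeries.coeff_mk]
  match i with
  | 0 =>
    simp only [PowerSeries.coeff_zero_mul_X, PowerSeries.coeff_zero_X, PowerSeries.coeff_zero_C]
    linear_combination h0
  | 1 =>
    simp only [PowerSeries.coeff_zero_mul_X, PowerSeries.coeff_mk, PowerSeries.coeff_one_X,
      zero_add, PowerSeries.coeff_succ_mul_X (n := 0), PowerSeries.coeff_C, one_ne_zero, if_false]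
    linear_combination h1
  | i + 2 =>
    simp only [PowerSeries.coeff_succ_mul_X, PowerSeries.coeff_mk, PowerSeries.coeff_X,
      PowerSeries.coeff_C]
    rw [if_neg (by omega), if_neg (by omega)]
    linear_combination h i

/-- Multiplied by Δ, both sides become y (1 + y) - y x: the recurrence kills the coefficients from
x² on, and boundary terms give the first two. -/
theorem cst_mul_eq_mk {A : ℕ → RatFun 1} (hA : ∀ i, HasVal (halfLine (oddCount i)) (A i)) :
    cst ![1] * ((1 - PowerSeries.X + cst ![1]) * discr⁻¹) = PowerSeries.mk A := by
  have hz : HasVal (halfLine 0) 0 := by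
    convert HasVal.zero using 1
    ext w
    simp [halfLine]
  rw [← mul_assoc, eq_comm, PowerSeries.eq_mul_inv_iff_mul_eq constantCoeff_discr_ne_zero,
    mk_mul_discr_eq (a := monom ![1] * (1 + monom ![1])) (b := -monom ![1])]
  · simp only [cst, map_mul, map_add, map_one, map_neg]
    ring
  · have h := hz.halfLine_recurrence hz (hA 0) fun x => by
      rw [oddCount_zero_recurrence]; simp
    simp only [oddCount_zero_eval, eval_zero] at h
    norm_num at h
    linear_combination h
  · have h := hz.halfLine_recurrence (hA 0) (hA 1) fun x => by
      rw [oddCount_one_recurrence]; simp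
    have h1 : (oddCount 1).eval 0 = 0 := by
      simpa using oddCount_eval_intCast (i := 1) (n := 0) le_rfl (by simp)
    have h2 : (oddCount 1).eval (-1) = -1 := by
      rw [oddCount_eval, show (2 * (-1) - 1 : ℝ) = -3 by norm_num, risingChoose_eval_neg,
        show (3 - ((2 * 1 + 1 : ℕ) : ℝ) + 1) = (1 : ℕ) by norm_num, risingChoose_eval_natCast]
      norm_num
    rw [h1, h2, oddCount_zero_eval] at h
    norm_num at h
    linear_combination h
  · intro i
    have h := (hA i).halfLine_recurrence (hA (i + 1)) (hA (i + 2)) (oddCount_recurrence i)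
    have h1 (j : ℕ) : (oddCount (j + 1)).eval 0 = 0 := by
      simpa using oddCount_eval_intCast (i := j + 1) (n := 0) le_rfl (by push_cast; omega)
    have h2 : (oddCount (i + 2)).eval (-1) = 0 := by
      simpa using oddCount_eval_intCast (i := i + 2) (n := -1) (by omega) (by push_cast; omega)
    rw [h1, h1, h2] at h
    norm_num at h
    linear_combination h

theorem convex_inversion : ∃ H : ℕ → RatFun 1, IsWidthGF convexPolygons perimOnly H ∧
    PowerSeries.mk H + cst ![3] * inverted (monom ![-1]) (PowerSeries.mk H) =
      PowerSeries.X * cst ![1] - PowerSeries.X ^ 3 * cst ![1] *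
        PowerSeries.derivative (RatFun 1) ((1 - PowerSeries.X + cst ![1]) * discr⁻¹) := by
  choose A hA using fun i => exists_hasVal_halfLine (oddCount i)
  obtain ⟨H, hH, h0, h⟩ := exists_isWidthGF (F := convexPolygons) (f := perimOnly)
    (Q := fun m R => HasVal (halfLine (convexCount (m - 1))) R) (fun M => by
      obtain ⟨R, hR⟩ := exists_hasVal_halfLine (convexCount M)
      refine ⟨R, (isRationalGF_iff _ _ _).2 ⟨finite_perimOnly _, ?_⟩, hR⟩
      rwa [countSeries_eq_halfLine fun n => ncard_convex_halfVertical])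
  refine ⟨H, hH, ?_⟩
  -- Differentiation multiplies the coefficient of x^i by i, the factor in `convexCount_inversion`,
  -- and lowers the exponent by one; the factor x³ then places it at width i + 2.
  have hd (n : ℕ) : PowerSeries.coeff n (cst ![1] * PowerSeries.derivative (RatFun 1)
      ((1 - PowerSeries.X + cst ![1]) * discr⁻¹)) = A (n + 1) * (n + 1) := by
    have h := congrArg (PowerSeries.coeff (n + 1)) (cst_mul_eq_mk hA)
    rw [cst, PowerSeries.coeff_C_mul, PowerSeries.coeff_mk] at h
    rw [cst, PowerSeries.coeff_C_mul, PowerSeries.coeff_derivative, ← mul_assoc, h]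
  ext m
  rw [map_add, coeff_cst_mul_inverted, PowerSeries.coeff_mk, map_sub, mul_assoc]
  have hX : PowerSeries.coeff m (PowerSeries.X * cst (k := 1) ![1]) =
      if m = 1 then monom ![1] else 0 := by
    rw [mul_comm, cst, PowerSeries.coeff_C_mul, PowerSeries.coeff_X, mul_ite, mul_one, mul_zero]
  have hm : ∀ v : ℤ, (3 : ℤ) - m = v →
      monom ![3] * (monom ![-1] ^ m * invVars 1 (H m)) = monom ![v] * invVars 1 (H m) := by
    rintro v rfl
    rw [← monom_nsmul, ← mul_assoc, ← monom_add]
    congr 2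
    ext i; fin_cases i; simp; ring
  rw [hX]
  match m with
  | 0 => simp [h0, PowerSeries.coeff_X_pow_mul']
  | 1 =>
    rw [hm 2 (by norm_num), PowerSeries.coeff_X_pow_mul', if_pos rfl, if_neg (by omega), sub_zero]
    exact convexCount_zero_inversion (h 1 le_rfl)
  | i + 2 =>
    rw [hm (1 - i) (by push_cast; ring), if_neg (by omega), zero_sub,
      convexCount_inversion (h (i + 2) (by omega)) (hA i)]
    cases i with
    -- In width two the defect has factor 0, and the right-hand side has no term below x³ besides x
    -- y.
    | zero => simp [PowerSeries.coeff_X_pow_mul']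
    | succ n =>
      rw [show n + 1 + 2 = n + 3 by ring, PowerSeries.coeff_X_pow_mul, hd]
      push_cast
      ring

end Polyomino
end

theorem mainTheorem4 :
    -- every family, every width, every tuple of linear statistics
    (∀ (𝓕 : Polyomino.Family) (m : ℕ), 1 ≤ m → ∀ (k : ℕ) (a b c d : Fin k → Fin (m + 1) → ℤ),
      (∀ w, {P | P ∈ 𝓕.ofWidth m ∧ Polyomino.linearStat a b c d P = w}.Finite) →
      ∃ R : Polyomino.RatFun k,
        Polyomino.IsRationalGF (𝓕.ofWidth m) (Polyomino.linearStat a b c d) R ∧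
        Polyomino.IsSelfReciprocal R) ∧
    -- column-convex polygons
    (∃ H : ℕ → Polyomino.RatFun 2,
      Polyomino.IsWidthGF Polyomino.columnConvex Polyomino.perimArea H ∧
      (∀ m : ℕ, 1 ≤ m →
        Polyomino.invVars 2 (H m) = -(Polyomino.monom ![-1, -(m : ℤ)] * H m)) ∧
      PowerSeries.mk H + Polyomino.cst ![1, 0] *
        Polyomino.inverted (Polyomino.monom ![0, 1]) (PowerSeries.mk H) = 0) ∧
    -- Ferrers graphs
    (∃ H : ℕ → Polyomino.RatFun 2,
      Polyomino.IsWidthGF Polyomino.ferrers Polyomino.perimArea H ∧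
      ∀ m : ℕ, 1 ≤ m →
        Polyomino.invVars 2 (H m) =
          (-1) ^ m * Polyomino.monom ![(m : ℤ) - 2, ((m : ℤ) ^ 2 - 3 * m) / 2] * H m) ∧
    (∃ H : ℕ → Polyomino.RatFun 1,
      Polyomino.IsWidthGF Polyomino.ferrers Polyomino.perimOnly H ∧
      PowerSeries.mk H - Polyomino.cst ![2] *
        Polyomino.inverted (-Polyomino.monom ![-1]) (PowerSeries.mk H) = 0) ∧
    -- stacks
    (∃ H : ℕ → Polyomino.RatFun 2,
      Polyomino.IsWidthGF Polyomino.stackPolygons Polyomino.perimArea H ∧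
      ∀ m : ℕ, 1 ≤ m →
        Polyomino.invVars 2 (H m) =
          -(Polyomino.monom ![2 * (m : ℤ) - 3, (m : ℤ) ^ 2 - 2 * m] * H m)) ∧
    (∃ H : ℕ → Polyomino.RatFun 1,
      Polyomino.IsWidthGF Polyomino.stackPolygons Polyomino.perimOnly H ∧
      PowerSeries.mk H + Polyomino.cst ![3] *
        Polyomino.inverted (Polyomino.monom ![-2]) (PowerSeries.mk H) = 0) ∧
    -- staircase polygons
    (∃ H : ℕ → Polyomino.RatFun 2,
      Polyomino.IsWidthGF Polyomino.staircase Polyomino.perimArea H ∧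
      (∀ m : ℕ, 2 ≤ m →
        Polyomino.invVars 2 (H m) = -(Polyomino.monom ![(m : ℤ) - 1, 0] * H m)) ∧
      PowerSeries.mk H + Polyomino.cst ![1, 0] *
        Polyomino.inverted (Polyomino.monom ![-1, 0]) (PowerSeries.mk H) = -PowerSeries.X) ∧
    -- directed convex polygons, by perimeter
    (∃ H : ℕ → Polyomino.RatFun 1,
      Polyomino.IsWidthGF Polyomino.directedConvex Polyomino.perimOnly H ∧
      (∀ m : ℕ, 1 ≤ m →
        Polyomino.invVars 1 (H m) = -(Polyomino.monom ![(m : ℤ) - 2] * H m)) ∧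
      PowerSeries.mk H + Polyomino.cst ![2] *
        Polyomino.inverted (Polyomino.monom ![-1]) (PowerSeries.mk H) = 0) ∧
    -- convex polygons, by perimeter
    (∃ H : ℕ → Polyomino.RatFun 1,
      Polyomino.IsWidthGF Polyomino.convexPolygons Polyomino.perimOnly H ∧
      PowerSeries.mk H + Polyomino.cst ![3] *
        Polyomino.inverted (Polyomino.monom ![-1]) (PowerSeries.mk H) =
      PowerSeries.X * Polyomino.cst ![1] - PowerSeries.X ^ 3 * Polyomino.cst ![1] *
        PowerSeries.derivative (Polyomino.RatFun 1)
          ((1 - PowerSeries.X + Polyomino.cst ![1]) * Polyomino.discr⁻¹)) ∧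
    -- bar-graphs
    (∃ H : ℕ → Polyomino.RatFun 2,
      Polyomino.IsWidthGF Polyomino.bargraphs Polyomino.perimArea H ∧
      (∀ m : ℕ, 1 ≤ m →
        Polyomino.invVars 2 (H m) = (-1) ^ m * Polyomino.monom ![-1, -(m : ℤ)] * H m) ∧
      PowerSeries.mk H - Polyomino.cst ![1, 0] *
        Polyomino.inverted (-Polyomino.monom ![0, 1]) (PowerSeries.mk H) = 0) ∧
    -- directed column-convex polygons, by area
    (∃ H : ℕ → Polyomino.RatFun 1,
      Polyomino.IsWidthGF Polyomino.directedColumnConvex Polyomino.areaOnly H ∧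
      (∀ m : ℕ, 1 ≤ m →
        Polyomino.invVars 1 (H m) = -(Polyomino.monom ![-1] * H m)) ∧
      PowerSeries.mk H + Polyomino.cst ![1] *
        Polyomino.inverted 1 (PowerSeries.mk H) = 0) :=
  ⟨fun F _ hm _ a b c d h => F.isSelfReciprocal hm _ a b c d h, Polyomino.columnConvex_inversion,
    Polyomino.ferrers_inversion, Polyomino.ferrers_inversion_perimeter, Polyomino.stack_inversion,
    Polyomino.stack_inversion_perimeter, Polyomino.staircase_inversion,
    Polyomino.directedConvex_inversion, Polyomino.convex_inversion, Polyomino.bargraphs_inversion,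
    Polyomino.directedColumnConvex_inversion⟩
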